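/- **Setting.** Let $G$ be a finite graph, $C$ a clique of $G$, and $H$ an interval graph with $V(H)\subseteq C$ (as a graph on a subset of the clique $C$, $H$ is a subgraph of $G$). Let $\mathcal I$ be the set of connected components of $G-C$. For $I\in\mathcal I$ let $N_C(I)$ (resp. $N^s_C(I)$) be the set of $c\in C$ adjacent to some vertex (resp. to all vertices) of $I$, and put $C(I)=C\setminus N^s_C(I)$, $C^s(I)=C\setminus N_C(I)$. A component $I$ is *ambiguous*, $I\in\mathcal I_a$, if $G[C\cup I]$ has an interval model with $C$ as left-most clique; it is *ambiguous simple* if moreover $N_C(I)=N_C^s(I)$. For distinct $I,J\in\mathcal I_a$ write $I\sqsubset J$ if $C(I)\subseteq C^s(J)$. A subset of $\mathcal I_a$ is a *chain* if any two distinct members are comparable by $\sqsubset$; a set $\mathcal A$ *respects the border* $B$ if $B\subseteq C^s(I)$ for all $I\in\mathcal A$. **Models.** Let $L=L_\circ\cup L_{\text{stick}}$ be the lollipop, a circle and a segment with exactly one common point $P$, an endpoint of the segment. A model of $G$ assigns to the vertices nonempty compact connected subsets $\phi(v)\subseteq L$ such that distinct $u,v$ are adjacent iff $\phi(u)\cap\phi(v)\neq\emptyset$.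 Let $\mathcal I^\phi_\circ$ and $\mathcal I^\phi_{\text{stick}}$ be the sets of $I\in\mathcal I$ with $\bigcup_{v\in I}\phi(v)$ contained in $L_\circ\setminus P$ and in $L_{\text{stick}}\setminus P$, respectively, and let $\prec_\phi$ be the left-to-right order of $\mathcal I^\phi_\circ$ along the open arc $L_\circ\setminus P$. For $c\in C$ let $\phi^*(c)=\{I\in\mathcal I^\phi_\circ: c\in C(I)\}$. The model $\phi$ is *$(C,H)$-centered* if $\{v:P\in\phi(v)\}=C$, $\phi^*(c)=\emptyset$ for $c\in C\setminus V(H)$, $\phi^*(c)\ne\emptyset$ for $c\in V(H)$, and for distinct $u,v\in V(H)$ we have $uv\in E(H)$ iff $\phi^*(u)\cap\phi^*(v)\neq\emptyset$. **Leaves.** Let $\mathbb T$ be a PQ-tree of $H$: its leaves are the maximal cliques of $H$ (none if $V(H)=\emptyset$), and its admissible leaf orders are exactly the orders of the maximal cliques in which the cliques containing any given vertex are consecutive. For an admissible order $\mathbb L_1,\dots,\mathbb L_n$ write $C(\mathbb L_i)$ for the clique of $\mathbb L_i$, and $C(\mathbb L_0)=C(\mathbb L_{n+1})=\emptyset$.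 **Assumptions on the instance.** (a) Distinct ambiguous simple components $I,J$ have $C(I)\neq C(J)$. (b) No ambiguous simple component $I$ has $C(I)=C(\mathbb L_i)\cap C(\mathbb L_{i+1})$ for an admissible order of the leaves and some $0\le i\le n$ (that is, $C(I)$ is not the clique of a minimal sector of an interval model of $H$). Let $\mathcal D$ be a set of ambiguous components each of which belongs to $\mathcal I^\phi_{\text{stick}}$ for every $(C,H)$-centered model $\phi$ of $G$, and let $\mathcal I'=\mathcal I\setminus\mathcal D$. **Good orders.** For a strict linear order $\prec$ of $\mathcal K\subseteq\mathcal I'$ and an admissible order $\mathbb L_1,\dots,\mathbb L_n$ put $inner(\mathbb L_i)=\{I\in\mathcal K:C(I)=C(\mathbb L_i)\}$, $$zone_L(\mathbb L_i)=\{I\in\mathcal K: I\prec inner(\mathbb L_i),\ C(I)\cap(C(\mathbb L_i)\setminus C(\mathbb L_{i-1}))\ne\emptyset\},$$ $$zone_R(\mathbb L_i)=\{I\in\mathcal K: inner(\mathbb L_i)\prec I,\ C(I)\cap(C(\mathbb L_i)\setminus C(\mathbb L_{i+1}))\neq\emptyset\},$$ and let $zone(\mathbb L_i)$ be the union of these three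 sets. Let $B_L=C(\mathbb L_{i-1})\cap C(\mathbb L_i)$ and $B_R=C(\mathbb L_i)\cap C(\mathbb L_{i+1})$. Then $(\mathcal K,\prec)$ is a *good order* if for some admissible order of the leaves, for all $i\in[n]$: 0. every $inner(\mathbb L_i)$ is a nonempty interval of $(\mathcal K,\prec)$, and $inner(\mathbb L_1)\prec\dots\prec inner(\mathbb L_n)$; 1. the sets $zone(\mathbb L_i)$ partition $\mathcal K$ and $zone(\mathbb L_1)\prec\dots\prec zone(\mathbb L_n)$; 2. $zone_L(\mathbb L_i)$ and $zone_R(\mathbb L_i)$ are chains in $(\mathcal I_a,\sqsubseteq)$ that respect the borders $B_L$ and $B_R$, respectively; $\prec$ equals $\sqsubset$ on $zone_L(\mathbb L_i)$ and equals the reverse of $\sqsubset$ on $zone_R(\mathbb L_i)$; 3. if $|inner(\mathbb L_i)|\ge2$, with first element $I_L$ and last element $I_R$, then $inner(\mathbb L_i)\subseteq\mathcal I_a$; the set $inner(\mathbb L_i)\setminus\{I_L,I_R\}$, if nonempty, consists of a single ambiguous simple component; $I\sqsubset I_L$ for all $I\in zone_L(\mathbb L_i)$ and $zone_L(\mathbb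 L_i)\cup\{I_L\}$ respects $B_L$; $I\sqsubset I_R$ for all $I\in zone_R(\mathbb L_i)$ and $zone_R(\mathbb L_i)\cup\{I_R\}$ respects $B_R$; 4. if $inner(\mathbb L_i)=\{I_S\}$, let $C_L=C(\max(zone_L(\mathbb L_i),\sqsubseteq))$ ($C_L=B_L$ if $zone_L(\mathbb L_i)=\emptyset$) and $C_R=C(\max(zone_R(\mathbb L_i),\sqsubseteq))$ ($C_R=B_R$ if $zone_R(\mathbb L_i)=\emptyset$). Then $C_L,C_R$ are cliques of $H$, $N_C(I_S)\setminus N_C^s(I_S)\subseteq(C\setminus C_L)\cup(C\setminus C_R)$, and $G^{ext}(C_L,I_S,C_R)$ is a circular-arc graph, where $G^{ext}(C_L,I_S,C_R)$ is $G[C\cup I_S]$ with two new nonadjacent vertices $v_L,v_R$ whose neighbourhoods are $C\setminus C_L$ and $C\setminus C_R$. A triple $(\mathcal J,\mathcal J',\prec)$ is *good* for $\mathcal I'$ if $\mathcal J,\mathcal J'$ are disjoint with $\mathcal J\cup\mathcal J'=\mathcal I'$, $\prec$ is a strict linear order of $\mathcal J$ and $(\mathcal J,\prec)$ is a good order, and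 $\mathcal J'\cup\mathcal D$ is a chain in $(\mathcal I_a,\sqsubseteq)$. **Lemma.** 1. For every $(C,H)$-centered model $\phi$ of $G$, the triple $(\mathcal I^\phi_\circ,\mathcal I^\phi_{\text{stick}}\setminus\mathcal D,\prec_\phi)$ is good for $\mathcal I'$. 2. For every good triple $(\mathcal J,\mathcal J',\prec)$ for $\mathcal I'$ there is a $(C,H)$-centered model $\phi$ of $G$ with $(\mathcal J,\prec)=(\mathcal I^\phi_\circ,\prec_\phi)$ and $\mathcal J'\cup\mathcal D=\mathcal I^\phi_{\text{stick}}$. In particular, $G$ has a $(C,H)$-centered model if and only if there is a good triple for $\mathcal I'$. -/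

import Mathlib

namespace Lollipop

open Set

/-! ### Intersection models -/

/-- `φ` represents the vertices of `Γ` by nonempty compact connected subsets of `X`, so that distinct
vertices are adjacent iff their sets meet. For `X` a circle the sets are arcs, for `X = ℝ` intervals,
for `X` the lollipop connected subgraphs of its subdivisions. -/
structure IsIntersectionModel {E W : Type*} [TopologicalSpace E] (X : Set E)
    (Γ : SimpleGraph W) (φ : W → Set E) : Prop where
  subset : ∀ v, φ v ⊆ X
  compact : ∀ v, IsCompact (φ v)
  connected : ∀ v, IsConnected (φ v)
  adj_iff : ∀ u v, u ≠ v → (Γ.Adj u v ↔ (φ u ∩ φ v).Nonempty)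

/-- The circle of the lollipop. -/
def circ : Set ℂ := Metric.sphere 0 1

/-- The stick of the lollipop. -/
def stick : Set ℂ := segment ℝ (1 : ℂ) 2

/-- The lollipop: a circle and a stick with exactly one common point. -/
def lollipop : Set ℂ := circ ∪ stick

/-- The branching point `P`, the common point of the circle and the stick. -/
def branchPt : ℂ := 1

/-- The point of the circle at parameter `t`; the open arc (circle minus `P`) is parametrised
from left to right by `t ∈ (0, 1)`. -/
noncomputable def circPt (t : ℝ) : ℂ := Complex.exp (2 * Real.pi * t * Complex.I)

/-- `Γ` has a circular-arc model. -/
def IsCircularArc {W : Type*} (Γ : SimpleGraph W) : Prop :=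
  ∃ ψ : W → Set ℂ, IsIntersectionModel circ Γ ψ

section Components

variable {V : Type*} (G : SimpleGraph V) (C : Set V)

/-- The set `𝓘` of the (vertex sets of the) connected components of `G - C`. -/
def comps : Set (Set V) :=
  {I | ∃ K : (G.induce Cᶜ).ConnectedComponent, I = Subtype.val '' K.supp}

/-- `N_C(I)`: the vertices of `C` with a neighbour in `I`. -/
def nbr (I : Set V) : Set V := {c ∈ C | ∃ v ∈ I, G.Adj c v}

/-- `N^s_C(I)`: the vertices of `C` adjacent to all of `I`. -/
def strongNbr (I : Set V) : Set V := {c ∈ C | ∀ v ∈ I, G.Adj c v}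

/-- `C(I) = C \ N^s_C(I)`. -/
def cl (I : Set V) : Set V := C \ strongNbr G C I

/-- `C^s(I) = C \ N_C(I)`. -/
def clS (I : Set V) : Set V := C \ nbr G C I

/-- The set `𝓘_a` of ambiguous components: `G[C ∪ I]` has an interval model with `C` as the
left-most clique. -/
def ambiguous : Set (Set V) :=
  {I ∈ comps G C | ∃ ψ : ↥(C ∪ I) → Set ℝ,
    IsIntersectionModel univ (G.induce (C ∪ I)) ψ ∧
    ∃ p : ℝ, ∀ v, (v.1 ∈ C → p ∈ ψ v) ∧ (v.1 ∉ C → ∀ x ∈ ψ v, p < x)}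

/-- The set of ambiguous simple components: no vertex of `C` is adjacent to some but not all
vertices of the component. -/
def ambiguousSimple : Set (Set V) := {I ∈ ambiguous G C | nbr G C I = strongNbr G C I}

/-- The relation `I ⊏ J` (used for `I, J ∈ 𝓘_a`). -/
def Below (I J : Set V) : Prop := I ≠ J ∧ cl G C I ⊆ clS G C J

/-- `𝓐` is a chain in `(𝓘_a, ⊑)`. -/
def IsChainAmb (A : Set (Set V)) : Prop :=
  A ⊆ ambiguous G C ∧ ∀ I ∈ A, ∀ J ∈ A, I = J ∨ Below G C I J ∨ Below G C J I

/-- `𝓐` respects the border `B`. -/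
def Respects (A : Set (Set V)) (B : Set V) : Prop := ∀ I ∈ A, B ⊆ clS G C I

/-- The graph `G^ext(C_L, I, C_R)`: `G[C ∪ I]` with two new nonadjacent vertices,
`v_L = inr false` with neighbourhood `C \ C_L` and `v_R = inr true` with neighbourhood `C \ C_R`. -/
def extGraph (CL I CR : Set V) : SimpleGraph (↥(C ∪ I) ⊕ Bool) :=
  SimpleGraph.fromRel fun x y =>
    match x, y with
    | .inl u, .inl v => G.Adj u.1 v.1
    | .inl u, .inr false => u.1 ∈ C \ CL
    | .inl u, .inr true => u.1 ∈ C \ CR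
    | .inr _, _ => False

/-! ### Centered models -/

/-- `𝓘^φ_∘`: the components represented on the circle without `P`. -/
def circleComps (φ : V → Set ℂ) : Set (Set V) :=
  {I ∈ comps G C | ∀ v ∈ I, φ v ⊆ circ \ {branchPt}}

/-- `𝓘^φ_stick`: the components represented on the stick without `P`. -/
def stickComps (φ : V → Set ℂ) : Set (Set V) :=
  {I ∈ comps G C | ∀ v ∈ I, φ v ⊆ stick \ {branchPt}}

/-- `I ≺_φ J`: on the circle without `P`, `I` is represented to the left of `J`. -/
def prec (φ : V → Set ℂ) (I J : Set V) : Prop :=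
  ∀ s ∈ Ioo (0 : ℝ) 1, ∀ t ∈ Ioo (0 : ℝ) 1,
    circPt s ∈ (⋃ v ∈ I, φ v) → circPt t ∈ (⋃ v ∈ J, φ v) → s < t

/-- The components on the circle which are not completely adjacent to `c`. In a model with `C` at
`P` they are consecutive in the order `≺_φ`; this is the interval `φ*(c)`. -/
def gap (φ : V → Set ℂ) (c : V) : Set (Set V) := {I ∈ circleComps G C φ | c ∈ cl G C I}

variable {G} in
/-- `φ` is a `(C, H)`-centered model of `G`: a lollipop model where exactly the vertices of `C`
contain `P`, and where the intervals `φ*(c)`, `c ∈ C`, are empty for `c ∉ V(H)` and form an interval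
model of `H` for `c ∈ V(H)`. -/
structure IsCenteredModel (H : G.Subgraph) (φ : V → Set ℂ) : Prop where
  model : IsIntersectionModel lollipop G φ
  center : ∀ v, branchPt ∈ φ v ↔ v ∈ C
  gap_nonempty : ∀ c ∈ H.verts, (gap G C φ c).Nonempty
  gap_empty : ∀ c ∈ C \ H.verts, gap G C φ c = ∅
  gap_adj : ∀ u ∈ H.verts, ∀ v ∈ H.verts, u ≠ v →
    (H.Adj u v ↔ (gap G C φ u ∩ gap G C φ v).Nonempty)

variable {G} in
/-- The ambiguous components that lie on the stick in every `(C, H)`-centered model. -/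
def forcedToStick (H : G.Subgraph) : Set (Set V) :=
  {I ∈ ambiguous G C | ∀ φ : V → Set ℂ, IsCenteredModel C H φ → I ∈ stickComps G C φ}

end Components

/-! ### PQ-trees and orders of the maximal cliques -/

/-- PQ-trees with leaves labelled by `α`. -/
inductive PQTree (α : Type*) where
  | leaf : α → PQTree α
  | pnode : List (PQTree α) → PQTree α
  | qnode : List (PQTree α) → PQTree α

/-- The admissible orders of the leaves: children of P-nodes may be permuted arbitrarily, the order
of the children of a Q-node may only be kept or reversed. -/
inductive PQTree.Admissible {α : Type*} : PQTree α → List α → Prop where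
  | leaf (a : α) : PQTree.Admissible (.leaf a) [a]
  | pnode (ts us : List (PQTree α)) (ls : List (List α)) :
      us.Perm ts → List.Forall₂ PQTree.Admissible us ls → PQTree.Admissible (.pnode ts) ls.flatten
  | qnode (ts us : List (PQTree α)) (ls : List (List α)) :
      us = ts ∨ us = ts.reverse → List.Forall₂ PQTree.Admissible us ls →
      PQTree.Admissible (.qnode ts) ls.flatten

section Cliques

variable {V : Type*} {G : SimpleGraph V} (H : G.Subgraph)

/-- `K` is a (possibly empty) clique of `H`. -/
def IsCliqueOf (K : Set V) : Prop := K ⊆ H.verts ∧ K.Pairwise H.Adj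

/-- `K` is a maximal clique of `H`; the graph without vertices has none. -/
def IsMaxCliqueOf (K : Set V) : Prop :=
  K.Nonempty ∧ IsCliqueOf H K ∧ ∀ K', IsCliqueOf H K' → K ⊆ K' → K' = K

/-- `l` lists the maximal cliques of `H`, those containing any given vertex consecutively. -/
def IsConsecutive (l : List (Set V)) : Prop :=
  l.Nodup ∧ (∀ K, K ∈ l ↔ IsMaxCliqueOf H K) ∧
    ∀ v ∈ H.verts, ∀ i j k : Fin l.length, i ≤ j → j ≤ k →
      v ∈ l.get i → v ∈ l.get k → v ∈ l.get j

/-- `T` is a PQ-tree of `H`: its leaves are the maximal cliques of `H` and its admissible orders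
are exactly the consecutive orders. -/
def IsPQTreeOf (T : PQTree (Set V)) : Prop := ∀ l, T.Admissible l ↔ IsConsecutive H l

/-- `C(𝕃_i)` for an order `𝕃_1, …, 𝕃_n`, with `C(𝕃_0) = C(𝕃_{n+1}) = ∅`. -/
def leafAt (l : List (Set V)) (i : ℕ) : Set V := (∅ :: l).getD i ∅

/-- `B = C(S)` for a minimal sector `S` of some interval model of `H`, that is, for a sector between
two consecutive maximal cliques, before the first one or after the last one. -/
def IsMinSectorClique (B : Set V) : Prop :=
  ∃ l, IsConsecutive H l ∧ ∃ i ≤ l.length, B = leafAt l i ∩ leafAt l (i + 1)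

end Cliques

/-! ### Good orders and good triples -/

section Good

variable {V : Type*} (G : SimpleGraph V) (C : Set V)

/-- `r` is a strict linear order of the set `K`. -/
def IsStrictLinearOn {α : Type*} (K : Set α) (r : α → α → Prop) : Prop :=
  (∀ a ∈ K, ¬ r a a) ∧ (∀ a ∈ K, ∀ b ∈ K, ∀ c ∈ K, r a b → r b c → r a c) ∧
    ∀ a ∈ K, ∀ b ∈ K, a ≠ b → r a b ∨ r b a

/-- `A ≺ B`: all elements of `A` precede all elements of `B`. -/
def SetPrec {α : Type*} (r : α → α → Prop) (A B : Set α) : Prop := ∀ a ∈ A, ∀ b ∈ B, r a b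

/-- `A` is a nonempty interval of `(K, r)`, for `A ⊆ K`. -/
def IsNonemptyInterval {α : Type*} (K : Set α) (r : α → α → Prop) (A : Set α) : Prop :=
  A.Nonempty ∧ ∀ a ∈ A, ∀ b ∈ A, ∀ x ∈ K, r a x → r x b → x ∈ A

variable (K : Set (Set V)) (r : Set V → Set V → Prop) (l : List (Set V))

/-- `inner^K(𝕃_i)`. -/
def inner (i : ℕ) : Set (Set V) := {I ∈ K | cl G C I = leafAt l i}

/-- `zone_L(𝕃_i)`, for `1 ≤ i ≤ n`. -/
def zoneL (i : ℕ) : Set (Set V) :=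
  {I ∈ K | SetPrec r {I} (inner G C K l i) ∧
    (cl G C I ∩ (leafAt l i \ leafAt l (i - 1))).Nonempty}

/-- `zone_R(𝕃_i)`, for `1 ≤ i ≤ n`. -/
def zoneR (i : ℕ) : Set (Set V) :=
  {I ∈ K | SetPrec r (inner G C K l i) {I} ∧
    (cl G C I ∩ (leafAt l i \ leafAt l (i + 1))).Nonempty}

/-- `zone(𝕃_i)`. -/
def zone (i : ℕ) : Set (Set V) :=
  zoneL G C K r l i ∪ inner G C K l i ∪ zoneR G C K r l i

/-- `B = C(I')` for the maximum `I'` of the chain `(Z, ⊑)`, and `B = border` if `Z` is empty. -/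
def IsSideClique (Z : Set (Set V)) (border B : Set V) : Prop :=
  (∃ I' ∈ Z, (∀ I ∈ Z, I = I' ∨ Below G C I I') ∧ B = cl G C I') ∨ (Z = ∅ ∧ B = border)

variable {G} in
/-- The conditions on a strict linear order `r` of `K` to be a good order for the root of the
PQ-tree `T` of `H` (with empty borders), where `l` is the order of the leaves induced by `(K, r)`. -/
structure IsGoodOrderWith (H : G.Subgraph) (T : PQTree (Set V)) : Prop where
  /-- `(K, r)` is nice to the root and induces the admissible order `l`. -/
  interval : ∀ i ∈ Icc 1 l.length, IsNonemptyInterval K r (inner G C K l i)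
  induced : ∀ i ∈ Icc 1 l.length, ∀ j ∈ Icc 1 l.length, i < j →
    SetPrec r (inner G C K l i) (inner G C K l j)
  admissible : T.Admissible l
  /-- The zones partition `K` and are ordered by `r`. -/
  zone_union : K = ⋃ i ∈ Icc 1 l.length, zone G C K r l i
  zone_disjoint : ∀ i ∈ Icc 1 l.length, ∀ j ∈ Icc 1 l.length, i ≠ j →
    Disjoint (zone G C K r l i) (zone G C K r l j)
  zone_prec : ∀ i ∈ Icc 1 l.length, ∀ j ∈ Icc 1 l.length, i < j →
    SetPrec r (zone G C K r l i) (zone G C K r l j)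
  /-- Left and right zones are chains respecting their borders, ordered by `⊏`, respectively by
  its reverse. -/
  zoneL_chain : ∀ i ∈ Icc 1 l.length,
    IsChainAmb G C (zoneL G C K r l i) ∧
    Respects G C (zoneL G C K r l i) (leafAt l (i - 1) ∩ leafAt l i) ∧
    ∀ I ∈ zoneL G C K r l i, ∀ J ∈ zoneL G C K r l i, (Below G C I J ↔ r I J)
  zoneR_chain : ∀ i ∈ Icc 1 l.length,
    IsChainAmb G C (zoneR G C K r l i) ∧
    Respects G C (zoneR G C K r l i) (leafAt l i ∩ leafAt l (i + 1)) ∧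
    ∀ I ∈ zoneR G C K r l i, ∀ J ∈ zoneR G C K r l i, (Below G C I J ↔ r J I)
  /-- Leaves with at least two inner components, `I_L` being the first and `I_R` the last one. -/
  multi : ∀ i ∈ Icc 1 l.length, (inner G C K l i).Nontrivial →
    ∀ IL ∈ inner G C K l i, (∀ X ∈ inner G C K l i, X ≠ IL → r IL X) →
    ∀ IR ∈ inner G C K l i, (∀ X ∈ inner G C K l i, X ≠ IR → r X IR) →
      inner G C K l i ⊆ ambiguous G C ∧
      (inner G C K l i \ {IL, IR}).Subsingleton ∧
      inner G C K l i \ {IL, IR} ⊆ ambiguousSimple G C ∧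
      SetPrec (Below G C) (zoneL G C K r l i) {IL} ∧
      Respects G C (zoneL G C K r l i ∪ {IL}) (leafAt l (i - 1) ∩ leafAt l i) ∧
      SetPrec (Below G C) (zoneR G C K r l i) {IR} ∧
      Respects G C (zoneR G C K r l i ∪ {IR}) (leafAt l i ∩ leafAt l (i + 1))
  /-- Leaves with exactly one inner component. -/
  single : ∀ i ∈ Icc 1 l.length, ∀ IS, inner G C K l i = {IS} →
    ∃ CL CR : Set V,
      IsSideClique G C (zoneL G C K r l i) (leafAt l (i - 1) ∩ leafAt l i) CL ∧
      IsSideClique G C (zoneR G C K r l i) (leafAt l i ∩ leafAt l (i + 1)) CR ∧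
      IsCliqueOf H CL ∧ IsCliqueOf H CR ∧
      nbr G C IS \ strongNbr G C IS ⊆ (C \ CL) ∪ (C \ CR) ∧
      IsCircularArc (extGraph G C CL IS CR)

variable {G} in
/-- `(K, r)` is a good order for the root of the PQ-tree `T` of `H`. -/
def IsGoodOrder (H : G.Subgraph) (T : PQTree (Set V)) : Prop :=
  IsStrictLinearOn K r ∧ ∃ l, IsGoodOrderWith C K r l H T

variable {G} in
/-- `(J, J', r)` is a good triple for `𝓘' = 𝓘 \ D`. -/
def IsGoodTriple (H : G.Subgraph) (T : PQTree (Set V)) (D J J' : Set (Set V))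
    (r : Set V → Set V → Prop) : Prop :=
  J ∪ J' = comps G C \ D ∧ Disjoint J J' ∧ IsGoodOrder C J r H T ∧ IsChainAmb G C (J' ∪ D)

end Good

end Lollipop

namespace Lollipop

open Set

/-! ### Coordinates on the lollipop -/

/-! Cutting the circle at P turns the model into a picture on the real line: a vertex of a component
is an interval [l, r], and a vertex c of C, whose set contains P, is the complement of an open gap
(a, b). Hence c is adjacent to v iff l v ≤ a c or b c ≤ r v (`IsLineModel`). The stick is the same
picture with the right threshold b out of reach.

From model to good order. If c misses a vertex of I and a vertex of J, its gap covers everything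
between them. So I ≺ X ≺ J implies C(I) ∩ C(J) ⊆ C^s(X) (`IsLineModel.inter_subset_clS`). Helly's
theorem for the intervals φ*(c) realizes every maximal clique of H as some C(I). The structure
`IsCentralOrder` keeps these facts, together with criteria for being ambiguous and for G^ext being a
circular-arc graph; the good-order conditions then follow combinatorially. If every c ∈ C(X) also
lies in C(J) for some J to the right of X, no vertex of C(X) reaches X from the right, so X is
ambiguous; symmetrically on the left. A component in no zone would be ambiguous simple with the
clique of a minimal sector, against assumption (b) (`IsCentralOrderWith.exists_mem_zone`).
Assumption (a) makes ⊏ antisymmetric on ambiguous components and leaves at most one middle inner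
component.

From good order to model. Disjointness of the zones and the clique conditions force C(X) ⊆ C(𝕃_i)
for X in the i-th zone (`IsGoodOrderWith.cl_subset_of_zone`), and consecutiveness of the leaves
gives back the gluing condition. Each X has a local model in which a vertex shared with an earlier
component does not reach X from the left, and one shared with a later component does not reach it
from the right. This model comes from ambiguity, or from a circular-arc model of G^ext cut inside
the arc of v_R. The local models are placed side by side in the given order; c takes its left
threshold from the first component with c ∈ C(X) and its right threshold from the last one
(`exists_lineModel`). The chain for the stick is laid out by the same construction, with ⊏ as the
order. -/

theorem continuous_circPt : Continuous circPt := by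
  unfold circPt; fun_prop

theorem circPt_eq_iff (s t : ℝ) : circPt s = circPt t ↔ ∃ n : ℤ, s = t + n := by
  unfold circPt
  rw [Complex.exp_eq_exp_iff_exists_int]
  refine exists_congr fun n => ?_
  have h : (2 * (Real.pi : ℂ) * Complex.I) ≠ 0 := Complex.two_pi_I_ne_zero
  constructor
  · intro e
    have e' : (s : ℂ) = t + n := by
      apply mul_right_cancel₀ h
      linear_combination e
    exact_mod_cast e'
  · intro e
    have e' : (s : ℂ) = t + n := by exact_mod_cast e
    rw [e']; ring

theorem circPt_add_one (t : ℝ) : circPt (t + 1) = circPt t :=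
  (circPt_eq_iff _ _).2 ⟨1, by simp⟩

theorem circPt_zero : circPt 0 = branchPt := by simp [circPt, branchPt]

theorem circPt_one : circPt 1 = branchPt := by
  rw [← circPt_zero, ← circPt_add_one 0, zero_add]

theorem circPt_add (s t : ℝ) : circPt (s + t) = circPt s * circPt t := by
  unfold circPt
  rw [← Complex.exp_add]; push_cast; ring_nf

theorem norm_circPt (t : ℝ) : ‖circPt t‖ = 1 := by
  unfold circPt
  rw [show (2 * Real.pi * t * Complex.I : ℂ) = ((2 * Real.pi * t : ℝ) : ℂ) * Complex.I by
    push_cast; ring]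
  exact Complex.norm_exp_ofReal_mul_I _

theorem circPt_mem_circ (t : ℝ) : circPt t ∈ circ := by simp [circ, norm_circPt]

theorem circPt_inj {s t : ℝ} (hs : s ∈ Ioo (0 : ℝ) 1) (ht : t ∈ Ico (0 : ℝ) 1)
    (h : circPt s = circPt t) : s = t := by
  obtain ⟨n, hn⟩ := (circPt_eq_iff s t).1 h
  have h1 : (n : ℝ) < 1 := by linarith [hs.2, ht.1]
  have h2 : (-1 : ℝ) < n := by linarith [hs.1, ht.2]
  have h3 : n = 0 := by
    have : n < 1 := by exact_mod_cast h1
    have : -1 < n := by exact_mod_cast h2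
    omega
  simpa [h3] using hn

theorem circPt_ne_branchPt {t : ℝ} (ht : t ∈ Ioo (0 : ℝ) 1) : circPt t ≠ branchPt := by
  intro h
  rw [← circPt_zero] at h
  exact ht.1.ne' (circPt_inj ht (by simp) h)

/-- The parameter in `(0, 1)` of a point of the open arc. -/
noncomputable def circParam (z : ℂ) : ℝ := 1 / 2 + Complex.arg (-z) / (2 * Real.pi)

theorem neg_circPt (t : ℝ) :
    -circPt t = Complex.exp ((2 * Real.pi * (t - 1 / 2) : ℝ) * Complex.I) := by
  unfold circPt
  rw [← one_mul (Complex.exp _), ← neg_mul, ← Complex.exp_neg_pi_mul_I, ← Complex.exp_add]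
  push_cast; ring_nf

/-- The sign moves the branch cut of `Complex.arg` to the positive real axis, which meets the circle
only in P. This makes `circParam` continuous on the whole open arc. -/
theorem neg_mem_slitPlane {z : ℂ} (hz : z ∈ circ \ {branchPt}) : -z ∈ Complex.slitPlane := by
  rw [Complex.mem_slitPlane_iff_not_le_zero]
  intro h
  apply hz.2
  have h1 : ‖z‖ = 1 := by simpa [circ] using hz.1
  obtain ⟨h2, h3⟩ := Complex.le_def.1 h
  simp at h2 h3
  have h4 : z = (z.re : ℂ) := Complex.ext (by simp) (by simp [h3])
  rw [h4, Complex.norm_real, Real.norm_of_nonneg h2] at h1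
  rw [mem_singleton_iff, h4, h1]; rfl

theorem circPt_circParam {z : ℂ} (hz : z ∈ circ) : circPt (circParam z) = z := by
  have h1 : ‖-z‖ = 1 := by simpa [circ] using hz
  have h2 := Complex.norm_mul_exp_arg_mul_I (-z)
  have h3 := neg_circPt (circParam z)
  rw [h1] at h2
  have h4 : 2 * Real.pi * (circParam z - 1 / 2) = Complex.arg (-z) := by
    unfold circParam; field_simp; ring
  rw [h4] at h3
  have : -circPt (circParam z) = -z := by rw [h3]; simpa using h2
  simpa using this

theorem circParam_mem {z : ℂ} (hz : z ∈ circ \ {branchPt}) : circParam z ∈ Ioo (0 : ℝ) 1 := by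
  have hpi := Real.pi_pos
  have h1 := Complex.neg_pi_lt_arg (-z)
  have h2 := (Complex.arg_le_pi (-z)).lt_of_ne
    (Complex.slitPlane_arg_ne_pi (neg_mem_slitPlane hz))
  unfold circParam
  constructor
  · have : -(1 / 2) < Complex.arg (-z) / (2 * Real.pi) := by
      rw [lt_div_iff₀ (by positivity)]; linarith
    linarith
  · have : Complex.arg (-z) / (2 * Real.pi) < 1 / 2 := by
      rw [div_lt_iff₀ (by positivity)]; linarith
    linarith

theorem continuousOn_circParam : ContinuousOn circParam (circ \ {branchPt}) := by
  intro z hz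
  refine ContinuousAt.continuousWithinAt ?_
  unfold circParam
  refine continuousAt_const.add (ContinuousAt.div_const ?_ _)
  exact ContinuousAt.comp (f := fun z : ℂ => -z) (g := Complex.arg)
    (Complex.continuousAt_arg (neg_mem_slitPlane hz)) continuousAt_neg

/-- The point of the stick at distance `t` from the branching point. -/
noncomputable def stickPt (t : ℝ) : ℂ := 1 + t

theorem continuous_stickPt : Continuous stickPt := by
  unfold stickPt; fun_prop

theorem mem_stick_iff {z : ℂ} : z ∈ stick ↔ ∃ t ∈ Icc (0 : ℝ) 1, stickPt t = z := by
  unfold stick stickPt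
  rw [segment_eq_image']
  constructor
  · rintro ⟨t, ht, rfl⟩
    exact ⟨t, ht, by norm_num⟩
  · rintro ⟨t, ht, rfl⟩
    exact ⟨t, ht, by norm_num⟩

theorem stickPt_inj {s t : ℝ} (h : stickPt s = stickPt t) : s = t := by
  unfold stickPt at h
  have := add_left_cancel h
  exact_mod_cast this

theorem stickPt_zero : stickPt 0 = branchPt := by simp [stickPt, branchPt]

theorem norm_stickPt {t : ℝ} (ht : 0 ≤ t) : ‖stickPt t‖ = 1 + t := by
  unfold stickPt
  rw [show (1 + t : ℂ) = ((1 + t : ℝ) : ℂ) by push_cast; ring, Complex.norm_real,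
    Real.norm_of_nonneg (by linarith)]

theorem circ_inter_stick {z : ℂ} (h1 : z ∈ circ) (h2 : z ∈ stick) : z = branchPt := by
  obtain ⟨t, ht, rfl⟩ := mem_stick_iff.1 h2
  have : ‖stickPt t‖ = 1 := by simpa [circ] using h1
  rw [norm_stickPt ht.1] at this
  rw [show t = 0 by linarith, stickPt_zero]

/-! ### Shapes of connected sets -/

theorem exists_eq_circPt_image {X : Set ℂ} (hX : X ⊆ circ \ {branchPt}) (hc : IsCompact X)
    (hX' : IsConnected X) : ∃ l r : ℝ, 0 < l ∧ l ≤ r ∧ r < 1 ∧ X = circPt '' Icc l r := by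
  have hcont := continuousOn_circParam.mono hX
  have h1 := eq_Icc_of_connected_compact (hX'.image _ hcont) (hc.image_of_continuousOn hcont)
  set l := sInf (circParam '' X)
  set r := sSup (circParam '' X)
  have hne : (Icc l r).Nonempty := h1 ▸ hX'.nonempty.image _
  have hsub : Icc l r ⊆ Ioo 0 1 := by
    rw [← h1]; rintro _ ⟨z, hz, rfl⟩; exact circParam_mem (hX hz)
  have hlr : l ≤ r := nonempty_Icc.1 hne
  refine ⟨l, r, (hsub ⟨le_rfl, hlr⟩).1, hlr, (hsub ⟨hlr, le_rfl⟩).2, ?_⟩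
  rw [← h1, image_image]
  ext z
  constructor
  · exact fun hz => ⟨z, hz, circPt_circParam (hX hz).1⟩
  · rintro ⟨w, hw, rfl⟩
    show circPt (circParam w) ∈ X
    rwa [circPt_circParam (hX hw).1]

theorem circPt_mem_image_iff {l r t : ℝ} (hl : 0 < l) (hr : r < 1) (ht : t ∈ Ioo (0 : ℝ) 1) :
    circPt t ∈ circPt '' Icc l r ↔ l ≤ t ∧ t ≤ r := by
  constructor
  · rintro ⟨s, hs, h⟩
    have := circPt_inj (s := s) (t := t) ⟨by linarith [hs.1], by linarith [hs.2]⟩ ⟨ht.1.le, ht.2⟩ h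
    rw [← this]; exact hs
  · exact fun h => ⟨t, h, rfl⟩

/-- A set that misses some point of the circle is rotated so that this point becomes P. There it is
the image of one interval, and undoing the rotation modulo integers yields the two pieces next to P.
-/
theorem exists_gap_of_circ {X : Set ℂ} (hX : X ⊆ circ) (hc : IsCompact X)
    (hX' : IsConnected X) (hP : branchPt ∈ X) :
    ∃ a b : ℝ, ∀ t ∈ Ioo (0 : ℝ) 1, (circPt t ∈ X ↔ t ≤ a ∨ b ≤ t) := by
  by_cases hs : ∃ s ∈ Ioo (0 : ℝ) 1, circPt s ∉ X
  swap
  · push Not at hs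
    -- The set contains the whole open arc; thresholds with b ≤ a describe an empty gap.
    exact ⟨1, 0, fun t ht => ⟨fun _ => Or.inl ht.2.le, fun _ => hs t ht⟩⟩
  obtain ⟨s, hs, hsX⟩ := hs
  have hcont : Continuous fun z : ℂ => z * circPt (-s) := by fun_prop
  have hcancel : circPt (-s) * circPt s = 1 := by
    rw [← circPt_add]; simp [circPt_zero, branchPt]
  obtain ⟨l, r, hl, hlr, hr, e⟩ := exists_eq_circPt_image (X := (fun z => z * circPt (-s)) '' X)
    (by
      rintro _ ⟨z, hz, rfl⟩
      have h1 : ‖z‖ = 1 := by simpa [circ] using hX hz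
      refine ⟨by simp [circ, norm_circPt, h1], fun h => hsX ?_⟩
      have h2 : z * circPt (-s) = 1 := h
      have : z = circPt s := by linear_combination circPt s * h2 - z * hcancel
      rwa [← this])
    (hc.image hcont) (hX'.image _ hcont.continuousOn)
  have hmem : ∀ t, circPt t ∈ X ↔ ∃ n : ℤ, l ≤ t - s + n ∧ t - s + n ≤ r := by
    intro t
    have h0 : circPt t ∈ X ↔ circPt (t - s) ∈ (fun z => z * circPt (-s)) '' X := by
      constructor
      · exact fun h => ⟨_, h, by rw [sub_eq_add_neg, circPt_add]⟩
      · rintro ⟨z, hz, h⟩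
        simp only [sub_eq_add_neg, circPt_add] at h
        have : z = circPt t := by linear_combination circPt s * h - (z - circPt t) * hcancel
        rwa [← this]
    rw [h0, e]
    constructor
    · rintro ⟨u, hu, h⟩
      obtain ⟨n, hn⟩ := (circPt_eq_iff _ _).1 h
      exact ⟨n, by rw [← hn]; exact hu.1, by rw [← hn]; exact hu.2⟩
    · rintro ⟨n, h1, h2⟩
      exact ⟨_, ⟨h1, h2⟩, (circPt_eq_iff _ _).2 ⟨n, rfl⟩⟩
  -- P, taken at parameter 1, lies in the set; this yields l ≤ 1 - s ≤ r, so the rotated interval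
  -- reaches across the cut.
  rw [← circPt_one, hmem] at hP
  obtain ⟨n, hn1, hn2⟩ := hP
  have hn : n = 0 := by
    have h1 : (n : ℝ) < 1 := by linarith [hs.2]
    have h2 : (-1 : ℝ) < n := by linarith [hs.1]
    have : n < 1 := by exact_mod_cast h1
    have : -1 < n := by exact_mod_cast h2
    omega
  subst hn
  simp only [Int.cast_zero, add_zero] at hn1 hn2
  refine ⟨r + s - 1, l + s, fun t ht => ?_⟩
  rw [hmem]
  constructor
  · rintro ⟨m, h1, h2⟩
    have h3 : (m : ℝ) < 2 := by linarith [hs.2, ht.1]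
    have h4 : (-1 : ℝ) < m := by linarith [hs.1, ht.2]
    have h5 : m < 2 := by exact_mod_cast h3
    have h6 : -1 < m := by exact_mod_cast h4
    obtain rfl | rfl : m = 0 ∨ m = 1 := by omega
    · right; simp at h1; linarith
    · left; simp at h2; linarith
  · rintro (h | h)
    · exact ⟨1, by push_cast; linarith [ht.1], by push_cast; linarith⟩
    · exact ⟨0, by push_cast; linarith, by push_cast; linarith [ht.2]⟩

/-- The map z ↦ z / max(1, |z|) retracts the lollipop onto the circle and sends the stick to P, so
the trace on the open arc is unchanged and the circle case applies. -/
theorem exists_gap_of_lollipop {X : Set ℂ} (hX : X ⊆ lollipop) (hc : IsCompact X)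
    (hX' : IsConnected X) (hP : branchPt ∈ X) :
    ∃ a b : ℝ, ∀ t ∈ Ioo (0 : ℝ) 1, (circPt t ∈ X ↔ t ≤ a ∨ b ≤ t) := by
  let ρ : ℂ → ℂ := fun z => z / (max 1 ‖z‖ : ℝ)
  have hρ : Continuous ρ := by
    refine continuous_id.div (by fun_prop) fun z => ?_
    exact_mod_cast (lt_of_lt_of_le one_pos (le_max_left 1 ‖z‖)).ne'
  have hρ1 : ∀ z ∈ circ, ρ z = z := by
    intro z hz
    have h1 : ‖z‖ = 1 := by simpa [circ] using hz
    simp [ρ, h1]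
  have hρ2 : ∀ z ∈ stick, ρ z = branchPt := by
    intro z hz
    obtain ⟨t, ht, rfl⟩ := mem_stick_iff.1 hz
    simp only [ρ, norm_stickPt ht.1, branchPt]
    rw [max_eq_right (by linarith [ht.1]), stickPt]
    push_cast
    apply div_self
    have : (1 + t : ℝ) ≠ 0 := by linarith [ht.1]
    exact_mod_cast this
  have hPc : branchPt ∈ circ := by rw [← circPt_zero]; exact circPt_mem_circ 0
  obtain ⟨a, b, h⟩ := exists_gap_of_circ (X := ρ '' X)
    (by
      rintro _ ⟨z, hz, rfl⟩
      rcases hX hz with hz | hz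
      · rwa [hρ1 z hz]
      · rwa [hρ2 z hz])
    (hc.image hρ) (hX'.image _ hρ.continuousOn) ⟨_, hP, hρ1 _ hPc⟩
  refine ⟨a, b, fun t ht => (?_ : _ ↔ _).trans (h t ht)⟩
  constructor
  · exact fun h => ⟨_, h, hρ1 _ (circPt_mem_circ t)⟩
  · rintro ⟨z, hz, e⟩
    rcases hX hz with hz' | hz'
    · rw [hρ1 z hz'] at e; rwa [← e]
    · rw [hρ2 z hz'] at e
      exact absurd e.symm (circPt_ne_branchPt ht)

theorem exists_eq_stickPt_image {X : Set ℂ} (hX : X ⊆ stick \ {branchPt}) (hc : IsCompact X)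
    (hX' : IsConnected X) : ∃ l r : ℝ, 0 < l ∧ l ≤ r ∧ r ≤ 1 ∧ X = stickPt '' Icc l r := by
  have hcont : Continuous fun z : ℂ => z.re - 1 := by fun_prop
  have hinv : ∀ t : ℝ, (stickPt t).re - 1 = t := by intro t; simp [stickPt]
  have h1 := eq_Icc_of_connected_compact (hX'.image _ hcont.continuousOn) (hc.image hcont)
  set l := sInf ((fun z : ℂ => z.re - 1) '' X)
  set r := sSup ((fun z : ℂ => z.re - 1) '' X)
  have hne : (Icc l r).Nonempty := h1 ▸ hX'.nonempty.image _
  have hsub : Icc l r ⊆ Ioc 0 1 := by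
    rw [← h1]; rintro _ ⟨z, hz, rfl⟩
    obtain ⟨t, ht, rfl⟩ := mem_stick_iff.1 (hX hz).1
    simp only [hinv]
    refine ⟨ht.1.lt_of_ne fun h => (hX hz).2 ?_, ht.2⟩
    rw [← h]; exact stickPt_zero
  have hlr : l ≤ r := nonempty_Icc.1 hne
  refine ⟨l, r, (hsub ⟨le_rfl, hlr⟩).1, hlr, (hsub ⟨hlr, le_rfl⟩).2, ?_⟩
  rw [← h1, image_image]
  have key : ∀ z ∈ X, stickPt (z.re - 1) = z := by
    intro z hz
    obtain ⟨t, ht, rfl⟩ := mem_stick_iff.1 (hX hz).1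
    rw [hinv]
  ext z
  constructor
  · exact fun hz => ⟨z, hz, key z hz⟩
  · rintro ⟨w, hw, rfl⟩
    show stickPt (w.re - 1) ∈ X
    rwa [key w hw]

/-- Here the circle is collapsed to P by the map z ↦ max(Re z - 1, 0) into ℝ. The image is an
interval containing 0, so the trace on the stick is an initial segment. -/
theorem exists_bound_of_lollipop {X : Set ℂ} (hX : X ⊆ lollipop) (hc : IsCompact X)
    (hX' : IsConnected X) (hP : branchPt ∈ X) :
    ∃ d : ℝ, ∀ t ∈ Ioc (0 : ℝ) 1, (stickPt t ∈ X ↔ t ≤ d) := by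
  let ρ : ℂ → ℝ := fun z => max (z.re - 1) 0
  have hρ : Continuous ρ := by fun_prop
  have hρ1 : ∀ z ∈ circ, ρ z = 0 := by
    intro z hz
    have h1 : ‖z‖ = 1 := by simpa [circ] using hz
    have := Complex.re_le_norm z
    exact max_eq_right (by linarith)
  have hρ2 : ∀ t, 0 ≤ t → ρ (stickPt t) = t := by
    intro t ht
    simp [ρ, stickPt, ht]
  have h1 := eq_Icc_of_connected_compact (hX'.image _ hρ.continuousOn) (hc.image hρ)
  have h0 : (0 : ℝ) ∈ ρ '' X := ⟨_, hP, by rw [← stickPt_zero, hρ2 _ le_rfl]⟩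
  refine ⟨sSup (ρ '' X), fun t ht => ?_⟩
  constructor
  · intro h
    have : t ∈ ρ '' X := ⟨_, h, hρ2 _ ht.1.le⟩
    rw [h1] at this
    exact this.2
  · intro h
    have : t ∈ ρ '' X := by
      rw [h1] at h0 ⊢
      exact ⟨h0.1.trans ht.1.le, h⟩
    obtain ⟨z, hz, e⟩ := this
    rcases hX hz with hz' | hz'
    · rw [hρ1 z hz'] at e; exact absurd e ht.1.ne
    · obtain ⟨s, hs, rfl⟩ := mem_stick_iff.1 hz'
      rw [hρ2 _ hs.1] at e
      rwa [← e]

/-! ### Intersections of arcs -/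

theorem image_inter_image_nonempty_iff {l r l' r' : ℝ} (hl : 0 < l) (hlr : l ≤ r) (hr : r < 1)
    (hl' : 0 < l') (hlr' : l' ≤ r') (hr' : r' < 1) :
    (circPt '' Icc l r ∩ circPt '' Icc l' r').Nonempty ↔ l ≤ r' ∧ l' ≤ r := by
  constructor
  · rintro ⟨_, ⟨s, hs, rfl⟩, h⟩
    have := (circPt_mem_image_iff hl' hr' ⟨hl.trans_le hs.1, hs.2.trans_lt hr⟩).1 h
    exact ⟨hs.1.trans this.2, this.1.trans hs.2⟩
  · rintro ⟨h1, h2⟩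
    exact ⟨circPt (max l l'), ⟨_, ⟨le_max_left _ _, max_le hlr h2⟩, rfl⟩,
      ⟨_, ⟨le_max_right _ _, max_le h1 hlr'⟩, rfl⟩⟩

theorem gap_inter_image_nonempty_iff {X : Set ℂ} {a b l r : ℝ}
    (hX : ∀ t ∈ Ioo (0 : ℝ) 1, (circPt t ∈ X ↔ t ≤ a ∨ b ≤ t))
    (hl : 0 < l) (hlr : l ≤ r) (hr : r < 1) :
    (X ∩ circPt '' Icc l r).Nonempty ↔ l ≤ a ∨ b ≤ r := by
  constructor
  · rintro ⟨_, h, s, hs, rfl⟩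
    rcases (hX s ⟨hl.trans_le hs.1, hs.2.trans_lt hr⟩).1 h with h | h
    · exact Or.inl (hs.1.trans h)
    · exact Or.inr (h.trans hs.2)
  · rintro (h | h)
    · exact ⟨circPt l, (hX l ⟨hl, by linarith⟩).2 (Or.inl h), _, ⟨le_rfl, hlr⟩, rfl⟩
    · exact ⟨circPt r, (hX r ⟨by linarith, hr⟩).2 (Or.inr h), _, ⟨hlr, le_rfl⟩, rfl⟩

theorem stickPt_mem_image_iff {l r t : ℝ} : stickPt t ∈ stickPt '' Icc l r ↔ l ≤ t ∧ t ≤ r := by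
  constructor
  · rintro ⟨s, hs, h⟩
    rw [← stickPt_inj h]; exact hs
  · exact fun h => ⟨t, h, rfl⟩

theorem stick_image_inter_image_nonempty_iff {l r l' r' : ℝ} (hlr : l ≤ r) (hlr' : l' ≤ r') :
    (stickPt '' Icc l r ∩ stickPt '' Icc l' r').Nonempty ↔ l ≤ r' ∧ l' ≤ r := by
  constructor
  · rintro ⟨_, ⟨s, hs, rfl⟩, h⟩
    have := stickPt_mem_image_iff.1 h
    exact ⟨hs.1.trans this.2, this.1.trans hs.2⟩
  · rintro ⟨h1, h2⟩
    exact ⟨stickPt (max l l'), ⟨_, ⟨le_max_left _ _, max_le hlr h2⟩, rfl⟩,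
      ⟨_, ⟨le_max_right _ _, max_le h1 hlr'⟩, rfl⟩⟩

theorem bound_inter_stick_image_nonempty_iff {X : Set ℂ} {d l r : ℝ}
    (hX : ∀ t ∈ Ioc (0 : ℝ) 1, (stickPt t ∈ X ↔ t ≤ d))
    (hl : 0 < l) (hlr : l ≤ r) (hr : r ≤ 1) :
    (X ∩ stickPt '' Icc l r).Nonempty ↔ l ≤ d := by
  constructor
  · rintro ⟨_, h, s, hs, rfl⟩
    exact hs.1.trans ((hX s ⟨hl.trans_le hs.1, hs.2.trans hr⟩).1 h)
  · intro h
    exact ⟨stickPt l, (hX l ⟨hl, by linarith⟩).2 h, _, ⟨le_rfl, hlr⟩, rfl⟩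

/-! ### Standard arcs -/

/-- The arc of the open arc `L_∘ \ P`, identified with `ℝ`, that corresponds to `[l, r]`. -/
noncomputable def ivArc (l r : ℝ) : Set ℂ := circPt '' Icc (Real.sigmoid l) (Real.sigmoid r)

/-- The arc through the branching point that leaves the gap `(a, b)` of `L_∘ \ P`, identified
with `ℝ`. -/
noncomputable def gapArc (a b : ℝ) : Set ℂ := circPt '' Icc (Real.sigmoid b - 1) (Real.sigmoid a)

theorem sigmoid_mem (t : ℝ) : Real.sigmoid t ∈ Ioo (0 : ℝ) 1 :=
  ⟨Real.sigmoid_pos t, Real.sigmoid_lt_one t⟩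

theorem isCompact_ivArc (l r : ℝ) : IsCompact (ivArc l r) :=
  isCompact_Icc.image continuous_circPt

theorem isCompact_gapArc (a b : ℝ) : IsCompact (gapArc a b) :=
  isCompact_Icc.image continuous_circPt

theorem isConnected_ivArc {l r : ℝ} (h : l ≤ r) : IsConnected (ivArc l r) :=
  (isConnected_Icc (Real.sigmoid_le h)).image _ continuous_circPt.continuousOn

theorem isConnected_gapArc (a b : ℝ) : IsConnected (gapArc a b) :=
  (isConnected_Icc (by linarith [Real.sigmoid_lt_one b, Real.sigmoid_pos a])).image _
    continuous_circPt.continuousOn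

theorem ivArc_subset (l r : ℝ) : ivArc l r ⊆ circ \ {branchPt} := by
  rintro _ ⟨t, ht, rfl⟩
  exact ⟨circPt_mem_circ t, circPt_ne_branchPt
    ⟨(Real.sigmoid_pos l).trans_le ht.1, ht.2.trans_lt (Real.sigmoid_lt_one r)⟩⟩

theorem gapArc_subset (a b : ℝ) : gapArc a b ⊆ circ := by
  rintro _ ⟨t, -, rfl⟩
  exact circPt_mem_circ t

theorem branchPt_mem_gapArc (a b : ℝ) : branchPt ∈ gapArc a b :=
  ⟨0, ⟨by linarith [Real.sigmoid_lt_one b], (Real.sigmoid_pos a).le⟩, circPt_zero⟩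

theorem circPt_mem_gapArc_iff {a b t : ℝ} (ht : t ∈ Ioo (0 : ℝ) 1) :
    circPt t ∈ gapArc a b ↔ t ≤ Real.sigmoid a ∨ Real.sigmoid b ≤ t := by
  have ha := sigmoid_mem a
  have hb := sigmoid_mem b
  constructor
  · rintro ⟨s, hs, h⟩
    obtain ⟨n, rfl⟩ := (circPt_eq_iff _ _).1 h
    have h1 : (n : ℝ) < 1 := by linarith [hs.2, ha.2, ht.1]
    have h2 : (-2 : ℝ) < n := by linarith [hs.1, hb.1, ht.2]
    have h3 : n < 1 := by exact_mod_cast h1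
    have h4 : -2 < n := by exact_mod_cast h2
    -- The arc is parametrised across 0: its nonnegative parameters are the piece to the right of P,
    -- its negative ones, shifted by 1, the piece to the left of P.
    obtain rfl | rfl : n = 0 ∨ n = -1 := by omega
    · left; simpa using hs.2
    · right; have := hs.1; push_cast at this; linarith
  · rintro (h | h)
    · exact ⟨t, ⟨by linarith [hb.2, ht.1], h⟩, rfl⟩
    · refine ⟨t - 1, ⟨by linarith, by linarith [ht.2, ha.1]⟩, ?_⟩
      rw [← circPt_add_one (t - 1), sub_add_cancel]

theorem ivArc_inter_ivArc {l r l' r' : ℝ} (h : l ≤ r) (h' : l' ≤ r') :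
    (ivArc l r ∩ ivArc l' r').Nonempty ↔ l ≤ r' ∧ l' ≤ r := by
  unfold ivArc
  rw [image_inter_image_nonempty_iff (sigmoid_mem l).1 (Real.sigmoid_le h) (sigmoid_mem r).2
    (sigmoid_mem l').1 (Real.sigmoid_le h') (sigmoid_mem r').2, Real.sigmoid_le_iff,
    Real.sigmoid_le_iff]

theorem gapArc_inter_ivArc {a b l r : ℝ} (h : l ≤ r) :
    (gapArc a b ∩ ivArc l r).Nonempty ↔ l ≤ a ∨ b ≤ r := by
  unfold ivArc
  rw [gap_inter_image_nonempty_iff (fun t ht => circPt_mem_gapArc_iff ht) (sigmoid_mem l).1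
    (Real.sigmoid_le h) (sigmoid_mem r).2, Real.sigmoid_le_iff, Real.sigmoid_le_iff]

/-! ### Components -/

section Comps

variable {V : Type*} {G : SimpleGraph V} {C I J : Set V}

theorem nonempty_of_mem_comps (hI : I ∈ comps G C) : I.Nonempty := by
  obtain ⟨K, rfl⟩ := hI
  exact K.nonempty_supp.image _

theorem notMem_of_mem_comps (hI : I ∈ comps G C) {v : V} (hv : v ∈ I) : v ∉ C := by
  obtain ⟨K, rfl⟩ := hI
  obtain ⟨w, -, rfl⟩ := hv
  exact w.2

theorem eq_of_mem_comps (hI : I ∈ comps G C) (hJ : J ∈ comps G C) {v : V} (hvI : v ∈ I)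
    (hvJ : v ∈ J) : I = J := by
  obtain ⟨K, rfl⟩ := hI
  obtain ⟨K', rfl⟩ := hJ
  obtain ⟨w, hw, rfl⟩ := hvI
  obtain ⟨w', hw', h⟩ := hvJ
  obtain rfl := Subtype.val_injective h
  rw [SimpleGraph.ConnectedComponent.mem_supp_iff] at hw hw'
  rw [← hw, ← hw']

theorem exists_mem_comps {v : V} (hv : v ∉ C) : ∃ I ∈ comps G C, v ∈ I :=
  ⟨_, ⟨(G.induce Cᶜ).connectedComponentMk ⟨v, hv⟩, rfl⟩, ⟨v, hv⟩, rfl, rfl⟩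

theorem mem_comps_of_adj (hI : I ∈ comps G C) {v w : V} (hv : v ∈ I) (hw : w ∉ C)
    (h : G.Adj v w) : w ∈ I := by
  obtain ⟨K, rfl⟩ := hI
  obtain ⟨v, hv, rfl⟩ := hv
  refine ⟨⟨w, hw⟩, ?_, rfl⟩
  exact SimpleGraph.ConnectedComponent.mem_supp_of_adj_mem_supp K hv (by simpa using h)

/-- Connectedness of a component is used only in this form, by induction along a walk. -/
theorem comps_induction (hI : I ∈ comps G C) {P : V → Prop}
    (h : ∀ u ∈ I, ∀ v ∈ I, G.Adj u v → P u → P v) {u : V} (hu : u ∈ I) (hP : P u) {v : V}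
    (hv : v ∈ I) : P v := by
  obtain ⟨K, rfl⟩ := hI
  obtain ⟨u, hu, rfl⟩ := hu
  obtain ⟨v, hv, rfl⟩ := hv
  obtain ⟨p⟩ := K.reachable_of_mem_supp hu hv
  induction p with
  | nil => exact hP
  | cons hadj p ih =>
    have hw := SimpleGraph.ConnectedComponent.mem_supp_of_adj_mem_supp K hu hadj
    exact ih hw (h _ ⟨_, hu, rfl⟩ _ ⟨_, hw, rfl⟩ (by simpa using hadj) hP) hv

theorem not_adj_of_mem_comps (hI : I ∈ comps G C) (hJ : J ∈ comps G C) (hIJ : I ≠ J) {u v : V}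
    (hu : u ∈ I) (hv : v ∈ J) : ¬ G.Adj u v := fun h =>
  hIJ (eq_of_mem_comps hI hJ (mem_comps_of_adj hI hu (notMem_of_mem_comps hJ hv) h) hv)

theorem mem_cl_iff {c : V} : c ∈ cl G C I ↔ c ∈ C ∧ ∃ v ∈ I, ¬ G.Adj c v := by
  simp only [cl, strongNbr, mem_sdiff, mem_sep_iff, not_and, not_forall]
  exact ⟨fun h => ⟨h.1, by simpa using h.2 h.1⟩, fun h => ⟨h.1, fun _ => by simpa using h.2⟩⟩

theorem mem_clS_iff {c : V} : c ∈ clS G C I ↔ c ∈ C ∧ ∀ v ∈ I, ¬ G.Adj c v := by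
  simp only [clS, nbr, mem_sdiff, mem_sep_iff, not_and, not_exists]
  exact ⟨fun h => ⟨h.1, h.2 h.1⟩, fun h => ⟨h.1, fun _ => h.2⟩⟩

theorem clS_subset_cl (hI : I ∈ comps G C) : clS G C I ⊆ cl G C I := by
  intro c hc
  obtain ⟨v, hv⟩ := nonempty_of_mem_comps hI
  rw [mem_clS_iff] at hc
  exact mem_cl_iff.2 ⟨hc.1, v, hv, hc.2 v hv⟩

theorem adj_of_notMem_cl {c v : V} (hc : c ∈ C) (h : c ∉ cl G C I) (hv : v ∈ I) : G.Adj c v := by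
  by_contra h'
  exact h (mem_cl_iff.2 ⟨hc, v, hv, h'⟩)

theorem nbr_eq_strongNbr_iff :
    nbr G C I = strongNbr G C I ↔ clS G C I = cl G C I := by
  have h1 : nbr G C I ⊆ C := fun _ h => h.1
  have h2 : strongNbr G C I ⊆ C := fun _ h => h.1
  unfold clS cl
  constructor
  · intro h; rw [h]
  · intro h
    rw [← sdiff_sdiff_cancel_left h1, h, sdiff_sdiff_cancel_left h2]

end Comps

/-! ### Models on the line -/

section LineModel

variable {V : Type*} {G : SimpleGraph V}

/-- The vertices of `S` are represented by the intervals `[l v, r v]`, and every vertex `c` of `Q`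
by the complement of the open interval `(a c, b c)`. Only adjacencies within `S` and between `Q` and
`S` are recorded. -/
structure IsLineModel (G : SimpleGraph V) (Q S : Set V) (l r a b : V → ℝ) : Prop where
  le : ∀ v ∈ S, l v ≤ r v
  adj : ∀ u ∈ S, ∀ v ∈ S, u ≠ v → (G.Adj u v ↔ l u ≤ r v ∧ l v ≤ r u)
  adj_center : ∀ c ∈ Q, ∀ v ∈ S, (G.Adj c v ↔ l v ≤ a c ∨ b c ≤ r v)

variable {Q S : Set V} {l r a b : V → ℝ}

/-- Reflection of the line exchanges the two thresholds, so statements about one side transfer to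
the other. -/
theorem IsLineModel.neg (h : IsLineModel G Q S l r a b) :
    IsLineModel G Q S (fun v => -r v) (fun v => -l v) (fun v => -b v) (fun v => -a v) where
  le v hv := neg_le_neg (h.le v hv)
  adj u hu v hv huv := by
    rw [h.adj u hu v hv huv, neg_le_neg_iff, neg_le_neg_iff, and_comm]
  adj_center c hc v hv := by
    rw [h.adj_center c hc v hv, neg_le_neg_iff, neg_le_neg_iff, or_comm]

theorem IsLineModel.mono (h : IsLineModel G Q S l r a b) {Q' S' : Set V} (hQ : Q' ⊆ Q)
    (hS : S' ⊆ S) : IsLineModel G Q' S' l r a b where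
  le v hv := h.le v (hS hv)
  adj u hu v hv := h.adj u (hS hu) v (hS hv)
  adj_center c hc v hv := h.adj_center c (hQ hc) v (hS hv)

theorem exists_lt_of_finite [Finite V] (f : V → ℝ) : ∃ m : ℝ, ∀ v, m < f v := by
  obtain ⟨m, hm⟩ := (finite_range f).bddBelow
  exact ⟨m - 1, fun v => by linarith [hm ⟨v, rfl⟩]⟩

theorem exists_gt_of_finite [Finite V] (f : V → ℝ) : ∃ m : ℝ, ∀ v, f v < m := by
  obtain ⟨m, hm⟩ := (finite_range f).bddAbove
  exact ⟨m + 1, fun v => by linarith [hm ⟨v, rfl⟩]⟩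

/-- A graph in which the line model covers a clique and its complement is a circular-arc graph. -/
theorem IsLineModel.isCircularArc {W : Type*} {Γ : SimpleGraph W} {Q : Set W} {l r a b : W → ℝ}
    (h : IsLineModel Γ Q Qᶜ l r a b) (hQ : Γ.IsClique Q) : IsCircularArc Γ := by
  classical
  refine ⟨fun w => if w ∈ Q then gapArc (a w) (b w) else ivArc (l w) (r w), ?_, ?_, ?_, ?_⟩
  · intro w
    split_ifs
    · exact gapArc_subset _ _
    · exact (ivArc_subset _ _).trans sdiff_subset
  · intro w
    split_ifs
    · exact isCompact_gapArc _ _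
    · exact isCompact_ivArc _ _
  · intro w
    split_ifs with hw
    · exact isConnected_gapArc _ _
    · exact isConnected_ivArc (h.le w hw)
  · intro u w huw
    split_ifs with hu hw hw
    · exact ⟨fun _ => ⟨_, branchPt_mem_gapArc _ _, branchPt_mem_gapArc _ _⟩,
        fun _ => hQ hu hw huw⟩
    · rw [gapArc_inter_ivArc (h.le w hw), h.adj_center u hu w hw]
    · rw [inter_comm, gapArc_inter_ivArc (h.le u hu), Γ.adj_comm, h.adj_center w hw u hu]
    · rw [ivArc_inter_ivArc (h.le u hu) (h.le w hw), h.adj u hu w hw huw]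

variable {C X : Set V}

/-- A component none of whose thresholds on the right side is used is ambiguous. -/
theorem IsLineModel.mem_ambiguous [Finite V] (hC : G.IsClique C) (hX : X ∈ comps G C)
    (h : IsLineModel G C X l r a b) (hb : ∀ c ∈ cl G C X, ∀ v ∈ X, r v < b c) :
    X ∈ ambiguous G C := by
  classical
  obtain ⟨m, hm⟩ := exists_lt_of_finite l
  obtain ⟨m', hm'⟩ := exists_gt_of_finite l
  -- All vertices of C start at m, to the left of X. Those in C(X) extend to their left threshold,
  -- since by assumption the right one never matters; the others must meet all of X and extend to
  -- m', beyond every left endpoint.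
  refine ⟨hX, fun w => if w.1 ∈ C then
    (if w.1 ∈ cl G C X then Icc m (max m (a w.1)) else Icc m (max m m'))
    else Icc (l w.1) (r w.1), ⟨fun _ => subset_univ _, ?_, ?_, ?_⟩, m, ?_⟩
  · intro w
    split_ifs <;> exact isCompact_Icc
  · intro w
    split_ifs with h1 h2
    · exact isConnected_Icc (le_max_left _ _)
    · exact isConnected_Icc (le_max_left _ _)
    · exact isConnected_Icc (h.le _ (w.2.resolve_left h1))
  · have key : ∀ c ∈ C, ∀ v ∈ X, (G.Adj c v ↔
        ((if c ∈ cl G C X then Icc m (max m (a c)) else Icc m (max m m')) ∩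
          Icc (l v) (r v)).Nonempty) := by
      intro c hc v hv
      have hle := h.le v hv
      have hmv := hm v
      have hmv' := hm' v
      split_ifs with h1
      · rw [h.adj_center c hc v hv]
        have := hb c h1 v hv
        constructor
        · rintro (h2 | h2)
          · exact ⟨l v, ⟨hmv.le, h2.trans (le_max_right _ _)⟩, le_rfl, hle⟩
          · linarith
        · rintro ⟨x, hx, hx'⟩
          rcases le_max_iff.1 (hx'.1.trans hx.2) with h3 | h3
          · linarith
          · exact Or.inl h3
      · refine iff_of_true (adj_of_notMem_cl hc h1 hv) ⟨l v, ⟨hmv.le, ?_⟩, le_rfl, hle⟩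
        exact hmv'.le.trans (le_max_right _ _)
    intro u w huw
    have huw' : u.1 ≠ w.1 := fun h => huw (Subtype.ext h)
    simp only [SimpleGraph.comap_adj, Function.Embedding.subtype_apply]
    by_cases hu : u.1 ∈ C <;> by_cases hw : w.1 ∈ C
    · simp only [hu, hw, if_true]
      refine iff_of_true (hC hu hw huw') ⟨m, ?_, ?_⟩ <;> split_ifs <;>
        exact ⟨le_rfl, le_max_left _ _⟩
    · simp only [hu, hw, if_true, if_false]
      exact key _ hu _ (w.2.resolve_left hw)
    · simp only [hu, hw, if_true, if_false]
      rw [G.adj_comm, inter_comm]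
      exact key _ hw _ (u.2.resolve_left hu)
    · simp only [hu, hw, if_false]
      have hu' := u.2.resolve_left hu
      have hw' := w.2.resolve_left hw
      rw [h.adj _ hu' _ hw' huw', Icc_inter_Icc, nonempty_Icc, sup_le_iff, le_inf_iff, le_inf_iff]
      have := h.le _ hu'
      have := h.le _ hw'
      tauto
  · intro w
    dsimp only
    constructor
    · intro hw
      rw [if_pos hw]
      split_ifs <;> exact ⟨le_rfl, le_max_left _ _⟩
    · intro hw x hx
      rw [if_neg hw] at hx
      exact (hm _).trans_le hx.1

/-- In a line model the components are linearly ordered. -/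
theorem IsLineModel.lt_or_lt {K : Set (Set V)} (hK : K ⊆ comps G C)
    (h : IsLineModel G Q (⋃₀ K) l r a b) {I J : Set V} (hI : I ∈ K) (hJ : J ∈ K) (hIJ : I ≠ J) :
    (∀ u ∈ I, ∀ v ∈ J, r u < l v) ∨ (∀ u ∈ I, ∀ v ∈ J, r v < l u) := by
  -- Being to the left of a fixed v ∈ J propagates along the edges of I: a neighbour not to the left
  -- of v would have to meet v or lie entirely to its right, away from the vertex it is adjacent to.
  have key : ∀ I ∈ K, ∀ J ∈ K, I ≠ J → ∀ u ∈ I, ∀ v ∈ J, r u < l v → ∀ u' ∈ I, r u' < l v := by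
    intro I hI J hJ hIJ u hu v hv huv u' hu'
    refine comps_induction (hK hI) (P := fun w => r w < l v) ?_ hu huv hu'
    intro w hw w' hw' hadj hlt
    have h1 := not_adj_of_mem_comps (hK hI) (hK hJ) hIJ hw' hv
    rw [h.adj _ ⟨I, hI, hw'⟩ _ ⟨J, hJ, hv⟩
      (fun e => hIJ (eq_of_mem_comps (hK hI) (hK hJ) hw' (e ▸ hv)))] at h1
    by_cases e : w = w'
    · rwa [← e]
    have h2 := (h.adj _ ⟨I, hI, hw⟩ _ ⟨I, hI, hw'⟩ e).1 hadj
    have h3 := h.le v ⟨J, hJ, hv⟩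
    by_contra h4
    exact h1 ⟨by linarith, by linarith⟩
  have key' : ∀ I ∈ K, ∀ J ∈ K, I ≠ J → ∀ u ∈ I, ∀ v ∈ J, r v < l u → ∀ u' ∈ I, r v < l u' := by
    intro I hI J hJ hIJ u hu v hv huv u' hu'
    refine comps_induction (hK hI) (P := fun w => r v < l w) ?_ hu huv hu'
    intro w hw w' hw' hadj hlt
    have h1 := not_adj_of_mem_comps (hK hI) (hK hJ) hIJ hw' hv
    rw [h.adj _ ⟨I, hI, hw'⟩ _ ⟨J, hJ, hv⟩
      (fun e => hIJ (eq_of_mem_comps (hK hI) (hK hJ) hw' (e ▸ hv)))] at h1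
    by_cases e : w = w'
    · rwa [← e]
    have h2 := (h.adj _ ⟨I, hI, hw⟩ _ ⟨I, hI, hw'⟩ e).1 hadj
    have h3 := h.le v ⟨J, hJ, hv⟩
    by_contra h4
    exact h1 ⟨by linarith, by linarith⟩
  obtain ⟨u, hu⟩ := nonempty_of_mem_comps (hK hI)
  obtain ⟨v, hv⟩ := nonempty_of_mem_comps (hK hJ)
  have h1 := not_adj_of_mem_comps (hK hI) (hK hJ) hIJ hu hv
  rw [h.adj _ ⟨I, hI, hu⟩ _ ⟨J, hJ, hv⟩
    (fun e => hIJ (eq_of_mem_comps (hK hI) (hK hJ) hu (e ▸ hv))), not_and_or, not_le, not_le] at h1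
  rcases h1 with h1 | h1
  · right
    intro u' hu' v' hv'
    have h2 := key' I hI J hJ hIJ u hu v hv h1 u' hu'
    exact key J hJ I hI hIJ.symm v hv u' hu' h2 v' hv'
  · left
    intro u' hu' v' hv'
    have h2 := key I hI J hJ hIJ u hu v hv h1 u' hu'
    exact key' J hJ I hI hIJ.symm v hv u' hu' h2 v' hv'

end LineModel

/-! ### Line models from lollipop models -/

section Extraction

variable {V : Type*} {G : SimpleGraph V} {C : Set V} {φ : V → Set ℂ}

/-- Circle and stick are closed and meet only in P. A connected set avoiding P therefore stays on
one of them, and adjacent vertices of a component must be on the same one. -/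
theorem mem_circleComps_or_mem_stickComps (hφ : IsIntersectionModel lollipop G φ)
    (hP : ∀ v, branchPt ∈ φ v ↔ v ∈ C) {I : Set V} (hI : I ∈ comps G C) :
    I ∈ circleComps G C φ ∨ I ∈ stickComps G C φ := by
  have hclosed : IsClosed circ := Metric.isClosed_sphere
  have hclosed' : IsClosed stick := by
    have : stick = stickPt '' Icc 0 1 := by
      ext z; rw [mem_stick_iff]; rfl
    rw [this]
    exact (isCompact_Icc.image continuous_stickPt).isClosed
  have hPv : ∀ v ∈ I, branchPt ∉ φ v := fun v hv h =>
    notMem_of_mem_comps hI hv ((hP v).1 h)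
  have key : ∀ v ∈ I, φ v ⊆ circ \ {branchPt} ∨ φ v ⊆ stick \ {branchPt} := by
    intro v hv
    have hsub : ∀ X : Set ℂ, φ v ⊆ X → φ v ⊆ X \ {branchPt} := fun X hX z hz =>
      ⟨hX hz, fun e => hPv v hv (mem_singleton_iff.1 e ▸ hz)⟩
    by_contra hcon
    rw [not_or] at hcon
    have h1 : ¬ φ v ⊆ circ := fun h => hcon.1 (hsub _ h)
    have h2 : ¬ φ v ⊆ stick := fun h => hcon.2 (hsub _ h)
    obtain ⟨x, hx, hx'⟩ := not_subset.1 h1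
    obtain ⟨y, hy, hy'⟩ := not_subset.1 h2
    have hsubset := hφ.subset v
    obtain ⟨z, hz, hz1, hz2⟩ := isPreconnected_closed_iff.1 (hφ.connected v).isPreconnected circ
      stick hclosed hclosed' hsubset ⟨y, hy, (hsubset hy).resolve_right hy'⟩
      ⟨x, hx, (hsubset hx).resolve_left hx'⟩
    rw [circ_inter_stick hz1 hz2] at hz
    exact hPv v hv hz
  obtain ⟨u, hu⟩ := nonempty_of_mem_comps hI
  have meet : ∀ v w, G.Adj v w → (φ v ∩ φ w).Nonempty := fun v w h =>
    (hφ.adj_iff v w h.ne).1 h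
  rcases key u hu with h | h
  · left
    refine ⟨hI, fun v hv => comps_induction hI (P := fun v => φ v ⊆ circ \ {branchPt}) ?_ hu h hv⟩
    intro v hv w hw hadj hsub
    refine (key w hw).resolve_right fun h' => ?_
    obtain ⟨z, hz1, hz2⟩ := meet v w hadj
    exact (hsub hz1).2 (circ_inter_stick (hsub hz1).1 (h' hz2).1)
  · right
    refine ⟨hI, fun v hv => comps_induction hI (P := fun v => φ v ⊆ stick \ {branchPt}) ?_ hu h hv⟩
    intro v hv w hw hadj hsub
    refine (key w hw).resolve_left fun h' => ?_
    obtain ⟨z, hz1, hz2⟩ := meet v w hadj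
    exact (hsub hz1).2 (circ_inter_stick (h' hz2).1 (hsub hz1).1)

theorem notMem_stickComps_of_mem_circleComps (hφ : IsIntersectionModel lollipop G φ) {I : Set V}
    (hI : I ∈ circleComps G C φ) : I ∉ stickComps G C φ := by
  intro hI'
  obtain ⟨v, hv⟩ := nonempty_of_mem_comps hI.1
  obtain ⟨z, hz⟩ := (hφ.connected v).nonempty
  exact (hI.2 v hv hz).2 (circ_inter_stick (hI.2 v hv hz).1 (hI'.2 v hv hz).1)

theorem exists_lineModel_circleComps (hφ : IsIntersectionModel lollipop G φ)
    (hP : ∀ v, branchPt ∈ φ v ↔ v ∈ C) :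
    ∃ l r a b, IsLineModel G C (⋃₀ circleComps G C φ) l r a b ∧
      ∀ I ∈ circleComps G C φ, ∀ J ∈ circleComps G C φ,
        (prec φ I J ↔ ∀ u ∈ I, ∀ v ∈ J, r u < l v) := by
  have h1 : ∀ v, ∃ l r : ℝ, v ∈ ⋃₀ circleComps G C φ →
      0 < l ∧ l ≤ r ∧ r < 1 ∧ φ v = circPt '' Icc l r := by
    intro v
    by_cases hv : v ∈ ⋃₀ circleComps G C φ
    · obtain ⟨I, hI, hvI⟩ := hv
      obtain ⟨l, r, h⟩ := exists_eq_circPt_image (hI.2 v hvI) (hφ.compact v) (hφ.connected v)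
      exact ⟨l, r, fun _ => h⟩
    · exact ⟨0, 0, fun h => absurd h hv⟩
  have h2 : ∀ c, ∃ a b : ℝ, c ∈ C → ∀ t ∈ Ioo (0 : ℝ) 1, (circPt t ∈ φ c ↔ t ≤ a ∨ b ≤ t) := by
    intro c
    by_cases hc : c ∈ C
    · obtain ⟨a, b, h⟩ := exists_gap_of_lollipop (hφ.subset c) (hφ.compact c) (hφ.connected c)
        ((hP c).2 hc)
      exact ⟨a, b, fun _ => h⟩
    · exact ⟨0, 0, fun h => absurd h hc⟩
  choose l r hlr using h1
  choose a b hab using h2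
  refine ⟨l, r, a, b, ⟨fun v hv => (hlr v hv).2.1, ?_, ?_⟩, ?_⟩
  · intro u hu v hv huv
    obtain ⟨hu1, hu2, hu3, hu4⟩ := hlr u hu
    obtain ⟨hv1, hv2, hv3, hv4⟩ := hlr v hv
    rw [hφ.adj_iff u v huv, hu4, hv4, image_inter_image_nonempty_iff hu1 hu2 hu3 hv1 hv2 hv3]
  · intro c hc v hv
    obtain ⟨hv1, hv2, hv3, hv4⟩ := hlr v hv
    have hcv : c ≠ v := by
      rintro rfl
      obtain ⟨I, hI, hvI⟩ := hv
      exact notMem_of_mem_comps hI.1 hvI hc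
    rw [hφ.adj_iff c v hcv, hv4, gap_inter_image_nonempty_iff (hab c hc) hv1 hv2 hv3]
  · intro I hI J hJ
    constructor
    · intro h u hu v hv
      obtain ⟨hu1, hu2, hu3, hu4⟩ := hlr u ⟨I, hI, hu⟩
      obtain ⟨hv1, hv2, hv3, hv4⟩ := hlr v ⟨J, hJ, hv⟩
      refine h (r u) ⟨by linarith, hu3⟩ (l v) ⟨hv1, by linarith⟩ (mem_iUnion₂.2 ⟨u, hu, ?_⟩)
        (mem_iUnion₂.2 ⟨v, hv, ?_⟩)
      · rw [hu4]; exact ⟨_, ⟨hu2, le_rfl⟩, rfl⟩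
      · rw [hv4]; exact ⟨_, ⟨le_rfl, hv2⟩, rfl⟩
    · intro h s hs t ht hsI htJ
      obtain ⟨u, hu, hsu⟩ := mem_iUnion₂.1 hsI
      obtain ⟨v, hv, htv⟩ := mem_iUnion₂.1 htJ
      obtain ⟨hu1, hu2, hu3, hu4⟩ := hlr u ⟨I, hI, hu⟩
      obtain ⟨hv1, hv2, hv3, hv4⟩ := hlr v ⟨J, hJ, hv⟩
      rw [hu4, circPt_mem_image_iff hu1 hu3 hs] at hsu
      rw [hv4, circPt_mem_image_iff hv1 hv3 ht] at htv
      linarith [h u hu v hv]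

theorem exists_lineModel_stickComps (hφ : IsIntersectionModel lollipop G φ)
    (hP : ∀ v, branchPt ∈ φ v ↔ v ∈ C) :
    ∃ l r a b, IsLineModel G C (⋃₀ stickComps G C φ) l r a b ∧
      ∀ c, ∀ v ∈ ⋃₀ stickComps G C φ, r v < b c := by
  have h1 : ∀ v, ∃ l r : ℝ, v ∈ ⋃₀ stickComps G C φ →
      0 < l ∧ l ≤ r ∧ r ≤ 1 ∧ φ v = stickPt '' Icc l r := by
    intro v
    by_cases hv : v ∈ ⋃₀ stickComps G C φ
    · obtain ⟨I, hI, hvI⟩ := hv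
      obtain ⟨l, r, h⟩ := exists_eq_stickPt_image (hI.2 v hvI) (hφ.compact v) (hφ.connected v)
      exact ⟨l, r, fun _ => h⟩
    · exact ⟨0, 0, fun h => absurd h hv⟩
  have h2 : ∀ c, ∃ d : ℝ, c ∈ C → ∀ t ∈ Ioc (0 : ℝ) 1, (stickPt t ∈ φ c ↔ t ≤ d) := by
    intro c
    by_cases hc : c ∈ C
    · obtain ⟨d, h⟩ := exists_bound_of_lollipop (hφ.subset c) (hφ.compact c) (hφ.connected c)
        ((hP c).2 hc)
      exact ⟨d, fun _ => h⟩
    · exact ⟨0, fun h => absurd h hc⟩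
  choose l r hlr using h1
  choose d hd using h2
  -- The stick has parameters at most 1, so the right threshold 2 is never reached.
  refine ⟨l, r, d, fun _ => 2, ⟨fun v hv => (hlr v hv).2.1, ?_, ?_⟩, ?_⟩
  · intro u hu v hv huv
    obtain ⟨hu1, hu2, hu3, hu4⟩ := hlr u hu
    obtain ⟨hv1, hv2, hv3, hv4⟩ := hlr v hv
    rw [hφ.adj_iff u v huv, hu4, hv4, stick_image_inter_image_nonempty_iff hu2 hv2]
  · intro c hc v hv
    obtain ⟨hv1, hv2, hv3, hv4⟩ := hlr v hv
    have hcv : c ≠ v := by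
      rintro rfl
      obtain ⟨I, hI, hvI⟩ := hv
      exact notMem_of_mem_comps hI.1 hvI hc
    rw [hφ.adj_iff c v hcv, hv4, bound_inter_stick_image_nonempty_iff (hd c hc) hv1 hv2 hv3]
    refine ⟨Or.inl, fun h => h.resolve_right ?_⟩
    linarith
  · intro c v hv
    have := (hlr v hv).2.2.1
    linarith

end Extraction

/-! ### Consequences of a line model -/

section Consequences

variable {V : Type*} {G : SimpleGraph V} {C : Set V} {K : Set (Set V)} {l r a b : V → ℝ}

/-- With right thresholds out of reach, a vertex of C missing some v has its left threshold before
v, and so misses every component farther to the right. -/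
theorem IsLineModel.isChainAmb [Finite V] (hC : G.IsClique C) (hK : K ⊆ comps G C)
    (h : IsLineModel G C (⋃₀ K) l r a b) (hb : ∀ c, ∀ v ∈ ⋃₀ K, r v < b c) :
    IsChainAmb G C K := by
  have key : ∀ I ∈ K, ∀ J ∈ K, (∀ u ∈ I, ∀ v ∈ J, r u < l v) → cl G C I ⊆ clS G C J := by
    intro I hI J hJ hlt c hc
    obtain ⟨hcC, v, hv, hcv⟩ := mem_cl_iff.1 hc
    rw [h.adj_center c hcC v ⟨I, hI, hv⟩, not_or] at hcv
    refine mem_clS_iff.2 ⟨hcC, fun w hw => ?_⟩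
    rw [h.adj_center c hcC w ⟨J, hJ, hw⟩, not_or]
    have h1 := h.le v ⟨I, hI, hv⟩
    have h2 := hb c w ⟨J, hJ, hw⟩
    have h3 := hlt v hv w hw
    constructor
    · linarith [hcv.1]
    · linarith
  refine ⟨fun I hI => ?_, fun I hI J hJ => ?_⟩
  · exact (h.mono subset_rfl (subset_sUnion_of_mem hI)).mem_ambiguous hC (hK hI)
      fun c _ v hv => hb c v ⟨I, hI, hv⟩
  · by_cases e : I = J
    · exact Or.inl e
    · rcases h.lt_or_lt hK hI hJ e with hlt | hlt
      · exact Or.inr (Or.inl ⟨e, key I hI J hJ hlt⟩)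
      · exact Or.inr (Or.inr ⟨Ne.symm e, key J hJ I hI fun u hu v hv => hlt v hv u hu⟩)

variable {s : Set V → Set V → Prop}

theorem IsLineModel.isStrictLinearOn (hK : K ⊆ comps G C) (h : IsLineModel G C (⋃₀ K) l r a b)
    (hs : ∀ I ∈ K, ∀ J ∈ K, (s I J ↔ ∀ u ∈ I, ∀ v ∈ J, r u < l v)) : IsStrictLinearOn K s := by
  refine ⟨fun I hI hII => ?_, fun I hI J hJ L hL hIJ hJL => ?_, fun I hI J hJ hne => ?_⟩
  · obtain ⟨v, hv⟩ := nonempty_of_mem_comps (hK hI)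
    have h1 := (hs I hI I hI).1 hII v hv v hv
    have h2 := h.le v ⟨I, hI, hv⟩
    linarith
  · rw [hs I hI L hL]
    intro u hu v hv
    obtain ⟨w, hw⟩ := nonempty_of_mem_comps (hK hJ)
    have h1 := (hs I hI J hJ).1 hIJ u hu w hw
    have h2 := (hs J hJ L hL).1 hJL w hw v hv
    have h3 := h.le w ⟨J, hJ, hw⟩
    linarith
  · rw [hs I hI J hJ, hs J hJ I hI]
    refine (h.lt_or_lt hK hI hJ hne).imp id fun h' u hu v hv => h' v hv u hu

/-- A vertex c that misses w has its right threshold beyond w, hence beyond everything to the left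
of w. -/
theorem IsLineModel.lt_right (h : IsLineModel G C (⋃₀ K) l r a b) {I J : Set V}
    (hJ : J ∈ K) (hIJ : ∀ u ∈ I, ∀ v ∈ J, r u < l v) {c : V} (hc : c ∈ cl G C J) :
    ∀ v ∈ I, r v < b c := by
  intro v hv
  obtain ⟨hcC, w, hw, hcw⟩ := mem_cl_iff.1 hc
  rw [h.adj_center c hcC w ⟨J, hJ, hw⟩, not_or] at hcw
  have h1 := h.le w ⟨J, hJ, hw⟩
  have h2 := hIJ v hv w hw
  linarith [hcw.2]

theorem IsLineModel.left_lt (h : IsLineModel G C (⋃₀ K) l r a b) {I J : Set V}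
    (hI : I ∈ K) (hIJ : ∀ u ∈ I, ∀ v ∈ J, r u < l v) {c : V} (hc : c ∈ cl G C I) :
    ∀ v ∈ J, a c < l v := by
  intro v hv
  obtain ⟨hcC, w, hw, hcw⟩ := mem_cl_iff.1 hc
  rw [h.adj_center c hcC w ⟨I, hI, hw⟩, not_or] at hcw
  have h1 := h.le w ⟨I, hI, hw⟩
  have h2 := hIJ w hw v hv
  linarith [hcw.1]

/-- The gap of c contains a vertex of I and a vertex of J, hence all of X between them. This is the
gluing condition on which both directions rest. -/
theorem IsLineModel.inter_subset_clS (h : IsLineModel G C (⋃₀ K) l r a b) {I X J : Set V}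
    (hI : I ∈ K) (hX : X ∈ K) (hJ : J ∈ K) (hIX : ∀ u ∈ I, ∀ v ∈ X, r u < l v)
    (hXJ : ∀ u ∈ X, ∀ v ∈ J, r u < l v) : cl G C I ∩ cl G C J ⊆ clS G C X := by
  rintro c ⟨hcI, hcJ⟩
  refine mem_clS_iff.2 ⟨hcI.1, fun v hv => ?_⟩
  rw [h.adj_center c hcI.1 v ⟨X, hX, hv⟩, not_or, not_le, not_le]
  exact ⟨h.left_lt hI hIX hcI v hv, h.lt_right hJ hXJ hcJ v hv⟩

/-- A vertex of a component `Z` on the left of `X` that meets exactly the vertices outside `cl Z`,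
among those of `cl X`. -/
theorem IsLineModel.exists_left_witness [Finite V] (hK : K ⊆ comps G C)
    (h : IsLineModel G C (⋃₀ K) l r a b) {X Z : Set V} (hX : X ∈ K) (hZ : Z ∈ K)
    (hZX : ∀ u ∈ Z, ∀ v ∈ X, r u < l v) :
    ∃ x y : ℝ, x ≤ y ∧ (∀ v ∈ X, y < l v) ∧
      ∀ c ∈ cl G C X, (c ∉ cl G C Z ↔ x ≤ a c ∨ b c ≤ y) := by
  -- A vertex of `cl G C X` can reach Z only from the left, so the vertex with the largest left
  -- endpoint is the hardest one to reach: whoever meets it meets all of Z.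
  obtain ⟨w, hw, hmax⟩ := exists_max_image Z l (toFinite Z) (nonempty_of_mem_comps (hK hZ))
  refine ⟨l w, r w, h.le w ⟨Z, hZ, hw⟩, fun v hv => hZX w hw v hv, fun c hc => ?_⟩
  constructor
  · intro hcZ
    rw [← h.adj_center c hc.1 w ⟨Z, hZ, hw⟩]
    exact adj_of_notMem_cl hc.1 hcZ hw
  · intro hor hcZ
    obtain ⟨hcC, z, hz, hcz⟩ := mem_cl_iff.1 hcZ
    rw [h.adj_center c hcC z ⟨Z, hZ, hz⟩, not_or] at hcz
    have h1 := h.lt_right hX hZX hc w hw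
    have h2 := hmax z hz
    rcases hor with h3 | h3
    · linarith [hcz.1]
    · linarith

/-- A set is cut out of `cl X` on the left side. -/
def IsLeftCut (G : SimpleGraph V) (C : Set V) (K : Set (Set V)) (s : Set V → Set V → Prop)
    (X B : Set V) : Prop :=
  B = ∅ ∨ ∃ Z ∈ K, s Z X ∧ ∀ c ∈ cl G C X, (c ∈ B ↔ c ∈ cl G C Z)

theorem IsLineModel.exists_left_interval [Finite V] (hK : K ⊆ comps G C)
    (h : IsLineModel G C (⋃₀ K) l r a b)
    (hs : ∀ I ∈ K, ∀ J ∈ K, s I J → ∀ u ∈ I, ∀ v ∈ J, r u < l v) {X B : Set V}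
    (hX : X ∈ K) (hB : IsLeftCut G C K s X B) :
    ∃ x y : ℝ, x ≤ y ∧ (∀ v ∈ X, y < l v) ∧ ∀ c ∈ cl G C X, (c ∉ B ↔ x ≤ a c ∨ b c ≤ y) := by
  rcases hB with rfl | ⟨Z, hZ, hZX, hB⟩
  · obtain ⟨m, hm⟩ := exists_lt_of_finite fun v => min (l v) (a v)
    refine ⟨m, m, le_rfl, fun v _ => (lt_min_iff.1 (hm v)).1, fun c _ => ?_⟩
    simp [(lt_min_iff.1 (hm c)).2.le]
  · obtain ⟨x, y, h1, h2, h3⟩ := h.exists_left_witness hK hX hZ (hs Z hZ X hX hZX)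
    refine ⟨x, y, h1, h2, fun c hc => ?_⟩
    rw [hB c hc, h3 c hc]

theorem extGraph_adj_inl {X CL CR : Set V} (u v : ↥(C ∪ X)) :
    (extGraph G C CL X CR).Adj (.inl u) (.inl v) ↔ G.Adj u.1 v.1 := by
  simp only [extGraph, SimpleGraph.fromRel_adj, ne_eq, Sum.inl.injEq]
  constructor
  · rintro ⟨-, h | h⟩
    · exact h
    · exact h.symm
  · intro h
    exact ⟨fun e => h.ne (by rw [e]), Or.inl h⟩

theorem extGraph_adj_false {X CL CR : Set V} (u : ↥(C ∪ X)) :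
    (extGraph G C CL X CR).Adj (.inl u) (.inr false) ↔ u.1 ∈ C \ CL := by
  simp [extGraph]

theorem extGraph_adj_true {X CL CR : Set V} (u : ↥(C ∪ X)) :
    (extGraph G C CL X CR).Adj (.inl u) (.inr true) ↔ u.1 ∈ C \ CR := by
  simp [extGraph]

theorem extGraph_not_adj_inr {X CL CR : Set V} (x y : Bool) :
    ¬ (extGraph G C CL X CR).Adj (.inr x) (.inr y) := by
  simp [extGraph]

/-- The line model restricted to X, with the witness interval on the left as v_L and the one on the
right as v_R, is a model of the extended graph. -/
theorem IsLineModel.isCircularArc_extGraph [Finite V] (hC : G.IsClique C) (hK : K ⊆ comps G C)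
    (h : IsLineModel G C (⋃₀ K) l r a b)
    (hs : ∀ I ∈ K, ∀ J ∈ K, s I J → ∀ u ∈ I, ∀ v ∈ J, r u < l v) {X CL CR : Set V}
    (hX : X ∈ K) (hCL : IsLeftCut G C K s X CL) (hCR : IsLeftCut G C K (fun I J => s J I) X CR)
    (hCL' : CL ⊆ cl G C X) (hCR' : CR ⊆ cl G C X) :
    IsCircularArc (extGraph G C CL X CR) := by
  classical
  obtain ⟨x, y, hxy, hyX, hL⟩ := h.exists_left_interval hK hs hX hCL
  -- The right witness is found in reflected coordinates; in the original ones it is [-y', -x'].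
  obtain ⟨x', y', hxy', hyX', hR⟩ := h.neg.exists_left_interval (s := fun I J => s J I) hK
    (fun I hI J hJ hIJ u hu v hv => neg_lt_neg (hs J hJ I hI hIJ v hv u hu)) hX hCR
  obtain ⟨v₀, hv₀⟩ := nonempty_of_mem_comps (hK hX)
  have hyx : y < -y' := by
    have h1 := hyX v₀ hv₀
    have h2 := hyX' v₀ hv₀
    have h3 := h.le v₀ ⟨X, hX, hv₀⟩
    linarith
  let Γ := extGraph G C CL X CR
  let Q : Set (↥(C ∪ X) ⊕ Bool) := {w | ∃ c : ↥(C ∪ X), w = .inl c ∧ c.1 ∈ C}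
  let l' : ↥(C ∪ X) ⊕ Bool → ℝ := Sum.elim (fun u => l u.1) (fun t => if t then -y' else x)
  let r' : ↥(C ∪ X) ⊕ Bool → ℝ := Sum.elim (fun u => r u.1) (fun t => if t then -x' else y)
  -- Vertices of C outside C(X) belong to neither cut and are adjacent to everything in the extended
  -- graph; equal thresholds 0, 0 make their gap empty.
  let a' : ↥(C ∪ X) ⊕ Bool → ℝ :=
    Sum.elim (fun u => if u.1 ∈ cl G C X then a u.1 else 0) (fun _ => 0)
  let b' : ↥(C ∪ X) ⊕ Bool → ℝ :=
    Sum.elim (fun u => if u.1 ∈ cl G C X then b u.1 else 0) (fun _ => 0)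
  have hmemX : ∀ u : ↥(C ∪ X), (.inl u : ↥(C ∪ X) ⊕ Bool) ∈ Qᶜ → u.1 ∈ X := fun u hu =>
    u.2.resolve_left fun hc => hu ⟨u, rfl, hc⟩
  have hmemC : ∀ u : ↥(C ∪ X), u.1 ∈ X → u.1 ∉ C := fun u hu => notMem_of_mem_comps (hK hX) hu
  have hmodel : IsLineModel Γ Q Qᶜ l' r' a' b' := by
    refine ⟨?_, ?_, ?_⟩
    · rintro (u | t) hu
      · exact h.le u.1 ⟨X, hX, hmemX u hu⟩
      · cases t
        · exact hxy
        · exact neg_le_neg hxy'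
    · rintro (u | t) hu (v | t') hv huv
      · have hu' := hmemX u hu
        have hv' := hmemX v hv
        rw [extGraph_adj_inl]
        exact h.adj u.1 ⟨X, hX, hu'⟩ v.1 ⟨X, hX, hv'⟩
          fun e => huv (congrArg Sum.inl (Subtype.ext e))
      · have hu' := hmemX u hu
        have h1 := h.le _ ⟨X, hX, hu'⟩
        have h2 := hyX _ hu'
        have h3 := hyX' _ hu'
        cases t'
        · refine iff_of_false (fun e => hmemC u hu' ((extGraph_adj_false u).1 e).1) ?_
          simp only [l', r', Sum.elim_inl, Sum.elim_inr, Bool.false_eq_true, if_false]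
          intro e; linarith [e.1]
        · refine iff_of_false (fun e => hmemC u hu' ((extGraph_adj_true u).1 e).1) ?_
          simp only [l', r', Sum.elim_inl, Sum.elim_inr, if_true]
          intro e; linarith [e.2]
      · have hu' := hmemX v hv
        have h1 := h.le _ ⟨X, hX, hu'⟩
        have h2 := hyX _ hu'
        have h3 := hyX' _ hu'
        rw [Γ.adj_comm]
        cases t
        · refine iff_of_false (fun e => hmemC v hu' ((extGraph_adj_false v).1 e).1) ?_
          simp only [l', r', Sum.elim_inl, Sum.elim_inr, Bool.false_eq_true, if_false]
          intro e; linarith [e.2]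
        · refine iff_of_false (fun e => hmemC v hu' ((extGraph_adj_true v).1 e).1) ?_
          simp only [l', r', Sum.elim_inl, Sum.elim_inr, if_true]
          intro e; linarith [e.1]
      · refine iff_of_false (extGraph_not_adj_inr t t') ?_
        cases t <;> cases t' <;>
          simp only [l', r', Sum.elim_inr, if_true, Bool.false_eq_true, if_false]
        · exact absurd rfl huv
        · intro e; linarith [e.2]
        · intro e; linarith [e.1]
        · exact absurd rfl huv
    · rintro _ ⟨c, rfl, hc⟩ (v | t) hv
      · have hv' := hmemX v hv
        rw [extGraph_adj_inl]
        simp only [l', r', a', b', Sum.elim_inl]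
        split_ifs with hcX
        · exact h.adj_center c.1 hc v.1 ⟨X, hX, hv'⟩
        · refine iff_of_true (adj_of_notMem_cl hc hcX hv') ?_
          have h1 := h.le _ ⟨X, hX, hv'⟩
          by_contra hcon
          rw [not_or] at hcon
          linarith [hcon.1, hcon.2]
      · cases t
        · rw [extGraph_adj_false]
          simp only [l', r', a', b', Sum.elim_inl, Sum.elim_inr, Bool.false_eq_true, if_false]
          split_ifs with hcX
          · rw [← hL c.1 hcX]
            exact ⟨fun e => e.2, fun e => ⟨hc, e⟩⟩
          · refine iff_of_true ⟨hc, fun e => hcX (hCL' e)⟩ ?_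
            by_contra hcon
            rw [not_or] at hcon
            linarith [hcon.1, hcon.2]
        · rw [extGraph_adj_true]
          simp only [l', r', a', b', Sum.elim_inl, Sum.elim_inr, if_true]
          split_ifs with hcX
          · have h2 : (-y' ≤ a c.1 ∨ b c.1 ≤ -x') ↔ (x' ≤ -b c.1 ∨ -a c.1 ≤ y') := by
              rw [neg_le, le_neg, or_comm]
            rw [h2, ← hR c.1 hcX]
            exact ⟨fun e => e.2, fun e => ⟨hc, e⟩⟩
          · refine iff_of_true ⟨hc, fun e => hcX (hCR' e)⟩ ?_
            by_contra hcon
            rw [not_or] at hcon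
            linarith [hcon.1, hcon.2]
  refine hmodel.isCircularArc ?_
  rintro _ ⟨c, rfl, hc⟩ _ ⟨d, rfl, hd⟩ hcd
  rw [extGraph_adj_inl]
  exact hC hc hd fun e => hcd (congrArg Sum.inl (Subtype.ext e))

end Consequences

/-! ### Consecutive orders of the maximal cliques -/

section Leaves

variable {V : Type*} {G : SimpleGraph V} {H : G.Subgraph} {l : List (Set V)}

theorem leafAt_succ {i : ℕ} (hi : i < l.length) : leafAt l (i + 1) = l[i] := by
  simp [leafAt, hi]

theorem leafAt_of_length_lt {i : ℕ} (hi : l.length < i) : leafAt l i = ∅ := by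
  obtain ⟨j, rfl⟩ : ∃ j, i = j + 1 := ⟨i - 1, by omega⟩
  simp [leafAt, show l.length ≤ j by omega]

theorem mem_Icc_of_mem_leafAt {i : ℕ} {v : V} (h : v ∈ leafAt l i) : i ∈ Icc 1 l.length := by
  constructor
  · by_contra hi
    obtain rfl : i = 0 := by omega
    exact h
  · by_contra hi
    rw [leafAt_of_length_lt (by omega)] at h
    exact h

theorem leafAt_mem {i : ℕ} (hi : i ∈ Icc 1 l.length) : leafAt l i ∈ l := by
  obtain ⟨j, rfl⟩ : ∃ j, i = j + 1 := ⟨i - 1, by have := hi.1; omega⟩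
  have hj : j < l.length := by have := hi.2; omega
  rw [leafAt_succ hj]
  exact List.getElem_mem hj

theorem IsConsecutive.isMaxCliqueOf (hl : IsConsecutive H l) {i : ℕ} (hi : i ∈ Icc 1 l.length) :
    IsMaxCliqueOf H (leafAt l i) := (hl.2.1 _).1 (leafAt_mem hi)

theorem IsConsecutive.exists_leafAt_eq (hl : IsConsecutive H l) {Q : Set V}
    (hQ : IsMaxCliqueOf H Q) : ∃ i ∈ Icc 1 l.length, leafAt l i = Q := by
  obtain ⟨j, hj, rfl⟩ := List.getElem_of_mem ((hl.2.1 Q).2 hQ)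
  exact ⟨j + 1, ⟨by omega, by omega⟩, leafAt_succ hj⟩

theorem IsConsecutive.mem_leafAt (hl : IsConsecutive H l) {i j k : ℕ} (hij : i ≤ j) (hjk : j ≤ k)
    {v : V} (hi : v ∈ leafAt l i) (hk : v ∈ leafAt l k) : v ∈ leafAt l j := by
  have hv : v ∈ H.verts := (hl.isMaxCliqueOf (mem_Icc_of_mem_leafAt hi)).2.1.1 hi
  obtain ⟨hi1, hi2⟩ := mem_Icc_of_mem_leafAt hi
  obtain ⟨hk1, hk2⟩ := mem_Icc_of_mem_leafAt hk
  obtain ⟨i, rfl⟩ : ∃ m, i = m + 1 := ⟨i - 1, by omega⟩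
  obtain ⟨j, rfl⟩ : ∃ m, j = m + 1 := ⟨j - 1, by omega⟩
  obtain ⟨k, rfl⟩ : ∃ m, k = m + 1 := ⟨k - 1, by omega⟩
  have hi' : i < l.length := by omega
  have hj' : j < l.length := by omega
  have hk' : k < l.length := by omega
  rw [leafAt_succ hi'] at hi
  rw [leafAt_succ hk'] at hk
  rw [leafAt_succ hj']
  exact hl.2.2 v hv ⟨i, hi'⟩ ⟨j, hj'⟩ ⟨k, hk'⟩ (Fin.mk_le_mk.2 (by omega))
    (Fin.mk_le_mk.2 (by omega)) hi hk

theorem IsCliqueOf.exists_isMaxCliqueOf [Finite V] {Q : Set V} (hQ : IsCliqueOf H Q)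
    (hne : Q.Nonempty) : ∃ M, IsMaxCliqueOf H M ∧ Q ⊆ M := by
  obtain ⟨M, hQM, hM⟩ := (toFinite {M | IsCliqueOf H M}).exists_le_maximal hQ
  exact ⟨M, ⟨hne.mono hQM, hM.1, fun M' hM' h => subset_antisymm (hM.2 hM' h) h⟩, hQM⟩

theorem isCliqueOf_singleton {v : V} (hv : v ∈ H.verts) : IsCliqueOf H {v} :=
  ⟨singleton_subset_iff.2 hv, pairwise_singleton _ _⟩

theorem IsCliqueOf.mono {Q Q' : Set V} (hQ : IsCliqueOf H Q) (h : Q' ⊆ Q) : IsCliqueOf H Q' :=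
  ⟨h.trans hQ.1, hQ.2.mono h⟩

theorem isCliqueOf_empty : IsCliqueOf H (∅ : Set V) := ⟨empty_subset _, pairwise_empty _⟩

theorem isCliqueOf_pair {u v : V} (h : H.Adj u v) : IsCliqueOf H {u, v} := by
  refine ⟨insert_subset h.fst_mem (singleton_subset_iff.2 h.snd_mem), ?_⟩
  rintro x (rfl | rfl) y (rfl | rfl) hxy
  exacts [absurd rfl hxy, h, h.symm, absurd rfl hxy]

theorem IsConsecutive.exists_mem_leafAt [Finite V] (hl : IsConsecutive H l) {v : V}
    (hv : v ∈ H.verts) : ∃ i ∈ Icc 1 l.length, v ∈ leafAt l i := by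
  obtain ⟨M, hM, hvM⟩ := (isCliqueOf_singleton hv).exists_isMaxCliqueOf (singleton_nonempty v)
  obtain ⟨i, hi, rfl⟩ := hl.exists_leafAt_eq hM
  exact ⟨i, hi, hvM rfl⟩

theorem IsConsecutive.exists_subset_leafAt [Finite V] (hl : IsConsecutive H l) {Q : Set V}
    (hQ : IsCliqueOf H Q) (hne : Q.Nonempty) : ∃ i ∈ Icc 1 l.length, Q ⊆ leafAt l i := by
  obtain ⟨M, hM, hQM⟩ := hQ.exists_isMaxCliqueOf hne
  obtain ⟨i, hi, rfl⟩ := hl.exists_leafAt_eq hM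
  exact ⟨i, hi, hQM⟩

theorem IsConsecutive.isCliqueOf_leafAt (hl : IsConsecutive H l) (i : ℕ) :
    IsCliqueOf H (leafAt l i) := by
  by_cases hi : i ∈ Icc 1 l.length
  · exact (hl.isMaxCliqueOf hi).2.1
  · have : leafAt l i = ∅ := by
      by_contra h
      obtain ⟨v, hv⟩ := nonempty_iff_ne_empty.2 h
      exact hi (mem_Icc_of_mem_leafAt hv)
    rw [this]; exact isCliqueOf_empty

end Leaves

/-! ### Strict linear orders on finite sets -/

section Rank

variable {α : Type*} {K : Set α} {s : α → α → Prop}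

/-- The number of predecessors. -/
noncomputable def rank (K : Set α) (s : α → α → Prop) (x : α) : ℕ := {y ∈ K | s y x}.ncard

theorem IsStrictLinearOn.rank_lt [Finite α] (hs : IsStrictLinearOn K s) {x y : α} (hx : x ∈ K)
    (hy : y ∈ K) (h : s x y) : rank K s x < rank K s y := by
  refine ncard_lt_ncard ⟨fun z hz => ⟨hz.1, hs.2.1 z hz.1 x hx y hy hz.2 h⟩, fun hsub => ?_⟩
    (toFinite _)
  exact hs.1 x hx (hsub ⟨hx, h⟩).2

theorem IsStrictLinearOn.rank_lt_iff [Finite α] (hs : IsStrictLinearOn K s) {x y : α}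
    (hx : x ∈ K) (hy : y ∈ K) : rank K s x < rank K s y ↔ s x y := by
  refine ⟨fun h => ?_, hs.rank_lt hx hy⟩
  by_contra h'
  rcases eq_or_ne x y with rfl | hne
  · exact lt_irrefl _ h
  · exact lt_asymm h (hs.rank_lt hy hx ((hs.2.2 x hx y hy hne).resolve_left h'))

theorem IsStrictLinearOn.asymm (hs : IsStrictLinearOn K s) {x y : α} (hx : x ∈ K) (hy : y ∈ K)
    (h : s x y) : ¬ s y x := fun h' => hs.1 x hx (hs.2.1 x hx y hy x hx h h')

theorem IsStrictLinearOn.lt_of_not_lt (hs : IsStrictLinearOn K s) {x y : α} (hx : x ∈ K)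
    (hy : y ∈ K) (hne : x ≠ y) (h : ¬ s y x) : s x y := (hs.2.2 x hx y hy hne).resolve_right h

end Rank

/-! ### Antisymmetry of ⊏ -/

section Below

variable {V : Type*} {G : SimpleGraph V} {C : Set V}

/-- Mutual comparability makes C^s(I), C(I), C^s(J), C(J) all equal. Then both components are
ambiguous simple with the same clique, which assumption (a) excludes. -/
theorem Below.asymm
    (hsimple : ∀ I ∈ ambiguousSimple G C, ∀ J ∈ ambiguousSimple G C, cl G C I = cl G C J → I = J)
    {I J : Set V} (hI : I ∈ ambiguous G C) (hJ : J ∈ ambiguous G C) (h : Below G C I J) :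
    ¬ Below G C J I := by
  intro h'
  have h1 := clS_subset_cl hI.1
  have h2 := clS_subset_cl hJ.1
  have h3 : clS G C I = cl G C I := h1.antisymm (h.2.trans (h2.trans h'.2))
  have h4 : clS G C J = cl G C J := h2.antisymm (h'.2.trans (h1.trans h.2))
  refine h.1 (hsimple I ⟨hI, nbr_eq_strongNbr_iff.2 h3⟩ J ⟨hJ, nbr_eq_strongNbr_iff.2 h4⟩ ?_)
  exact (h.2.trans h2).antisymm (h'.2.trans h1)

end Below

/-! ### From central orders to good orders -/

section CentralOrder

variable {V : Type*} {G : SimpleGraph V} {C : Set V} {H : G.Subgraph} {K : Set (Set V)}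
  {s : Set V → Set V → Prop} {l : List (Set V)}

/-- The properties of the left-to-right order of the components on the circle of a centered
model. -/
structure IsCentralOrder (C : Set V) (H : G.Subgraph) (K : Set (Set V))
    (s : Set V → Set V → Prop) : Prop where
  subset_comps : K ⊆ comps G C
  linear : IsStrictLinearOn K s
  glue : ∀ I ∈ K, ∀ X ∈ K, ∀ J ∈ K, s I X → s X J → cl G C I ∩ cl G C J ⊆ clS G C X
  clique : ∀ I ∈ K, IsCliqueOf H (cl G C I)
  maxClique : ∀ Q, IsMaxCliqueOf H Q → ∃ I ∈ K, cl G C I = Q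
  ambiguous_right : ∀ X ∈ K, (∀ c ∈ cl G C X, c ∈ clS G C X ∨ ∃ J ∈ K, s X J ∧ c ∈ cl G C J) →
    X ∈ ambiguous G C
  ambiguous_left : ∀ X ∈ K, (∀ c ∈ cl G C X, c ∈ clS G C X ∨ ∃ J ∈ K, s J X ∧ c ∈ cl G C J) →
    X ∈ ambiguous G C
  circularArc : ∀ X ∈ K, ∀ CL CR, IsLeftCut G C K s X CL →
    IsLeftCut G C K (fun I J => s J I) X CR → CL ⊆ cl G C X → CR ⊆ cl G C X →
      IsCircularArc (extGraph G C CL X CR)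

namespace IsCentralOrder

/-- The maximal cliques are sorted by the position of one chosen component each, and gluing makes
the order consecutive. The choice does not matter: by maximality, whatever lies between two
components with the same maximal clique has that clique too. -/
theorem exists_isConsecutive [Finite V] (h : IsCentralOrder C H K s) :
    ∃ l, IsConsecutive H l ∧ ∀ i ∈ Icc 1 l.length, ∀ j ∈ Icc 1 l.length, i < j →
      SetPrec s (inner G C K l i) (inner G C K l j) := by
  classical
  have hρ' : ∀ Q, ∃ I, IsMaxCliqueOf H Q → I ∈ K ∧ cl G C I = Q := by
    intro Q
    by_cases hQ : IsMaxCliqueOf H Q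
    · obtain ⟨I, hI⟩ := h.maxClique Q hQ
      exact ⟨I, fun _ => hI⟩
    · exact ⟨∅, fun h => absurd h hQ⟩
  choose ρ hρ using hρ'
  let f : Set V → ℕ := fun Q => rank K s (ρ Q)
  let l := ((toFinite {Q | IsMaxCliqueOf H Q}).toFinset.toList).insertionSort (fun Q Q' => f Q ≤ f Q')
  have hperm : l.Perm ((toFinite {Q | IsMaxCliqueOf H Q}).toFinset.toList) :=
    List.perm_insertionSort _ _
  have hnodup : l.Nodup := hperm.nodup_iff.2 (Finset.nodup_toList _)
  have hmem : ∀ Q, Q ∈ l ↔ IsMaxCliqueOf H Q := by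
    intro Q
    rw [hperm.mem_iff]
    simp
  have : Std.Total (fun Q Q' : Set V => f Q ≤ f Q') := ⟨fun a b => le_total _ _⟩
  have : IsTrans (Set V) (fun Q Q' : Set V => f Q ≤ f Q') := ⟨fun a b c => le_trans⟩
  have hsorted : l.Pairwise (fun Q Q' => f Q ≤ f Q') := List.pairwise_insertionSort _ _
  have hsorted' : ∀ i j, ∀ (hi : i < l.length) (hj : j < l.length), i < j →
      s (ρ l[i]) (ρ l[j]) := by
    intro i j hi hj hij
    have h1 := List.pairwise_iff_getElem.1 hsorted i j hi hj hij
    obtain ⟨h2, h2'⟩ := hρ _ ((hmem l[i]).1 (List.getElem_mem hi))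
    obtain ⟨h3, h3'⟩ := hρ _ ((hmem l[j]).1 (List.getElem_mem hj))
    refine h.linear.lt_of_not_lt h2 h3 (fun e => ?_)
      (fun e => absurd (h.linear.rank_lt h3 h2 e) (not_lt.2 h1))
    rw [e, h3'] at h2'
    have := hnodup.getElem_inj_iff.1 h2'
    omega
  refine ⟨l, ⟨hnodup, hmem, ?_⟩, ?_⟩
  · intro v _ i j k hij hjk hi hk
    rcases hij.eq_or_lt with rfl | hij
    · exact hi
    rcases hjk.eq_or_lt with rfl | hjk
    · exact hk
    obtain ⟨h1, h1'⟩ := hρ _ ((hmem (l.get i)).1 (List.get_mem _ _))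
    obtain ⟨h2, h2'⟩ := hρ _ ((hmem (l.get j)).1 (List.get_mem _ _))
    obtain ⟨h3, h3'⟩ := hρ _ ((hmem (l.get k)).1 (List.get_mem _ _))
    rw [← h2']
    refine clS_subset_cl (h.subset_comps h2) (h.glue _ h1 _ h2 _ h3
      (hsorted' i j i.2 j.2 hij) (hsorted' j k j.2 k.2 hjk) ⟨?_, ?_⟩)
    · rwa [h1']
    · rwa [h3']
  · rintro i ⟨hi1, hi2⟩ j ⟨hj1, hj2⟩ hij A hA B hB
    obtain ⟨i, rfl⟩ : ∃ m, i = m + 1 := ⟨i - 1, by omega⟩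
    obtain ⟨j, rfl⟩ : ∃ m, j = m + 1 := ⟨j - 1, by omega⟩
    have hi : i < l.length := by omega
    have hj : j < l.length := by omega
    have hA2 := hA.2
    have hB2 := hB.2
    rw [leafAt_succ hi] at hA2
    rw [leafAt_succ hj] at hB2
    have hlt := hsorted' i j hi hj (by omega)
    have hm1 := (hmem l[i]).1 (List.getElem_mem hi)
    have hm2 := (hmem l[j]).1 (List.getElem_mem hj)
    obtain ⟨h1, h1'⟩ := hρ _ hm1
    obtain ⟨h2, h2'⟩ := hρ _ hm2
    have hne : l[i] ≠ l[j] := fun e => by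
      have := hnodup.getElem_inj_iff.1 e
      omega
    have hmax : ∀ X Y Z, X ∈ K → Y ∈ K → Z ∈ K → s X Y → s Y Z → cl G C X = cl G C Z →
        IsMaxCliqueOf H (cl G C X) → cl G C Y = cl G C X := by
      intro X Y Z hX hY hZ hXY hYZ hXZ hm
      refine hm.2.2 _ (h.clique Y hY) fun c hc => ?_
      exact clS_subset_cl (h.subset_comps hY) (h.glue X hX Y hY Z hZ hXY hYZ ⟨hc, hXZ ▸ hc⟩)
    -- If B preceded A, either B would lie between two components with clique l[i], or the
    -- representative of l[i] would lie between two components with clique l[j]; both identify the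
    -- two cliques.
    refine h.linear.lt_of_not_lt hA.1 hB.1 (fun e => hne ?_) fun hBA => ?_
    · rw [← hA2, ← hB2, e]
    · by_cases hρB : s (ρ l[i]) B
      · have := hmax _ _ _ h1 hB.1 hA.1 hρB hBA (h1'.trans hA2.symm) (by rwa [h1'])
        exact hne (by rw [← h1', ← this, hB2])
      · have hneq : B ≠ ρ l[i] := fun e => hne (by rw [← h1', ← e, hB2])
        have hlt' := h.linear.lt_of_not_lt hB.1 h1 hneq hρB
        have := hmax _ _ _ hB.1 h1 h2 hlt' hlt (hB2.trans h2'.symm) (by rwa [hB2])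
        exact hne (by rw [← h1', this, hB2])

theorem mem_cl_of_between (h : IsCentralOrder C H K s) {I X J : Set V} (hI : I ∈ K) (hX : X ∈ K)
    (hJ : J ∈ K) (hIX : s I X) (hXJ : s X J) {c : V} (hcI : c ∈ cl G C I) (hcJ : c ∈ cl G C J) :
    c ∈ cl G C X :=
  clS_subset_cl (h.subset_comps hX) (h.glue I hI X hX J hJ hIX hXJ ⟨hcI, hcJ⟩)

end IsCentralOrder

/-- A central order together with the order of the maximal cliques that it induces. -/
structure IsCentralOrderWith (C : Set V) (H : G.Subgraph) (K : Set (Set V))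
    (s : Set V → Set V → Prop) (l : List (Set V)) : Prop extends IsCentralOrder C H K s where
  consecutive : IsConsecutive H l
  induced : ∀ i ∈ Icc 1 l.length, ∀ j ∈ Icc 1 l.length, i < j →
    SetPrec s (inner G C K l i) (inner G C K l j)

namespace IsCentralOrderWith

variable {i j : ℕ} {X Y A : Set V}

theorem exists_inner (h : IsCentralOrderWith C H K s l) (hi : i ∈ Icc 1 l.length) :
    ∃ A, A ∈ inner G C K l i := by
  obtain ⟨A, hA, hA'⟩ := h.maxClique _ (h.consecutive.isMaxCliqueOf hi)
  exact ⟨A, hA, hA'⟩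

theorem mem_leafAt_of_mem_cl (h : IsCentralOrderWith C H K s l) (hA : A ∈ inner G C K l i)
    (hX : X ∈ K) (hY : Y ∈ K) (hXA : s X A) (hAY : s A Y) {c : V} (hcX : c ∈ cl G C X)
    (hcY : c ∈ cl G C Y) : c ∈ leafAt l i := by
  rw [← hA.2]
  exact h.mem_cl_of_between hX hA.1 hY hXA hAY hcX hcY

theorem mem_Icc_of_between {k m : ℕ} (hi : i ∈ Icc 1 l.length) (hk : k ∈ Icc 1 l.length)
    (h1 : i ≤ m) (h2 : m ≤ k) : m ∈ Icc 1 l.length := ⟨hi.1.trans h1, h2.trans hk.2⟩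

/-- A vertex v of C(X) in C(𝕃_i) but not in C(𝕃_{i-1}) is in no earlier leaf. If X preceded A, then
A would lie between X and an inner component of 𝕃_i and inherit v. -/
theorem inner_lt_zoneL (h : IsCentralOrderWith C H K s l) (hi : i ∈ Icc 1 l.length)
    (hj : j ∈ Icc 1 l.length) (hji : j < i) (hX : X ∈ zoneL G C K s l i)
    (hA : A ∈ inner G C K l j) : s A X := by
  obtain ⟨v, hvX, hvi, hvi'⟩ := hX.2.2
  obtain ⟨B, hB⟩ := h.exists_inner hi
  have hvA : v ∉ cl G C A := fun hvA => hvi' <| by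
    rw [hA.2] at hvA
    exact h.consecutive.mem_leafAt (by omega) (Nat.sub_le _ _) hvA hvi
  refine h.linear.lt_of_not_lt hA.1 hX.1 (fun e => hvA (e ▸ hvX)) fun hXA => hvA ?_
  exact h.mem_cl_of_between hX.1 hA.1 hB.1 hXA (h.induced _ hj _ hi hji A hA B hB) hvX
    (hB.2 ▸ hvi)

theorem zoneR_lt_inner (h : IsCentralOrderWith C H K s l) (hi : i ∈ Icc 1 l.length)
    (hj : j ∈ Icc 1 l.length) (hij : i < j) (hX : X ∈ zoneR G C K s l i)
    (hA : A ∈ inner G C K l j) : s X A := by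
  obtain ⟨v, hvX, hvi, hvi'⟩ := hX.2.2
  obtain ⟨B, hB⟩ := h.exists_inner hi
  have hvA : v ∉ cl G C A := fun hvA => hvi' <| by
    rw [hA.2] at hvA
    exact h.consecutive.mem_leafAt (Nat.le_succ _) (by omega) hvi hvA
  refine h.linear.lt_of_not_lt hX.1 hA.1 (fun e => hvA (e ▸ hvX)) fun hAX => hvA ?_
  exact h.mem_cl_of_between hB.1 hA.1 hX.1 (h.induced _ hi _ hj hij B hB A hA) hAX
    (hB.2 ▸ hvi) hvX

theorem inner_lt_zone (h : IsCentralOrderWith C H K s l) (hi : i ∈ Icc 1 l.length)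
    (hj : j ∈ Icc 1 l.length) (hji : j < i) (hX : X ∈ zone G C K s l i)
    (hA : A ∈ inner G C K l j) : s A X := by
  rcases hX with (hX | hX) | hX
  · exact h.inner_lt_zoneL hi hj hji hX hA
  · exact h.induced _ hj _ hi hji A hA X hX
  · obtain ⟨B, hB⟩ := h.exists_inner hi
    exact h.linear.2.1 A hA.1 B hB.1 X hX.1 (h.induced _ hj _ hi hji A hA B hB)
      (hX.2.1 B hB X rfl)

/-- The clique C(X) lies in some leaf j. The vertex witnessing that X is in the zone rules out j <
i; for j > i an inner component of 𝕃_i lies between X and the j-th leaf and inherits all of C(X). -/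
theorem cl_subset_of_mem_zoneL [Finite V] (h : IsCentralOrderWith C H K s l)
    (hi : i ∈ Icc 1 l.length) (hX : X ∈ zoneL G C K s l i) : cl G C X ⊆ leafAt l i := by
  obtain ⟨v, hvX, hvi, hvi'⟩ := hX.2.2
  obtain ⟨j, hj, hXj⟩ := h.consecutive.exists_subset_leafAt (h.clique X hX.1) ⟨v, hvX⟩
  rcases lt_trichotomy j i with hji | rfl | hij
  · exact absurd (h.consecutive.mem_leafAt (by omega) (Nat.sub_le _ _) (hXj hvX) hvi) hvi'
  · exact hXj
  · intro c hc
    obtain ⟨A, hA⟩ := h.exists_inner hi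
    obtain ⟨B, hB⟩ := h.exists_inner hj
    exact h.mem_leafAt_of_mem_cl hA hX.1 hB.1 (hX.2.1 X rfl A hA)
      (h.induced _ hi _ hj hij A hA B hB) hc (hB.2 ▸ hXj hc)

theorem cl_subset_of_mem_zoneR [Finite V] (h : IsCentralOrderWith C H K s l)
    (hi : i ∈ Icc 1 l.length) (hX : X ∈ zoneR G C K s l i) : cl G C X ⊆ leafAt l i := by
  obtain ⟨v, hvX, hvi, hvi'⟩ := hX.2.2
  obtain ⟨j, hj, hXj⟩ := h.consecutive.exists_subset_leafAt (h.clique X hX.1) ⟨v, hvX⟩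
  rcases lt_trichotomy j i with hji | rfl | hij
  · intro c hc
    obtain ⟨A, hA⟩ := h.exists_inner hi
    obtain ⟨B, hB⟩ := h.exists_inner hj
    exact h.mem_leafAt_of_mem_cl hA hB.1 hX.1 (h.induced _ hj _ hi hji B hB A hA)
      (hX.2.1 A hA X rfl) (hB.2 ▸ hXj hc) hc
  · exact hXj
  · exact absurd (h.consecutive.mem_leafAt (Nat.le_succ _) (by omega) hvi (hXj hvX)) hvi'

theorem zone_prec [Finite V] (h : IsCentralOrderWith C H K s l) (hi : i ∈ Icc 1 l.length)
    (hj : j ∈ Icc 1 l.length) (hij : i < j) :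
    SetPrec s (zone G C K s l i) (zone G C K s l j) := by
  intro X hX Y hY
  have trans : ∀ {A}, A ∈ K → X ∈ K → Y ∈ K → s X A → s A Y → s X Y :=
    fun hA hX hY => h.linear.2.1 X hX _ hA Y hY
  rcases hX with (hX' | hX') | hX'
  · obtain ⟨A, hA⟩ := h.exists_inner hi
    have hAY := h.inner_lt_zone hj hi hij hY hA
    have hYK : Y ∈ K := by rcases hY with (hY | hY) | hY <;> exact hY.1
    exact trans hA.1 hX'.1 hYK (hX'.2.1 X rfl A hA) hAY
  · exact h.inner_lt_zone hj hi hij hY hX'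
  · rcases hY with (hY' | hY') | hY'
    · rcases lt_or_ge (i + 1) j with hij' | hij'
      · have hi1 := mem_Icc_of_between hi hj (Nat.le_succ i) hij'.le
        obtain ⟨A, hA⟩ := h.exists_inner hi1
        exact trans hA.1 hX'.1 hY'.1 (h.zoneR_lt_inner hi hi1 (Nat.lt_succ_self i) hX' hA)
          (h.inner_lt_zoneL hj hi1 hij' hY' hA)
      · obtain rfl : j = i + 1 := by omega
        obtain ⟨v, hvX, hvi, hvi'⟩ := hX'.2.2
        have hvY : v ∉ cl G C Y := fun e => hvi' (h.cl_subset_of_mem_zoneL hj hY' e)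
        refine h.linear.lt_of_not_lt hX'.1 hY'.1 (fun e => hvY (e ▸ hvX)) fun hYX => hvY ?_
        obtain ⟨A, hA⟩ := h.exists_inner hi
        exact h.mem_cl_of_between hA.1 hY'.1 hX'.1 (h.inner_lt_zoneL hj hi hij hY' hA) hYX
          (hA.2 ▸ hvi) hvX
    · exact h.zoneR_lt_inner hi hj hij hX' hY'
    · obtain ⟨A, hA⟩ := h.exists_inner hj
      exact trans hA.1 hX'.1 hY'.1 (h.zoneR_lt_inner hi hj hij hX' hA) (hY'.2.1 A hA Y rfl)

theorem mem_of_mem_zone (hX : X ∈ zone G C K s l i) : X ∈ K := by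
  rcases hX with (hX | hX) | hX <;> exact hX.1

theorem disjoint_zone [Finite V] (h : IsCentralOrderWith C H K s l) (hi : i ∈ Icc 1 l.length)
    (hj : j ∈ Icc 1 l.length) (hij : i ≠ j) :
    Disjoint (zone G C K s l i) (zone G C K s l j) := by
  rw [disjoint_left]
  intro X hX hX'
  rcases lt_or_gt_of_ne hij with hlt | hlt
  · exact h.linear.1 X (mem_of_mem_zone hX) (h.zone_prec hi hj hlt X hX X hX')
  · exact h.linear.1 X (mem_of_mem_zone hX) (h.zone_prec hj hi hlt X hX' X hX)

/-- Suppose X is in no zone, and let 𝕃_m be the last leaf with inner components to the left of X.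
Not being in the zones of 𝕃_m and 𝕃_{m+1} gives C(X) ⊆ C(𝕃_m) ∩ C(𝕃_{m+1}), and gluing places this
intersection inside C^s(X). So X is ambiguous simple with a minimal sector clique, contrary to
assumption (b). -/
theorem exists_mem_zone [Finite V] (h : IsCentralOrderWith C H K s l)
    (hsector : ∀ I ∈ ambiguousSimple G C, ¬ IsMinSectorClique H (cl G C I)) (hX : X ∈ K) :
    ∃ i ∈ Icc 1 l.length, X ∈ zone G C K s l i := by
  classical
  by_contra hcon
  push Not at hcon
  have hcl : ∀ i ∈ Icc 1 l.length, ∀ A ∈ inner G C K l i, A ≠ X := fun i hi A hA e =>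
    hcon i hi (Or.inl (Or.inr (e ▸ hA)))
  have hsame : ∀ i ∈ Icc 1 l.length, ∀ A ∈ inner G C K l i, ∀ B ∈ inner G C K l i,
      s A X → s B X := by
    intro i hi A hA B hB hAX
    refine h.linear.lt_of_not_lt hB.1 hX (hcl i hi B hB) fun hXB => hcon i hi (Or.inl (Or.inr ?_))
    refine ⟨hX, (h.consecutive.isMaxCliqueOf hi).2.2 _ (h.clique X hX) fun c hc => ?_⟩
    exact h.mem_cl_of_between hA.1 hX hB.1 hAX hXB (hA.2.symm ▸ hc) (hB.2.symm ▸ hc)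
  let P : ℕ → Prop := fun i => ∃ A ∈ inner G C K l i, s A X
  -- The value m = 0 occurs when no inner component is to the left of X, and m = n when none is to
  -- the right; `leafAt` is then empty on that side.
  let m := Nat.findGreatest P l.length
  have hm : m ≤ l.length := Nat.findGreatest_le _
  have hleft : m ∈ Icc 1 l.length → ∀ A ∈ inner G C K l m, s A X := by
    intro hm' A hA
    obtain ⟨B, hB, hBX⟩ := Nat.findGreatest_of_ne_zero (P := P) (m := m) rfl (by
      have := hm'.1; omega)
    exact hsame m hm' B hB A hA hBX
  have hright : m + 1 ∈ Icc 1 l.length → ∀ A ∈ inner G C K l (m + 1), s X A := by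
    intro hm' A hA
    refine h.linear.lt_of_not_lt hX hA.1 (hcl _ hm' A hA).symm fun hAX => ?_
    exact Nat.findGreatest_is_greatest (P := P) (n := l.length) (k := m + 1)
      (Nat.lt_succ_self _) hm'.2 ⟨A, hA, hAX⟩
  have h1 : ∀ c ∈ cl G C X, c ∈ leafAt l m → c ∈ leafAt l (m + 1) := by
    intro c hc hcm
    by_contra hcm'
    have hm' := mem_Icc_of_mem_leafAt hcm
    refine hcon m hm' (Or.inr ⟨hX, ?_, c, hc, hcm, hcm'⟩)
    rintro A hA _ rfl
    exact hleft hm' A hA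
  have h2 : ∀ c ∈ cl G C X, c ∈ leafAt l (m + 1) → c ∈ leafAt l m := by
    intro c hc hcm
    by_contra hcm'
    have hm' := mem_Icc_of_mem_leafAt hcm
    refine hcon (m + 1) hm' (Or.inl (Or.inl ⟨hX, ?_, c, hc, hcm, hcm'⟩))
    rintro _ rfl A hA
    exact hright hm' A hA
  have h3 : cl G C X ⊆ leafAt l m ∩ leafAt l (m + 1) := by
    intro c hc
    suffices c ∈ leafAt l m ∨ c ∈ leafAt l (m + 1) from
      this.elim (fun e => ⟨e, h1 c hc e⟩) fun e => ⟨h2 c hc e, e⟩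
    obtain ⟨j, hj, hcj⟩ := h.consecutive.exists_mem_leafAt ((h.clique X hX).1 hc)
    obtain ⟨B, hB⟩ := h.exists_inner hj
    rcases le_or_gt j m with hjm | hmj
    · left
      rcases hjm.eq_or_lt with rfl | hlt
      · exact hcj
      have hm' := (⟨hj.1.trans hjm, hm⟩ : m ∈ Icc 1 l.length)
      obtain ⟨A, hA⟩ := h.exists_inner hm'
      exact h.mem_leafAt_of_mem_cl hA hB.1 hX (h.induced _ hj _ hm' hlt B hB A hA)
        (hleft hm' A hA) (hB.2 ▸ hcj) hc
    · right
      rcases (show m + 1 ≤ j from hmj).eq_or_lt with rfl | hlt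
      · exact hcj
      have hm' := (⟨by omega, (Nat.succ_le_of_lt hmj).trans hj.2⟩ : m + 1 ∈ Icc 1 l.length)
      obtain ⟨A, hA⟩ := h.exists_inner hm'
      exact h.mem_leafAt_of_mem_cl hA hX hB.1 (hright hm' A hA) (h.induced _ hm' _ hj hlt A hA B hB)
        hc (hB.2 ▸ hcj)
  have h4 : leafAt l m ∩ leafAt l (m + 1) ⊆ clS G C X := by
    rintro c ⟨hc, hc'⟩
    have hm1 := mem_Icc_of_mem_leafAt hc
    have hm2 := mem_Icc_of_mem_leafAt hc'
    obtain ⟨A, hA⟩ := h.exists_inner hm1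
    obtain ⟨B, hB⟩ := h.exists_inner hm2
    exact h.glue A hA.1 X hX B hB.1 (hleft hm1 A hA) (hright hm2 B hB)
      ⟨hA.2.symm ▸ hc, hB.2.symm ▸ hc'⟩
  have h5 := clS_subset_cl (h.subset_comps hX)
  refine hsector X ⟨h.ambiguous_right X hX fun c hc => Or.inl (h4 (h3 hc)),
    nbr_eq_strongNbr_iff.2 (h5.antisymm (h3.trans h4))⟩ ⟨l, h.consecutive, m, hm, ?_⟩
  exact h3.antisymm (h4.trans h5)

/-- An inner component A to the right satisfies C(I) ⊆ C(A) for every I in the zone. Hence nothing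
in C(I) reaches I from the right, which gives ambiguity, and gluing against A turns I ≺ J into I ⊏
J. -/
theorem zoneL_chain [Finite V] (h : IsCentralOrderWith C H K s l)
    (hsimple : ∀ I ∈ ambiguousSimple G C, ∀ J ∈ ambiguousSimple G C, cl G C I = cl G C J → I = J)
    (hi : i ∈ Icc 1 l.length) :
    IsChainAmb G C (zoneL G C K s l i) ∧
    Respects G C (zoneL G C K s l i) (leafAt l (i - 1) ∩ leafAt l i) ∧
    ∀ I ∈ zoneL G C K s l i, ∀ J ∈ zoneL G C K s l i, (Below G C I J ↔ s I J) := by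
  obtain ⟨A, hA⟩ := h.exists_inner hi
  have hlt : ∀ I ∈ zoneL G C K s l i, s I A := fun I hI => hI.2.1 I rfl A hA
  have hsub : ∀ I ∈ zoneL G C K s l i, cl G C I ⊆ cl G C A := fun I hI => by
    rw [hA.2]; exact h.cl_subset_of_mem_zoneL hi hI
  have hamb : zoneL G C K s l i ⊆ ambiguous G C := fun I hI =>
    h.ambiguous_right I hI.1 fun c hc => Or.inr ⟨A, hA.1, hlt I hI, hsub I hI hc⟩
  have hbelow : ∀ I ∈ zoneL G C K s l i, ∀ J ∈ zoneL G C K s l i, s I J → Below G C I J := by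
    intro I hI J hJ hIJ
    refine ⟨fun e => h.linear.1 J hJ.1 (e ▸ hIJ), fun c hc => ?_⟩
    exact h.glue I hI.1 J hJ.1 A hA.1 hIJ (hlt J hJ) ⟨hc, hsub I hI hc⟩
  refine ⟨⟨hamb, fun I hI J hJ => ?_⟩, fun I hI => ?_, fun I hI J hJ =>
    ⟨fun hb => ?_, hbelow I hI J hJ⟩⟩
  · by_cases e : I = J
    · exact Or.inl e
    · exact Or.inr ((h.linear.2.2 I hI.1 J hJ.1 e).imp (hbelow I hI J hJ) (hbelow J hJ I hI))
  · rintro c ⟨hc, hc'⟩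
    have hi' := mem_Icc_of_mem_leafAt hc
    obtain ⟨B, hB⟩ := h.exists_inner hi'
    exact h.glue B hB.1 I hI.1 A hA.1
      (h.inner_lt_zoneL hi hi' (by have := hi.1; omega) hI hB) (hlt I hI)
      ⟨hB.2.symm ▸ hc, hA.2.symm ▸ hc'⟩
  · refine h.linear.lt_of_not_lt hI.1 hJ.1 hb.1 fun hJI => ?_
    exact hb.asymm hsimple (hamb hI) (hamb hJ) (hbelow J hJ I hI hJI)

theorem zoneR_chain [Finite V] (h : IsCentralOrderWith C H K s l)
    (hsimple : ∀ I ∈ ambiguousSimple G C, ∀ J ∈ ambiguousSimple G C, cl G C I = cl G C J → I = J)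
    (hi : i ∈ Icc 1 l.length) :
    IsChainAmb G C (zoneR G C K s l i) ∧
    Respects G C (zoneR G C K s l i) (leafAt l i ∩ leafAt l (i + 1)) ∧
    ∀ I ∈ zoneR G C K s l i, ∀ J ∈ zoneR G C K s l i, (Below G C I J ↔ s J I) := by
  obtain ⟨A, hA⟩ := h.exists_inner hi
  have hlt : ∀ I ∈ zoneR G C K s l i, s A I := fun I hI => hI.2.1 A hA I rfl
  have hsub : ∀ I ∈ zoneR G C K s l i, cl G C I ⊆ cl G C A := fun I hI => by
    rw [hA.2]; exact h.cl_subset_of_mem_zoneR hi hI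
  have hamb : zoneR G C K s l i ⊆ ambiguous G C := fun I hI =>
    h.ambiguous_left I hI.1 fun c hc => Or.inr ⟨A, hA.1, hlt I hI, hsub I hI hc⟩
  have hbelow : ∀ I ∈ zoneR G C K s l i, ∀ J ∈ zoneR G C K s l i, s J I → Below G C I J := by
    intro I hI J hJ hIJ
    refine ⟨fun e => h.linear.1 J hJ.1 (e ▸ hIJ), fun c hc => ?_⟩
    exact h.glue A hA.1 J hJ.1 I hI.1 (hlt J hJ) hIJ ⟨hsub I hI hc, hc⟩
  refine ⟨⟨hamb, fun I hI J hJ => ?_⟩, fun I hI => ?_, fun I hI J hJ =>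
    ⟨fun hb => ?_, hbelow I hI J hJ⟩⟩
  · by_cases e : I = J
    · exact Or.inl e
    · exact Or.inr ((h.linear.2.2 J hJ.1 I hI.1 (Ne.symm e)).imp (hbelow I hI J hJ)
        (hbelow J hJ I hI))
  · rintro c ⟨hc, hc'⟩
    have hi' := mem_Icc_of_mem_leafAt hc'
    obtain ⟨B, hB⟩ := h.exists_inner hi'
    exact h.glue A hA.1 I hI.1 B hB.1 (hlt I hI)
      (h.zoneR_lt_inner hi hi' (Nat.lt_succ_self i) hI hB)
      ⟨hA.2.symm ▸ hc, hB.2.symm ▸ hc'⟩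
  · refine h.linear.lt_of_not_lt hJ.1 hI.1 hb.1.symm fun hJI => ?_
    exact hb.asymm hsimple (hamb hI) (hamb hJ) (hbelow J hJ I hI hJI)

/-- The cut is made by the last component of the zone. If the zone is empty, an inner component of
the previous leaf cuts out the border; for the first leaf the border is empty. -/
theorem exists_isSideClique_left [Finite V] (h : IsCentralOrderWith C H K s l)
    (hsimple : ∀ I ∈ ambiguousSimple G C, ∀ J ∈ ambiguousSimple G C, cl G C I = cl G C J → I = J)
    (hi : i ∈ Icc 1 l.length) (hX : X ∈ inner G C K l i) :
    ∃ CL, IsSideClique G C (zoneL G C K s l i) (leafAt l (i - 1) ∩ leafAt l i) CL ∧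
      IsLeftCut G C K s X CL ∧ CL ⊆ cl G C X := by
  obtain ⟨hchain, -, hord⟩ := h.zoneL_chain hsimple hi
  rcases (zoneL G C K s l i).eq_empty_or_nonempty with he | hne
  · refine ⟨_, Or.inr ⟨he, rfl⟩, ?_, by rw [hX.2]; exact inter_subset_right⟩
    by_cases hi' : i - 1 ∈ Icc 1 l.length
    · obtain ⟨B, hB⟩ := h.exists_inner hi'
      refine Or.inr ⟨B, hB.1, h.induced _ hi' _ hi (by have := hi.1; omega) B hB X hX,
        fun c hc => ?_⟩
      rw [hX.2] at hc
      rw [hB.2]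
      exact ⟨fun e => e.1, fun e => ⟨e, hc⟩⟩
    · left
      by_contra hne
      obtain ⟨c, hc⟩ := nonempty_iff_ne_empty.2 hne
      exact hi' (mem_Icc_of_mem_leafAt hc.1)
  · obtain ⟨Z, hZ, hmax⟩ := exists_max_image _ (rank K s) (toFinite _) hne
    refine ⟨cl G C Z, Or.inl ⟨Z, hZ, fun I hI => ?_, rfl⟩,
      Or.inr ⟨Z, hZ.1, hZ.2.1 Z rfl X hX, fun c _ => Iff.rfl⟩,
      by rw [hX.2]; exact h.cl_subset_of_mem_zoneL hi hZ⟩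
    by_cases e : I = Z
    · exact Or.inl e
    · right
      rw [hord I hI Z hZ]
      refine h.linear.lt_of_not_lt hI.1 hZ.1 e fun hZI => ?_
      exact absurd (h.linear.rank_lt hZ.1 hI.1 hZI) (not_lt.2 (hmax I hI))

theorem exists_isSideClique_right [Finite V] (h : IsCentralOrderWith C H K s l)
    (hsimple : ∀ I ∈ ambiguousSimple G C, ∀ J ∈ ambiguousSimple G C, cl G C I = cl G C J → I = J)
    (hi : i ∈ Icc 1 l.length) (hX : X ∈ inner G C K l i) :
    ∃ CR, IsSideClique G C (zoneR G C K s l i) (leafAt l i ∩ leafAt l (i + 1)) CR ∧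
      IsLeftCut G C K (fun I J => s J I) X CR ∧ CR ⊆ cl G C X := by
  obtain ⟨hchain, -, hord⟩ := h.zoneR_chain hsimple hi
  rcases (zoneR G C K s l i).eq_empty_or_nonempty with he | hne
  · refine ⟨_, Or.inr ⟨he, rfl⟩, ?_, by rw [hX.2]; exact inter_subset_left⟩
    by_cases hi' : i + 1 ∈ Icc 1 l.length
    · obtain ⟨B, hB⟩ := h.exists_inner hi'
      refine Or.inr ⟨B, hB.1, h.induced _ hi _ hi' (Nat.lt_succ_self i) X hX B hB,
        fun c hc => ?_⟩
      rw [hX.2] at hc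
      rw [hB.2]
      exact ⟨fun e => e.2, fun e => ⟨hc, e⟩⟩
    · left
      by_contra hne
      obtain ⟨c, hc⟩ := nonempty_iff_ne_empty.2 hne
      exact hi' (mem_Icc_of_mem_leafAt hc.2)
  · obtain ⟨Z, hZ, hmin⟩ := exists_min_image _ (rank K s) (toFinite _) hne
    refine ⟨cl G C Z, Or.inl ⟨Z, hZ, fun I hI => ?_, rfl⟩,
      Or.inr ⟨Z, hZ.1, hZ.2.1 X hX Z rfl, fun c _ => Iff.rfl⟩,
      by rw [hX.2]; exact h.cl_subset_of_mem_zoneR hi hZ⟩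
    by_cases e : I = Z
    · exact Or.inl e
    · right
      rw [hord I hI Z hZ]
      refine h.linear.lt_of_not_lt hZ.1 hI.1 (Ne.symm e) fun hZI => ?_
      exact absurd (h.linear.rank_lt hI.1 hZ.1 hZI) (not_lt.2 (hmin I hI))

/-- Another inner component with the same clique shields one side of each inner component, which
makes it ambiguous. A middle one is shielded on both sides, hence simple, and assumption (a) allows
only one of these. -/
theorem multi [Finite V] (h : IsCentralOrderWith C H K s l)
    (hsimple : ∀ I ∈ ambiguousSimple G C, ∀ J ∈ ambiguousSimple G C, cl G C I = cl G C J → I = J)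
    (hi : i ∈ Icc 1 l.length) (hnt : (inner G C K l i).Nontrivial) {IL IR : Set V}
    (hIL : IL ∈ inner G C K l i) (hIL' : ∀ X ∈ inner G C K l i, X ≠ IL → s IL X)
    (hIR : IR ∈ inner G C K l i) (hIR' : ∀ X ∈ inner G C K l i, X ≠ IR → s X IR) :
    inner G C K l i ⊆ ambiguous G C ∧
      (inner G C K l i \ {IL, IR}).Subsingleton ∧
      inner G C K l i \ {IL, IR} ⊆ ambiguousSimple G C ∧
      SetPrec (Below G C) (zoneL G C K s l i) {IL} ∧
      Respects G C (zoneL G C K s l i ∪ {IL}) (leafAt l (i - 1) ∩ leafAt l i) ∧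
      SetPrec (Below G C) (zoneR G C K s l i) {IR} ∧
      Respects G C (zoneR G C K s l i ∪ {IR}) (leafAt l i ∩ leafAt l (i + 1)) := by
  have hne : IL ≠ IR := by
    rintro rfl
    obtain ⟨X, hX, hX'⟩ := hnt.exists_ne IL
    exact h.linear.asymm hIL.1 hX.1 (hIL' X hX hX') (hIR' X hX hX')
  have hlt : s IL IR := hIR' IL hIL hne
  have hamb : inner G C K l i ⊆ ambiguous G C := by
    intro X hX
    by_cases e : X = IR
    · subst e
      exact h.ambiguous_left X hX.1 fun c hc =>
        Or.inr ⟨IL, hIL.1, hlt, by rw [hIL.2, ← hX.2]; exact hc⟩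
    · exact h.ambiguous_right X hX.1 fun c hc =>
        Or.inr ⟨IR, hIR.1, hIR' X hX e, by rw [hIR.2, ← hX.2]; exact hc⟩
  have hmid : inner G C K l i \ {IL, IR} ⊆ ambiguousSimple G C := by
    rintro X ⟨hX, hX'⟩
    simp only [mem_insert_iff, mem_singleton_iff, not_or] at hX'
    refine ⟨hamb hX, nbr_eq_strongNbr_iff.2 ((clS_subset_cl (h.subset_comps hX.1)).antisymm
      fun c hc => ?_)⟩
    rw [hX.2] at hc
    exact h.glue IL hIL.1 X hX.1 IR hIR.1 (hIL' X hX hX'.1) (hIR' X hX hX'.2)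
      ⟨hIL.2.symm ▸ hc, hIR.2.symm ▸ hc⟩
  obtain ⟨-, hrL, -⟩ := h.zoneL_chain hsimple hi
  obtain ⟨-, hrR, -⟩ := h.zoneR_chain hsimple hi
  refine ⟨hamb, fun X hX Y hY => hsimple X (hmid hX) Y (hmid hY) ?_, hmid, ?_, ?_, ?_, ?_⟩
  · rw [hX.1.2, hY.1.2]
  · rintro X hX _ rfl
    have hlt' := hX.2.1 X rfl _ hIL
    refine ⟨fun e => h.linear.1 X hX.1 (by rw [← e] at hlt'; exact hlt'), fun c hc => ?_⟩
    exact h.glue X hX.1 _ hIL.1 IR hIR.1 hlt' hlt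
      ⟨hc, hIR.2.symm ▸ h.cl_subset_of_mem_zoneL hi hX hc⟩
  · rintro X (hX | rfl)
    · exact hrL X hX
    · rintro c ⟨hc, hc'⟩
      have hi' := mem_Icc_of_mem_leafAt hc
      obtain ⟨B, hB⟩ := h.exists_inner hi'
      exact h.glue B hB.1 X hIL.1 IR hIR.1
        (h.induced _ hi' _ hi (by have := hi.1; omega) B hB X hIL) hlt
        ⟨hB.2.symm ▸ hc, hIR.2.symm ▸ hc'⟩
  · rintro X hX _ rfl
    have hlt' := hX.2.1 _ hIR X rfl
    refine ⟨fun e => h.linear.1 X hX.1 (by rw [← e] at hlt'; exact hlt'), fun c hc => ?_⟩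
    exact h.glue IL hIL.1 _ hIR.1 X hX.1 hlt hlt'
      ⟨hIL.2.symm ▸ h.cl_subset_of_mem_zoneR hi hX hc, hc⟩
  · rintro X (hX | rfl)
    · exact hrR X hX
    · rintro c ⟨hc, hc'⟩
      have hi' := mem_Icc_of_mem_leafAt hc'
      obtain ⟨B, hB⟩ := h.exists_inner hi'
      exact h.glue IL hIL.1 X hIR.1 B hB.1 hlt
        (h.induced _ hi _ hi' (Nat.lt_succ_self i) X hIR B hB)
        ⟨hIL.2.symm ▸ hc, hB.2.symm ▸ hc'⟩

theorem isGoodOrderWith [Finite V] (h : IsCentralOrderWith C H K s l)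
    (hsimple : ∀ I ∈ ambiguousSimple G C, ∀ J ∈ ambiguousSimple G C, cl G C I = cl G C J → I = J)
    (hsector : ∀ I ∈ ambiguousSimple G C, ¬ IsMinSectorClique H (cl G C I))
    {T : PQTree (Set V)} (hT : T.Admissible l) : IsGoodOrderWith C K s l H T where
  interval i hi := by
    refine ⟨h.exists_inner hi, fun A hA B hB X hX hAX hXB => ⟨hX, ?_⟩⟩
    refine (h.consecutive.isMaxCliqueOf hi).2.2 _ (h.clique X hX) fun c hc => ?_
    exact h.mem_cl_of_between hA.1 hX hB.1 hAX hXB (hA.2.symm ▸ hc) (hB.2.symm ▸ hc)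
  induced := h.induced
  admissible := hT
  zone_union := by
    refine subset_antisymm (fun X hX => ?_) (iUnion₂_subset fun i _ X hX => mem_of_mem_zone hX)
    obtain ⟨i, hi, hXi⟩ := h.exists_mem_zone hsector hX
    exact mem_iUnion₂.2 ⟨i, hi, hXi⟩
  zone_disjoint i hi j hj hij := h.disjoint_zone hi hj hij
  zone_prec i hi j hj hij := h.zone_prec hi hj hij
  zoneL_chain i hi := h.zoneL_chain hsimple hi
  zoneR_chain i hi := h.zoneR_chain hsimple hi
  multi i hi hnt IL hIL hIL' IR hIR hIR' := h.multi hsimple hi hnt hIL hIL' hIR hIR'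
  single i hi IS hIS := by
    have hX : IS ∈ inner G C K l i := by rw [hIS]; rfl
    obtain ⟨CL, h1, h2, h3⟩ := h.exists_isSideClique_left hsimple hi hX
    obtain ⟨CR, h1', h2', h3'⟩ := h.exists_isSideClique_right hsimple hi hX
    have hcl := h.clique IS hX.1
    refine ⟨CL, CR, h1, h1', hcl.mono h3, hcl.mono h3', ?_,
      h.circularArc IS hX.1 CL CR h2 h2' h3 h3'⟩
    -- A vertex in both cuts is shared by a component on each side, so by gluing it has no neighbour
    -- in the inner component.
    rintro c ⟨hc, -⟩
    by_cases hcL : c ∈ CL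
    · refine Or.inr ⟨hc.1, fun hcR => ?_⟩
      rcases h2 with rfl | ⟨Z, hZ, hZX, hZc⟩
      · exact hcL
      rcases h2' with rfl | ⟨Z', hZ', hZX', hZc'⟩
      · exact hcR
      have := h.glue Z hZ IS hX.1 Z' hZ' hZX hZX'
        ⟨(hZc c (h3 hcL)).1 hcL, (hZc' c (h3 hcL)).1 hcR⟩
      exact this.2 hc
    · exact Or.inl ⟨hc.1, hcL⟩

end IsCentralOrderWith

theorem IsCentralOrder.isGoodOrder [Finite V] (h : IsCentralOrder C H K s)
    (hsimple : ∀ I ∈ ambiguousSimple G C, ∀ J ∈ ambiguousSimple G C, cl G C I = cl G C J → I = J)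
    (hsector : ∀ I ∈ ambiguousSimple G C, ¬ IsMinSectorClique H (cl G C I))
    {T : PQTree (Set V)} (hT : IsPQTreeOf H T) : IsGoodOrder C K s H T := by
  obtain ⟨l, hl, hind⟩ := h.exists_isConsecutive
  exact ⟨h.linear, l, (IsCentralOrderWith.mk h hl hind).isGoodOrderWith hsimple hsector
    ((hT l).2 hl)⟩

end CentralOrder

/-! ### From centered models to good triples -/

section CenteredModel

variable {V : Type*} {G : SimpleGraph V} {C : Set V} {H : G.Subgraph} {φ : V → Set ℂ}

/-- Helly's theorem for convex sets of a finite linear order. -/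
theorem exists_forall_mem_of_convex [Finite V] {K : Set (Set V)} {s : Set V → Set V → Prop}
    (hs : IsStrictLinearOn K s) {Q : Set V} (hQ : Q.Nonempty) (g : V → Set (Set V))
    (hgK : ∀ c ∈ Q, g c ⊆ K)
    (hconv : ∀ c ∈ Q, ∀ I ∈ g c, ∀ J ∈ g c, ∀ X ∈ K, s I X → s X J → X ∈ g c)
    (hmeet : ∀ c ∈ Q, ∀ d ∈ Q, (g c ∩ g d).Nonempty) : ∃ I ∈ K, ∀ c ∈ Q, I ∈ g c := by
  have hmin : ∀ c, ∃ I, c ∈ Q → I ∈ g c ∧ ∀ J ∈ g c, rank K s I ≤ rank K s J := by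
    intro c
    by_cases hc : c ∈ Q
    · obtain ⟨I, hI, hI'⟩ := exists_min_image (g c) (rank K s) (toFinite _)
        ((hmeet c hc c hc).mono inter_subset_left)
      exact ⟨I, fun _ => ⟨hI, hI'⟩⟩
    · exact ⟨∅, fun h => absurd h hc⟩
  choose f hf using hmin
  -- The common element is the latest of the first elements: every other set starts no later and
  -- shares a later or equal element with g c.
  obtain ⟨c, hc, hmax⟩ := exists_max_image Q (fun c => rank K s (f c)) (toFinite _) hQ
  have hfK := fun d (hd : d ∈ Q) => hgK d hd (hf d hd).1
  refine ⟨f c, hfK c hc, fun d hd => ?_⟩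
  obtain ⟨J, hJc, hJd⟩ := hmeet c hc d hd
  by_cases e1 : f c = f d
  · rw [e1]; exact (hf d hd).1
  by_cases e2 : f c = J
  · rw [e2]; exact hJd
  refine hconv d hd _ (hf d hd).1 J hJd _ (hfK c hc) ?_ ?_
  · exact hs.lt_of_not_lt (hfK d hd) (hfK c hc) (Ne.symm e1) fun h =>
      absurd (hs.rank_lt (hfK c hc) (hfK d hd) h) (not_lt.2 (hmax d hd))
  · exact hs.lt_of_not_lt (hfK c hc) (hgK c hc hJc) e2 fun h =>
      absurd (hs.rank_lt (hgK c hc hJc) (hfK c hc) h) (not_lt.2 ((hf c hc).2 J hJc))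

theorem IsCenteredModel.isCliqueOf_cl (h : IsCenteredModel C H φ) {I : Set V}
    (hI : I ∈ circleComps G C φ) : IsCliqueOf H (cl G C I) := by
  have hsub : cl G C I ⊆ H.verts := fun c hc => by
    by_contra hcH
    have := h.gap_empty c ⟨hc.1, hcH⟩
    exact (this ▸ (⟨hI, hc⟩ : I ∈ gap G C φ c) : I ∈ (∅ : Set (Set V)))
  refine ⟨hsub, fun u hu v hv huv => ?_⟩
  rw [h.gap_adj u (hsub hu) v (hsub hv) huv]
  exact ⟨I, ⟨hI, hu⟩, hI, hv⟩

/-- This is where geometry is left behind. Helly's theorem for the sets φ*(c), convex by gluing,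
provides a component for each maximal clique; the other conditions are read off the line model. -/
theorem IsCenteredModel.isCentralOrder [Finite V] (hC : G.IsClique C)
    (h : IsCenteredModel C H φ) : IsCentralOrder C H (circleComps G C φ) (prec φ) := by
  obtain ⟨l, r, a, b, hm, hs⟩ := exists_lineModel_circleComps h.model h.center
  have hK : circleComps G C φ ⊆ comps G C := fun I hI => hI.1
  have hlin := hm.isStrictLinearOn hK hs
  have hglue : ∀ I ∈ circleComps G C φ, ∀ X ∈ circleComps G C φ, ∀ J ∈ circleComps G C φ,
      prec φ I X → prec φ X J → cl G C I ∩ cl G C J ⊆ clS G C X :=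
    fun I hI X hX J hJ hIX hXJ => hm.inter_subset_clS hI hX hJ ((hs I hI X hX).1 hIX)
      ((hs X hX J hJ).1 hXJ)
  have hnonadj : ∀ {X c v}, X ∈ circleComps G C φ → c ∈ clS G C X → v ∈ X →
      a c < l v ∧ r v < b c := fun {X c v} hX hc hv => by
    have := (mem_clS_iff.1 hc).2 v hv
    rw [hm.adj_center c hc.1 v ⟨X, hX, hv⟩, not_or, not_le, not_le] at this
    exact this
  refine ⟨hK, hlin, hglue, fun I hI => h.isCliqueOf_cl hI, ?_, ?_, ?_, ?_⟩
  · intro Q hQ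
    obtain ⟨I, hI, hI'⟩ := exists_forall_mem_of_convex hlin hQ.1 (gap G C φ)
      (fun c _ I hI => hI.1)
      (fun c _ I hI J hJ X hX hIX hXJ => ⟨hX, clS_subset_cl (hK hX)
        (hglue I hI.1 X hX J hJ.1 hIX hXJ ⟨hI.2, hJ.2⟩)⟩)
      (fun c hc d hd => by
        by_cases e : c = d
        · subst e
          rw [inter_self]
          exact h.gap_nonempty c (hQ.2.1.1 hc)
        · exact (h.gap_adj c (hQ.2.1.1 hc) d (hQ.2.1.1 hd) e).1 (hQ.2.1.2 hc hd e))
    exact ⟨I, hI, hQ.2.2 _ (h.isCliqueOf_cl hI) fun c hc => (hI' c hc).2⟩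
  · intro X hX hc
    refine (hm.mono subset_rfl (subset_sUnion_of_mem hX)).mem_ambiguous hC (hK hX)
      fun c hcX v hv => ?_
    rcases hc c hcX with hcS | ⟨J, hJ, hXJ, hcJ⟩
    · exact (hnonadj hX hcS hv).2
    · exact hm.lt_right hJ ((hs X hX J hJ).1 hXJ) hcJ v hv
  · intro X hX hc
    refine (hm.mono subset_rfl (subset_sUnion_of_mem hX)).neg.mem_ambiguous hC (hK hX)
      fun c hcX v hv => neg_lt_neg ?_
    rcases hc c hcX with hcS | ⟨J, hJ, hXJ, hcJ⟩
    · exact (hnonadj hX hcS hv).1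
    · exact hm.left_lt hJ ((hs J hJ X hX).1 hXJ) hcJ v hv
  · intro X hX CL CR h1 h2 h3 h4
    exact hm.isCircularArc_extGraph hC hK (fun I hI J hJ => (hs I hI J hJ).1) hX h1 h2 h3 h4

theorem IsCenteredModel.isGoodTriple [Finite V] (hC : G.IsClique C)
    (h : IsCenteredModel C H φ) {T : PQTree (Set V)} (hT : IsPQTreeOf H T)
    (hsimple : ∀ I ∈ ambiguousSimple G C, ∀ J ∈ ambiguousSimple G C, cl G C I = cl G C J → I = J)
    (hsector : ∀ I ∈ ambiguousSimple G C, ¬ IsMinSectorClique H (cl G C I))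
    {D : Set (Set V)} (hD : D ⊆ forcedToStick C H) :
    IsGoodTriple C H T D (circleComps G C φ) (stickComps G C φ \ D) (prec φ) := by
  have hDs : D ⊆ stickComps G C φ := fun I hI => (hD hI).2 φ h
  have hdisj : ∀ I ∈ circleComps G C φ, I ∉ stickComps G C φ := fun I hI =>
    notMem_stickComps_of_mem_circleComps h.model hI
  refine ⟨?_, ?_, (h.isCentralOrder hC).isGoodOrder hsimple hsector hT, ?_⟩
  · ext I
    constructor
    · rintro (hI | hI)
      · exact ⟨hI.1, fun hID => hdisj I hI (hDs hID)⟩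
      · exact ⟨hI.1.1, hI.2⟩
    · rintro ⟨hI, hID⟩
      exact (mem_circleComps_or_mem_stickComps h.model h.center hI).imp id fun hI' => ⟨hI', hID⟩
  · rw [disjoint_left]
    exact fun I hI hI' => hdisj I hI hI'.1
  · rw [sdiff_union_of_subset hDs]
    obtain ⟨l, r, a, b, hm, hb⟩ := exists_lineModel_stickComps h.model h.center
    exact hm.isChainAmb hC (fun I hI => hI.1) hb

end CenteredModel

/-! ### Local models of single components -/

section LocalModel

variable {V : Type*} {G : SimpleGraph V} {C X A B : Set V}

/-- The component `X` has a model on the line such that the vertices of `A` do not reach it from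
the left and those of `B` do not reach it from the right. -/
def HasLocalModel (G : SimpleGraph V) (C X A B : Set V) : Prop :=
  ∃ l r a b : V → ℝ, IsLineModel G (cl G C X) X l r a b ∧
    (∀ c ∈ cl G C X, c ∈ A → ∀ v ∈ X, a c < l v) ∧ (∀ c ∈ cl G C X, c ∈ B → ∀ v ∈ X, r v < b c)

theorem HasLocalModel.symm (h : HasLocalModel G C X A B) : HasLocalModel G C X B A := by
  obtain ⟨l, r, a, b, hm, hA, hB⟩ := h
  exact ⟨_, _, _, _, hm.neg, fun c hc hcB v hv => neg_lt_neg (hB c hc hcB v hv),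
    fun c hc hcA v hv => neg_lt_neg (hA c hc hcA v hv)⟩

theorem HasLocalModel.mono (h : HasLocalModel G C X A B) {A' B' : Set V}
    (hA : A' ∩ cl G C X ⊆ A) (hB : B' ∩ cl G C X ⊆ B) : HasLocalModel G C X A' B' := by
  obtain ⟨l, r, a, b, hm, hA', hB'⟩ := h
  exact ⟨l, r, a, b, hm, fun c hc hcA => hA' c hc (hA ⟨hcA, hc⟩),
    fun c hc hcB => hB' c hc (hB ⟨hcB, hc⟩)⟩

/-- In an interval model with C left-most, the right endpoint of c is its left threshold and no
right threshold is needed, so B is arbitrary. A vertex of A in C(X) has no neighbour in X, and its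
threshold can be withdrawn to the left of everything. -/
theorem hasLocalModel_of_ambiguous [Finite V] (hX : X ∈ ambiguous G C)
    (hA : A ∩ cl G C X ⊆ clS G C X) (B : Set V) : HasLocalModel G C X A B := by
  classical
  obtain ⟨hXc, ψ, hψ, p, hp⟩ := hX
  let l : V → ℝ := fun v => if h : v ∈ C ∪ X then sInf (ψ ⟨v, h⟩) else 0
  let r : V → ℝ := fun v => if h : v ∈ C ∪ X then sSup (ψ ⟨v, h⟩) else 0
  have hlr : ∀ w : ↥(C ∪ X), ψ w = Icc (l w.1) (r w.1) := by
    intro w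
    simp only [l, r, dif_pos w.2]
    exact eq_Icc_of_connected_compact (hψ.connected w) (hψ.compact w)
  have hle : ∀ w : ↥(C ∪ X), l w.1 ≤ r w.1 := by
    intro w
    have := (hψ.connected w).nonempty
    rw [hlr] at this
    exact nonempty_Icc.1 this
  have hadj : ∀ u w : ↥(C ∪ X), u.1 ≠ w.1 → (G.Adj u.1 w.1 ↔ l u.1 ≤ r w.1 ∧ l w.1 ≤ r u.1) := by
    intro u w huw
    have h1 := hψ.adj_iff u w fun e => huw (congrArg Subtype.val e)
    rw [SimpleGraph.comap_adj] at h1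
    refine h1.trans ?_
    rw [hlr u, hlr w]
    constructor
    · rintro ⟨x, hx, hx'⟩
      exact ⟨hx.1.trans hx'.2, hx'.1.trans hx.2⟩
    · rintro ⟨h2, h3⟩
      exact ⟨max (l u.1) (l w.1), ⟨le_max_left _ _, max_le (hle u) h3⟩,
        ⟨le_max_right _ _, max_le h2 (hle w)⟩⟩
  have hpX : ∀ v ∈ X, p < l v := by
    intro v hv
    refine (hp ⟨v, Or.inr hv⟩).2 (notMem_of_mem_comps hXc hv) _ ?_
    rw [hlr]
    exact ⟨le_rfl, hle ⟨v, Or.inr hv⟩⟩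
  have hpC : ∀ c ∈ C, l c ≤ p := by
    intro c hc
    have := (hp ⟨c, Or.inl hc⟩).1 hc
    rw [hlr] at this
    exact this.1
  obtain ⟨m, hm⟩ := exists_lt_of_finite l
  obtain ⟨m', hm'⟩ := exists_gt_of_finite r
  refine ⟨l, r, fun c => if c ∈ A then m else r c, fun _ => m',
    ⟨fun v hv => hle ⟨v, Or.inr hv⟩, fun u hu v hv huv => hadj ⟨u, Or.inr hu⟩ ⟨v, Or.inr hv⟩ huv,
      fun c hc v hv => ?_⟩, fun c _ hcA v _ => ?_, fun _ _ _ v _ => hm' v⟩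
  · have h1 := hm v
    have h2 := hm' v
    have h3 := hpX v hv
    have h4 := hpC c hc.1
    have h5 := hle ⟨v, Or.inr hv⟩
    split_ifs with hcA
    · refine iff_of_false ((mem_clS_iff.1 (hA ⟨hcA, hc⟩)).2 v hv) ?_
      rintro (h | h) <;> linarith
    · rw [hadj ⟨c, Or.inl hc.1⟩ ⟨v, Or.inr hv⟩ fun e : c = v =>
        notMem_of_mem_comps hXc hv (e ▸ hc.1)]
      constructor
      · exact fun h => Or.inl h.2
      · rintro (h | h)
        · exact ⟨by simp only at h5; linarith, h⟩
        · linarith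
  · dsimp only
    rw [if_pos hcA]
    exact hm v

/-- The threshold pair of a vertex represented by an arc, in a circle cut at a point of `v_R`. The
arc is described by `(a, b)` if it contains the cut and by `[x, y]` otherwise; `[x₀, y₀]` represents
`v_L` and `(aR, bR)` the gap of `v_R`. -/
theorem exists_thresholds {l r : V → ℝ} {x₀ y₀ aR bR m m' : ℝ} (hle : ∀ v ∈ X, l v ≤ r v)
    (h0 : x₀ ≤ y₀) (haR : aR < x₀) (hR : ∀ v ∈ X, y₀ < l v ∧ r v < bR) (hm : ∀ v, m < l v)
    (hm' : ∀ v, r v < m') {N : V → Prop} {p q : Prop} (hpq : p → q → ∀ v ∈ X, ¬ N v)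
    (h : (∃ a b, (¬ p ↔ x₀ ≤ a ∨ b ≤ y₀) ∧ ¬ q ∧ ∀ v ∈ X, (N v ↔ l v ≤ a ∨ b ≤ r v)) ∨
      ∃ x y, (¬ p ↔ x ≤ y₀ ∧ x₀ ≤ y) ∧ (¬ q ↔ x ≤ aR ∨ bR ≤ y) ∧
        ∀ v ∈ X, (N v ↔ x ≤ r v ∧ l v ≤ y)) :
    ∃ a b, (∀ v ∈ X, (N v ↔ l v ≤ a ∨ b ≤ r v)) ∧ (p → ∀ v ∈ X, a < l v) ∧
      (q → ∀ v ∈ X, r v < b) := by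
  -- An arc through the cut already has the right form; it meets v_R, and if it avoids v_L it stops
  -- before reaching X from the left.
  rcases h with ⟨a, b, h1, h2, h3⟩ | ⟨x, y, h1, h2, h3⟩
  · refine ⟨a, b, h3, fun hp v hv => ?_, fun hq => absurd hq h2⟩
    by_contra hcon
    refine (h1.2 (Or.inl ?_)) hp
    linarith [(hR v hv).1]
  by_cases hp : p
  · by_cases hq : q
    · refine ⟨m, m', fun v hv => iff_of_false (hpq hp hq v hv) ?_, fun _ v _ => hm v,
        fun _ v _ => hm' v⟩
      rintro (h | h)
      · linarith [hm v]
      · linarith [hm' v]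
    -- The arc avoids v_L but meets v_R. Either it meets v_R on the right and reaches X from there,
    -- with threshold x, or it meets v_R on the left, stops before v_L, and misses X.
    · by_cases hy : bR ≤ y
      · refine ⟨m, x, fun v hv => ?_, fun _ v _ => hm v, fun hq' => absurd hq' hq⟩
        rw [h3 v hv]
        constructor
        · exact fun h => Or.inr h.1
        · rintro (h | h)
          · linarith [hm v]
          · exact ⟨h, by linarith [(hR v hv).2, hle v hv]⟩
      · have hx := (h2.1 hq).resolve_right hy
        have hy' : y < x₀ := by
          by_contra hcon
          exact h1.2 ⟨by linarith, by linarith⟩ hp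
        refine ⟨m, m', fun v hv => ?_, fun _ v _ => hm v, fun _ v _ => hm' v⟩
        rw [h3 v hv]
        refine iff_of_false (fun h => ?_) ?_
        · linarith [h.2, (hR v hv).1]
        · rintro (h | h)
          · linarith [hm v]
          · linarith [hm' v]
  -- The arc meets v_L, so it begins to the left of X and reaches X only from the left, up to y.
  · obtain ⟨hx, hy⟩ := h1.1 hp
    refine ⟨y, m', fun v hv => ?_, fun hp' => absurd hp' hp, fun _ v _ => hm' v⟩
    rw [h3 v hv]
    constructor
    · exact fun h => Or.inl h.2
    · rintro (h | h)
      · exact ⟨by linarith [(hR v hv).1, hle v hv], h⟩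
      · linarith [hm' v]

theorem hasLocalModel_of_thresholds [Finite V] {l r : V → ℝ} {x₀ y₀ aR bR : ℝ}
    (hle : ∀ v ∈ X, l v ≤ r v)
    (hadj : ∀ u ∈ X, ∀ v ∈ X, u ≠ v → (G.Adj u v ↔ l u ≤ r v ∧ l v ≤ r u))
    (h0 : x₀ ≤ y₀) (haR : aR < x₀) (hR : ∀ v ∈ X, y₀ < l v ∧ r v < bR)
    (hAB : ∀ c ∈ cl G C X, c ∈ A → c ∈ B → c ∈ clS G C X)
    (h : ∀ c ∈ cl G C X,
      (∃ a b, (c ∉ A ↔ x₀ ≤ a ∨ b ≤ y₀) ∧ c ∉ B ∧ ∀ v ∈ X, (G.Adj c v ↔ l v ≤ a ∨ b ≤ r v)) ∨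
      ∃ x y, (c ∉ A ↔ x ≤ y₀ ∧ x₀ ≤ y) ∧ (c ∉ B ↔ x ≤ aR ∨ bR ≤ y) ∧
        ∀ v ∈ X, (G.Adj c v ↔ x ≤ r v ∧ l v ≤ y)) : HasLocalModel G C X A B := by
  obtain ⟨m, hm⟩ := exists_lt_of_finite l
  obtain ⟨m', hm'⟩ := exists_gt_of_finite r
  have key : ∀ c, ∃ a b : ℝ, c ∈ cl G C X → (∀ v ∈ X, (G.Adj c v ↔ l v ≤ a ∨ b ≤ r v)) ∧
      (c ∈ A → ∀ v ∈ X, a < l v) ∧ (c ∈ B → ∀ v ∈ X, r v < b) := by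
    intro c
    by_cases hc : c ∈ cl G C X
    · obtain ⟨a, b, hab⟩ := exists_thresholds hle h0 haR hR hm hm'
        (fun hA hB => (mem_clS_iff.1 (hAB c hc hA hB)).2) (h c hc)
      exact ⟨a, b, fun _ => hab⟩
    · exact ⟨0, 0, fun h => absurd h hc⟩
  choose a b hab using key
  exact ⟨l, r, a, b, ⟨hle, hadj, fun c hc => (hab c hc).1⟩, fun c hc => (hab c hc).2.1,
    fun c hc => (hab c hc).2.2⟩

theorem IsCircularArc.exists_branchPt_mem {W : Type*} {Γ : SimpleGraph W} (h : IsCircularArc Γ)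
    (w : W) : ∃ ψ : W → Set ℂ, IsIntersectionModel circ Γ ψ ∧ branchPt ∈ ψ w := by
  obtain ⟨ψ, hψ⟩ := h
  obtain ⟨q, hq⟩ := (hψ.connected w).nonempty
  have hq1 : ‖q‖ = 1 := by simpa [circ] using hψ.subset w hq
  have hq0 : q ≠ 0 := fun e => by simp [e] at hq1
  have hcont : Continuous fun z : ℂ => z * q⁻¹ := by fun_prop
  have hinj : Function.Injective fun z : ℂ => z * q⁻¹ := mul_left_injective₀ (inv_ne_zero hq0)
  refine ⟨fun u => (fun z => z * q⁻¹) '' ψ u, ⟨?_, ?_, ?_, ?_⟩, q, hq, ?_⟩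
  · rintro u _ ⟨z, hz, rfl⟩
    have hz1 : ‖z‖ = 1 := by simpa [circ] using hψ.subset u hz
    simp [circ, hz1, hq1]
  · exact fun u => (hψ.compact u).image hcont
  · exact fun u => (hψ.connected u).image _ hcont.continuousOn
  · intro u v huv
    rw [hψ.adj_iff u v huv, ← image_inter hinj, image_nonempty]
  · simp [hq0, branchPt]

/-- The circle is cut at a point of the arc of v_R. The vertices of X and v_L are not adjacent to
v_R and become intervals. As X is connected and avoids v_L, it lies on one side of v_L, and up to
reflection between v_L and the right-hand end of v_R. A vertex of A avoids v_L and so cannot come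
from the left; a vertex of B avoids v_R and cannot come from the right. -/
theorem hasLocalModel_of_isCircularArc [Finite V] (hX : X ∈ comps G C)
    (h : IsCircularArc (extGraph G C A X B))
    (hAB : ∀ c ∈ cl G C X, c ∈ A → c ∈ B → c ∈ clS G C X) : HasLocalModel G C X A B := by
  classical
  obtain ⟨ψ, hψ, hP⟩ := h.exists_branchPt_mem (.inr true)
  set Γ := extGraph G C A X B
  obtain ⟨aR, bR, hRgap⟩ := exists_gap_of_circ (hψ.subset _) (hψ.compact _) (hψ.connected _) hP
  have hnot : ∀ w, w ≠ .inr true → ¬ Γ.Adj w (.inr true) → ψ w ⊆ circ \ {branchPt} := by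
    intro w hw hadj z hz
    refine ⟨hψ.subset w hz, fun e => hadj ((hψ.adj_iff _ _ hw).2 ⟨branchPt, ?_, hP⟩)⟩
    rw [← mem_singleton_iff.1 e]
    exact hz
  obtain ⟨x₀, y₀, hx₀, h0, hy₀, eL⟩ := exists_eq_circPt_image
    (hnot (.inr false) (by simp) (extGraph_not_adj_inr _ _)) (hψ.compact _) (hψ.connected _)
  have hv : ∀ v, ∃ l r : ℝ, ∀ hv : v ∈ X, 0 < l ∧ l ≤ r ∧ r < 1 ∧
      ψ (.inl ⟨v, Or.inr hv⟩) = circPt '' Icc l r := by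
    intro v
    by_cases hv : v ∈ X
    · obtain ⟨l, r, hlr⟩ := exists_eq_circPt_image (hnot (.inl ⟨v, Or.inr hv⟩) (by simp)
        fun e => notMem_of_mem_comps hX hv ((extGraph_adj_true _).1 e).1)
        (hψ.compact _) (hψ.connected _)
      exact ⟨l, r, fun _ => hlr⟩
    · exact ⟨0, 0, fun h => absurd h hv⟩
  choose l r hlr using hv
  have hLR : ¬ (x₀ ≤ aR ∨ bR ≤ y₀) := by
    rw [← gap_inter_image_nonempty_iff hRgap hx₀ h0 hy₀, ← eL, ← hψ.adj_iff _ _ (by simp)]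
    exact extGraph_not_adj_inr _ _
  have hXR : ∀ v ∈ X, ¬ (l v ≤ aR ∨ bR ≤ r v) := by
    intro v hv
    obtain ⟨h1, h2, h3, h4⟩ := hlr v hv
    rw [← gap_inter_image_nonempty_iff hRgap h1 h2 h3, ← h4, ← hψ.adj_iff _ _ (by simp),
      Γ.adj_comm, extGraph_adj_true]
    exact fun e => notMem_of_mem_comps hX hv e.1
  have hXL : ∀ v ∈ X, ¬ (l v ≤ y₀ ∧ x₀ ≤ r v) := by
    intro v hv
    obtain ⟨h1, h2, h3, h4⟩ := hlr v hv
    rw [← image_inter_image_nonempty_iff h1 h2 h3 hx₀ h0 hy₀, ← h4, ← eL,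
      ← hψ.adj_iff _ _ (by simp), extGraph_adj_false]
    exact fun e => notMem_of_mem_comps hX hv e.1
  have hle : ∀ v ∈ X, l v ≤ r v := fun v hv => (hlr v hv).2.1
  have hadj : ∀ u ∈ X, ∀ v ∈ X, u ≠ v → (G.Adj u v ↔ l u ≤ r v ∧ l v ≤ r u) := by
    intro u hu v hv huv
    obtain ⟨h1, h2, h3, h4⟩ := hlr u hu
    obtain ⟨h1', h2', h3', h4'⟩ := hlr v hv
    rw [← image_inter_image_nonempty_iff h1 h2 h3 h1' h2' h3', ← h4, ← h4',
      ← hψ.adj_iff _ _ (fun e => huv (congrArg Subtype.val (Sum.inl.inj e))), extGraph_adj_inl]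
  have harc : ∀ c ∈ cl G C X,
      (∃ a b, (c ∉ A ↔ x₀ ≤ a ∨ b ≤ y₀) ∧ c ∉ B ∧ ∀ v ∈ X, (G.Adj c v ↔ l v ≤ a ∨ b ≤ r v)) ∨
      ∃ x y, (c ∉ A ↔ x ≤ y₀ ∧ x₀ ≤ y) ∧ (c ∉ B ↔ x ≤ aR ∨ bR ≤ y) ∧
        ∀ v ∈ X, (G.Adj c v ↔ x ≤ r v ∧ l v ≤ y) := by
    intro c hc
    let w : ↥(C ∪ X) := ⟨c, Or.inl hc.1⟩
    have hA : c ∉ A ↔ (ψ (.inl w) ∩ ψ (.inr false)).Nonempty := by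
      rw [← hψ.adj_iff _ _ (by simp), extGraph_adj_false]
      exact ⟨fun e => ⟨hc.1, e⟩, fun e => e.2⟩
    have hB : c ∉ B ↔ (ψ (.inl w) ∩ ψ (.inr true)).Nonempty := by
      rw [← hψ.adj_iff _ _ (by simp), extGraph_adj_true]
      exact ⟨fun e => ⟨hc.1, e⟩, fun e => e.2⟩
    have hN : ∀ v, ∀ hv : v ∈ X, (G.Adj c v ↔ (ψ (.inl w) ∩ ψ (.inl ⟨v, Or.inr hv⟩)).Nonempty) := by
      intro v hv
      rw [← hψ.adj_iff, extGraph_adj_inl]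
      intro e
      have : c = v := congrArg Subtype.val (Sum.inl.inj e)
      exact notMem_of_mem_comps hX hv (this ▸ hc.1)
    by_cases hPc : branchPt ∈ ψ (.inl w)
    · left
      obtain ⟨a, b, hab⟩ := exists_gap_of_circ (hψ.subset _) (hψ.compact _) (hψ.connected _) hPc
      refine ⟨a, b, ?_, hB.2 ⟨_, hPc, hP⟩, fun v hv => ?_⟩
      · rw [hA, eL, gap_inter_image_nonempty_iff hab hx₀ h0 hy₀]
      · obtain ⟨h1, h2, h3, h4⟩ := hlr v hv
        rw [hN v hv, h4, gap_inter_image_nonempty_iff hab h1 h2 h3]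
    · right
      obtain ⟨x, y, hx, hxy, hy, e⟩ := exists_eq_circPt_image (X := ψ (.inl w))
        (fun z hz => ⟨hψ.subset _ hz, fun e => hPc (mem_singleton_iff.1 e ▸ hz)⟩)
        (hψ.compact _) (hψ.connected _)
      refine ⟨x, y, ?_, ?_, fun v hv => ?_⟩
      · rw [hA, e, eL, image_inter_image_nonempty_iff hx hxy hy hx₀ h0 hy₀]
      · rw [hB, e, inter_comm, gap_inter_image_nonempty_iff hRgap hx hxy hy]
      · obtain ⟨h1, h2, h3, h4⟩ := hlr v hv
        rw [hN v hv, e, h4, image_inter_image_nonempty_iff hx hxy hy h1 h2 h3]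
  have hside : (∀ v ∈ X, y₀ < l v) ∨ ∀ v ∈ X, r v < x₀ := by
    have hor : ∀ v ∈ X, y₀ < l v ∨ r v < x₀ := fun v hv => by
      have := hXL v hv
      rw [not_and_or, not_le, not_le] at this
      exact this
    have hstep : ∀ u ∈ X, ∀ v ∈ X, G.Adj u v → l u ≤ r v ∧ l v ≤ r u := fun u hu v hv e =>
      (hadj u hu v hv e.ne).1 e
    obtain ⟨u, hu⟩ := nonempty_of_mem_comps hX
    rcases hor u hu with hu' | hu'
    · refine Or.inl fun v hv => comps_induction hX (P := fun v => y₀ < l v) ?_ hu hu' hv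
      intro v hv w hw hvw hlt
      refine (hor w hw).resolve_right fun e => ?_
      linarith [(hstep v hv w hw hvw).1]
    · refine Or.inr fun v hv => comps_induction hX (P := fun v => r v < x₀) ?_ hu hu' hv
      intro v hv w hw hvw hlt
      refine (hor w hw).resolve_left fun e => ?_
      linarith [(hstep v hv w hw hvw).2]
  rw [not_or, not_le, not_le] at hLR
  have hXR' : ∀ v ∈ X, aR < l v ∧ r v < bR := fun v hv => by
    have := hXR v hv
    rwa [not_or, not_le, not_le] at this
  rcases hside with hside | hside
  · exact hasLocalModel_of_thresholds hle hadj h0 hLR.1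
      (fun v hv => ⟨hside v hv, (hXR' v hv).2⟩) hAB harc
  -- X lies to the left of v_L; the whole picture is reflected.
  · refine hasLocalModel_of_thresholds (l := fun v => -r v) (r := fun v => -l v) (x₀ := -y₀)
      (y₀ := -x₀) (aR := -bR) (bR := -aR) (fun v hv => neg_le_neg (hle v hv)) ?_
      (neg_le_neg h0) (neg_lt_neg hLR.2)
      (fun v hv => ⟨neg_lt_neg (hside v hv), neg_lt_neg (hXR' v hv).1⟩) hAB ?_
    · intro u hu v hv huv
      rw [hadj u hu v hv huv, neg_le_neg_iff, neg_le_neg_iff, and_comm]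
    · intro c hc
      rcases harc c hc with ⟨a, b, h1, h2, h3⟩ | ⟨x, y, h1, h2, h3⟩
      · refine Or.inl ⟨-b, -a, ?_, h2, fun v hv => ?_⟩
        · rw [h1, neg_le_neg_iff, neg_le_neg_iff, or_comm]
        · rw [h3 v hv, neg_le_neg_iff, neg_le_neg_iff, or_comm]
      · refine Or.inr ⟨-y, -x, ?_, ?_, fun v hv => ?_⟩
        · rw [h1, neg_le_neg_iff, neg_le_neg_iff, and_comm]
        · rw [h2, neg_le_neg_iff, neg_le_neg_iff, or_comm]
        · rw [h3 v hv, neg_le_neg_iff, neg_le_neg_iff, and_comm]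

end LocalModel

/-! ### Gluing local models -/

section Gluing

variable {V : Type*} {G : SimpleGraph V} {C : Set V} {K : Set (Set V)}
  {s : Set V → Set V → Prop}

theorem add_sigmoid_lt {m n : ℕ} (h : m < n) (x y : ℝ) :
    (m : ℝ) + Real.sigmoid x < n + Real.sigmoid y := by
  have h1 : (m : ℝ) + 1 ≤ n := by exact_mod_cast h
  have h2 := Real.sigmoid_lt_one x
  have h3 := Real.sigmoid_pos y
  linarith

/-- Local models of linearly ordered components are glued to a line model. -/
theorem exists_lineModel [Finite V] (hK : K ⊆ comps G C) (hs : IsStrictLinearOn K s)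
    {A B : Set V → Set V}
    (hglue : ∀ I ∈ K, ∀ X ∈ K, ∀ J ∈ K, s I X → s X J → cl G C I ∩ cl G C J ⊆ clS G C X)
    (hA : ∀ I ∈ K, ∀ X ∈ K, s I X → cl G C I ∩ cl G C X ⊆ A X)
    (hB : ∀ I ∈ K, ∀ X ∈ K, s X I → cl G C I ∩ cl G C X ⊆ B X)
    (hloc : ∀ X ∈ K, HasLocalModel G C X (A X) (B X)) :
    ∃ l r a b, IsLineModel G C (⋃₀ K) l r a b ∧
      (∀ I ∈ K, ∀ J ∈ K, (s I J ↔ ∀ u ∈ I, ∀ v ∈ J, r u < l v)) ∧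
      ∀ X ∈ K, ∀ c ∈ cl G C X, c ∈ B X → ∀ v ∈ X, r v < b c := by
  classical
  have h1 : ∀ X, ∃ l r a b : V → ℝ, X ∈ K → IsLineModel G (cl G C X) X l r a b ∧
      (∀ c ∈ cl G C X, c ∈ A X → ∀ v ∈ X, a c < l v) ∧
      (∀ c ∈ cl G C X, c ∈ B X → ∀ v ∈ X, r v < b c) := by
    intro X
    by_cases hX : X ∈ K
    · obtain ⟨l, r, a, b, h⟩ := hloc X hX
      exact ⟨l, r, a, b, fun _ => h⟩
    · exact ⟨0, 0, 0, 0, fun h => absurd h hX⟩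
  choose L R La Lb hL using h1
  have h2 : ∀ v, ∃ X, v ∈ ⋃₀ K → X ∈ K ∧ v ∈ X := by
    intro v
    by_cases hv : v ∈ ⋃₀ K
    · obtain ⟨X, hX, hvX⟩ := hv
      exact ⟨X, fun _ => ⟨hX, hvX⟩⟩
    · exact ⟨∅, fun h => absurd h hv⟩
  choose κ hκ' using h2
  have hκ : ∀ X ∈ K, ∀ v ∈ X, κ v = X := fun X hX v hv =>
    eq_of_mem_comps (hK (hκ' v ⟨X, hX, hv⟩).1) (hK hX) (hκ' v ⟨X, hX, hv⟩).2 hv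
  -- F c and E c are the first and the last component containing a vertex that c misses; the gap of
  -- c has to open in the former and close in the latter.
  have h3 : ∀ c, ∃ X Y, {Z ∈ K | c ∈ cl G C Z}.Nonempty → (X ∈ K ∧ c ∈ cl G C X) ∧
      (Y ∈ K ∧ c ∈ cl G C Y) ∧ ∀ Z ∈ K, c ∈ cl G C Z →
        rank K s X ≤ rank K s Z ∧ rank K s Z ≤ rank K s Y := by
    intro c
    by_cases hc : {Z ∈ K | c ∈ cl G C Z}.Nonempty
    · obtain ⟨X, hX, hX'⟩ := exists_min_image _ (rank K s) (toFinite _) hc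
      obtain ⟨Y, hY, hY'⟩ := exists_max_image _ (rank K s) (toFinite _) hc
      exact ⟨X, Y, fun _ => ⟨hX, hY, fun Z hZ hcZ => ⟨hX' Z ⟨hZ, hcZ⟩, hY' Z ⟨hZ, hcZ⟩⟩⟩⟩
    · exact ⟨∅, ∅, fun h => absurd h hc⟩
  choose F E hFE using h3
  let k := rank K s
  have hinj : ∀ X ∈ K, ∀ Y ∈ K, k X = k Y → X = Y := by
    intro X hX Y hY h
    by_contra hne
    rcases hs.2.2 X hX Y hY hne with h' | h'
    · exact (hs.rank_lt hX hY h').ne h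
    · exact (hs.rank_lt hY hX h').ne' h
  have hlt : ∀ X ∈ K, ∀ Y ∈ K, (k X < k Y ↔ s X Y) := fun X hX Y hY => hs.rank_lt_iff hX hY
  -- The local model of the component of rank k is compressed into the open interval (k, k + 1).
  let l : V → ℝ := fun v => k (κ v) + Real.sigmoid (L (κ v) v)
  let r : V → ℝ := fun v => k (κ v) + Real.sigmoid (R (κ v) v)
  -- The default 0 is for vertices adjacent to all components: every right endpoint is positive, so
  -- the threshold b = 0 is always met.
  let a : V → ℝ := fun c => if {Z ∈ K | c ∈ cl G C Z}.Nonempty then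
    k (F c) + Real.sigmoid (La (F c) c) else 0
  let b : V → ℝ := fun c => if {Z ∈ K | c ∈ cl G C Z}.Nonempty then
    k (E c) + Real.sigmoid (Lb (E c) c) else 0
  have hl : ∀ X ∈ K, ∀ v ∈ X, l v = k X + Real.sigmoid (L X v) := fun X hX v hv => by
    simp only [l, hκ X hX v hv]
  have hr : ∀ X ∈ K, ∀ v ∈ X, r v = k X + Real.sigmoid (R X v) := fun X hX v hv => by
    simp only [r, hκ X hX v hv]
  have ha : ∀ X ∈ K, ∀ c ∈ cl G C X, a c = k (F c) + Real.sigmoid (La (F c) c) :=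
    fun X hX c hc => if_pos ⟨X, hX, hc⟩
  have hb : ∀ X ∈ K, ∀ c ∈ cl G C X, b c = k (E c) + Real.sigmoid (Lb (E c) c) :=
    fun X hX c hc => if_pos ⟨X, hX, hc⟩
  have hle : ∀ v ∈ ⋃₀ K, l v ≤ r v := by
    rintro v ⟨X, hX, hv⟩
    rw [hl X hX v hv, hr X hX v hv, add_le_add_iff_left, Real.sigmoid_le_iff]
    exact (hL X hX).1.le v hv
  have hsep : ∀ X ∈ K, ∀ Y ∈ K, k X < k Y → ∀ u ∈ X, ∀ v ∈ Y, r u < l v := by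
    intro X hX Y hY hXY u hu v hv
    rw [hr X hX u hu, hl Y hY v hv]
    exact add_sigmoid_lt hXY _ _
  refine ⟨l, r, a, b, ⟨hle, ?_, ?_⟩, fun I hI J hJ => ?_, ?_⟩
  · rintro u ⟨X, hX, hu⟩ v ⟨Y, hY, hv⟩ huv
    have h1 := hle u ⟨X, hX, hu⟩
    have h2 := hle v ⟨Y, hY, hv⟩
    rcases lt_trichotomy (k X) (k Y) with h | h | h
    · have h3 := hsep X hX Y hY h u hu v hv
      refine iff_of_false (not_adj_of_mem_comps (hK hX) (hK hY) ?_ hu hv) fun e => by linarith [e.2]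
      rintro rfl
      exact lt_irrefl _ h
    · obtain rfl := hinj X hX Y hY h
      rw [(hL X hX).1.adj u hu v hv huv, hl X hX u hu, hl X hX v hv, hr X hX u hu, hr X hX v hv]
      simp only [add_le_add_iff_left, Real.sigmoid_le_iff]
    · have h3 := hsep Y hY X hX h v hv u hu
      refine iff_of_false (not_adj_of_mem_comps (hK hX) (hK hY) ?_ hu hv) fun e => by linarith [e.1]
      rintro rfl
      exact lt_irrefl _ h
  · rintro c hcC v ⟨X, hX, hv⟩
    have hlev := hle v ⟨X, hX, hv⟩
    by_cases hne : {Z ∈ K | c ∈ cl G C Z}.Nonempty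
    swap
    · have hcX : c ∉ cl G C X := fun hc => hne ⟨X, hX, hc⟩
      refine iff_of_true (adj_of_notMem_cl hcC hcX hv) (Or.inr ?_)
      simp only [b, if_neg hne]
      rw [hr X hX v hv]
      have := Real.sigmoid_pos (R X v)
      positivity
    obtain ⟨⟨hF, hcF⟩, ⟨hE, hcE⟩, hFE'⟩ := hFE c hne
    rw [ha _ hF c hcF, hb _ hF c hcF, hl X hX v hv, hr X hX v hv]
    by_cases hcX : c ∈ cl G C X
    · obtain ⟨hFX, hXE⟩ := hFE' X hX hcX
      have hloc := (hL X hX).1.adj_center c hcX v hv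
      rcases hFX.eq_or_lt with hFX | hFX
      · have hFX := hinj _ hF _ hX hFX
        rcases hXE.eq_or_lt with hXE | hXE
        · have hXE := hinj _ hX _ hE hXE
          rw [hloc, hFX, ← hXE]
          simp only [add_le_add_iff_left, Real.sigmoid_le_iff]
        -- The glued right threshold lies in a later block. Nothing is lost, since c is shared with
        -- E c and so does not reach X from the right in the local model either.
        · have h1 := add_sigmoid_lt hXE (R X v) (Lb (E c) c)
          have h2 := (hL X hX).2.2 c hcX
            (hB _ hE X hX ((hlt X hX _ hE).1 hXE) ⟨hcE, hcX⟩) v hv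
          rw [hloc, hFX, or_iff_left (not_le.2 h2), or_iff_left (not_le.2 h1)]
          simp only [add_le_add_iff_left, Real.sigmoid_le_iff]
      · have h1 := add_sigmoid_lt hFX (La (F c) c) (L X v)
        have h2 := (hL X hX).2.1 c hcX
          (hA _ hF X hX ((hlt _ hF X hX).1 hFX) ⟨hcF, hcX⟩) v hv
        rcases hXE.eq_or_lt with hXE | hXE
        · have hXE := hinj _ hX _ hE hXE
          rw [hloc, ← hXE, or_iff_right (not_le.2 h2), or_iff_right (not_le.2 h1)]
          simp only [add_le_add_iff_left, Real.sigmoid_le_iff]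
        · have h3 := add_sigmoid_lt hXE (R X v) (Lb (E c) c)
          refine iff_of_false ?_ (not_or.2 ⟨not_le.2 h1, not_le.2 h3⟩)
          exact (mem_clS_iff.1 (hglue _ hF X hX _ hE ((hlt _ hF X hX).1 hFX)
            ((hlt X hX _ hE).1 hXE) ⟨hcF, hcE⟩)).2 v hv
    · refine iff_of_true (adj_of_notMem_cl hcC hcX hv) ?_
      have hFX : k (F c) ≠ k X := fun e => hcX (hinj _ hF _ hX e ▸ hcF)
      have hXE : k X ≠ k (E c) := fun e => hcX (hinj _ hX _ hE e ▸ hcE)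
      rcases lt_or_gt_of_ne hFX with hFX | hFX
      · rcases lt_or_gt_of_ne hXE with hXE | hXE
        -- A component strictly between F c and E c has c in its C(X) by gluing. So a component
        -- completely adjacent to c lies before F c or after E c, where the thresholds grant
        -- adjacency.
        · exact absurd (clS_subset_cl (hK hX) (hglue _ hF X hX _ hE ((hlt _ hF X hX).1 hFX)
            ((hlt X hX _ hE).1 hXE) ⟨hcF, hcE⟩)) hcX
        · exact Or.inr (add_sigmoid_lt hXE _ _).le
      · exact Or.inl (add_sigmoid_lt hFX _ _).le
  · rw [← hlt I hI J hJ]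
    refine ⟨fun h => hsep I hI J hJ h, fun h => ?_⟩
    by_contra hcon
    obtain ⟨u, hu⟩ := nonempty_of_mem_comps (hK hI)
    obtain ⟨v, hv⟩ := nonempty_of_mem_comps (hK hJ)
    rcases (not_lt.1 hcon).eq_or_lt with e | e
    · obtain rfl := hinj J hJ I hI e
      linarith [h u hu u hu, hle u ⟨J, hJ, hu⟩]
    · linarith [h u hu v hv, hsep J hJ I hI e v hv u hu, hle u ⟨I, hI, hu⟩, hle v ⟨J, hJ, hv⟩]
  · intro X hX c hcX hcB v hv
    obtain ⟨⟨hF, hcF⟩, ⟨hE, hcE⟩, hFE'⟩ := hFE c ⟨X, hX, hcX⟩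
    rw [hr X hX v hv, hb X hX c hcX]
    rcases (hFE' X hX hcX).2.eq_or_lt with e | e
    · obtain e := hinj _ hX _ hE e
      rw [← e, add_lt_add_iff_left, Real.sigmoid_lt_iff]
      exact (hL X hX).2.2 c hcX hcB v hv
    · exact add_sigmoid_lt e _ _

/-- A chain of ambiguous components has a model on a half-line. -/
theorem IsChainAmb.exists_model [Finite V] (h : IsChainAmb G C K)
    (hsimple : ∀ I ∈ ambiguousSimple G C, ∀ J ∈ ambiguousSimple G C, cl G C I = cl G C J → I = J) :
    ∃ l r d : V → ℝ, (∀ v ∈ ⋃₀ K, l v ≤ r v) ∧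
      (∀ u ∈ ⋃₀ K, ∀ v ∈ ⋃₀ K, u ≠ v → (G.Adj u v ↔ l u ≤ r v ∧ l v ≤ r u)) ∧
      ∀ c ∈ C, ∀ v ∈ ⋃₀ K, (G.Adj c v ↔ l v ≤ d c) := by
  classical
  have hK : K ⊆ comps G C := fun I hI => (h.1 hI).1
  have hlin : IsStrictLinearOn K (Below G C) := by
    refine ⟨fun I _ hII => hII.1 rfl, fun I hI J hJ L hL hIJ hJL => ⟨?_, ?_⟩, fun I hI J hJ hne =>
      (h.2 I hI J hJ).resolve_left hne⟩
    · rintro rfl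
      exact hIJ.asymm hsimple (h.1 hI) (h.1 hJ) hJL
    · exact hIJ.2.trans ((clS_subset_cl (hK hJ)).trans hJL.2)
  -- Taking B X to be all of C(X) keeps right thresholds from being used inside X.
  obtain ⟨l, r, a, b, hm, hord, hbd⟩ := exists_lineModel hK hlin
    (A := fun X => clS G C X) (B := fun X => cl G C X)
    (fun I _ X _ J _ hIX _ c hc => hIX.2 hc.1)
    (fun I _ X _ hIX c hc => hIX.2 hc.1) (fun I _ X _ _ c hc => hc.2)
    (fun X hX => hasLocalModel_of_ambiguous (h.1 hX) inter_subset_left _)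
  obtain ⟨m, hm'⟩ := exists_gt_of_finite l
  -- A vertex adjacent to all of the chain must reach every left endpoint, hence the bound m.
  refine ⟨l, r, fun c => if ∃ X ∈ K, c ∈ cl G C X then a c else m, hm.le, hm.adj, ?_⟩
  rintro c hc v ⟨X, hX, hv⟩
  dsimp only
  split_ifs with hex
  · rw [hm.adj_center c hc v ⟨X, hX, hv⟩, or_iff_left_iff_imp]
    intro hbv
    by_cases hcX : c ∈ cl G C X
    · exact absurd hbv (not_le.2 (hbd X hX c hcX hcX v hv))
    · obtain ⟨Y, hY, hcY⟩ := hex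
      exfalso
      -- Otherwise Y ⊏ X would give c ∈ C(X). Thus X is to the left of Y, and the right threshold,
      -- being beyond Y, is not reached in X.
      have hXY : Below G C X Y := by
        rcases h.2 X hX Y hY with rfl | h' | h'
        · exact absurd hcY hcX
        · exact h'
        · exact absurd (clS_subset_cl (hK hX) (h'.2 hcY)) hcX
      obtain ⟨w, hw⟩ := nonempty_of_mem_comps (hK hY)
      have h1 := (hord X hX Y hY).1 hXY v hv w hw
      have h2 := hbd Y hY c hcY hcY w hw
      have h3 := hm.le w ⟨Y, hY, hw⟩
      linarith
  · refine iff_of_true (adj_of_notMem_cl hc (fun hcX => hex ⟨X, hX, hcX⟩) hv) (hm' v).le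

end Gluing

/-! ### Assembling a lollipop model -/

section Realization

variable {V : Type*} {G : SimpleGraph V} {C : Set V}

theorem stickPt_image_subset {x y : ℝ} (hx : 0 < x) (hy : y < 1) :
    stickPt '' Icc x y ⊆ stick \ {branchPt} := by
  rintro _ ⟨t, ht, rfl⟩
  refine ⟨mem_stick_iff.2 ⟨t, ⟨by linarith [ht.1], by linarith [ht.2]⟩, rfl⟩, fun e => ?_⟩
  have : t = 0 := stickPt_inj ((mem_singleton_iff.1 e).trans stickPt_zero.symm)
  linarith [ht.1]

/-- A vertex of C is drawn as an arc through P together with an initial segment of the stick. Since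
circle and stick meet only in P, its adjacencies on the two parts are independent, and the two line
models can be drawn separately. -/
theorem exists_lollipopModel (hC : G.IsClique C) {K K' : Set (Set V)}
    (hKK : K ∪ K' = comps G C) (hdisj : Disjoint K K') {l r a b l' r' d : V → ℝ}
    (hm : IsLineModel G C (⋃₀ K) l r a b) (hle' : ∀ v ∈ ⋃₀ K', l' v ≤ r' v)
    (hadj' : ∀ u ∈ ⋃₀ K', ∀ v ∈ ⋃₀ K', u ≠ v → (G.Adj u v ↔ l' u ≤ r' v ∧ l' v ≤ r' u))
    (hcen' : ∀ c ∈ C, ∀ v ∈ ⋃₀ K', (G.Adj c v ↔ l' v ≤ d c)) :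
    ∃ φ : V → Set ℂ, IsIntersectionModel lollipop G φ ∧ (∀ v, branchPt ∈ φ v ↔ v ∈ C) ∧
      circleComps G C φ = K ∧ stickComps G C φ = K' ∧
      ∀ I ∈ K, ∀ J ∈ K, (prec φ I J ↔ ∀ u ∈ I, ∀ v ∈ J, r u < l v) := by
  classical
  have hK : K ⊆ comps G C := hKK ▸ subset_union_left
  have hK' : K' ⊆ comps G C := hKK ▸ subset_union_right
  let φ : V → Set ℂ := fun v => if v ∈ C then
    gapArc (a v) (b v) ∪ stickPt '' Icc 0 (Real.sigmoid (d v)) else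
    if v ∈ ⋃₀ K then ivArc (l v) (r v) else
      stickPt '' Icc (Real.sigmoid (l' v)) (Real.sigmoid (r' v))
  have hcover : ∀ v, v ∈ C ∨ v ∈ ⋃₀ K ∨ v ∈ ⋃₀ K' := by
    intro v
    by_cases hv : v ∈ C
    · exact Or.inl hv
    · obtain ⟨I, hI, hvI⟩ := exists_mem_comps (G := G) hv
      rw [← hKK] at hI
      exact Or.inr (hI.imp (fun h => ⟨I, h, hvI⟩) fun h => ⟨I, h, hvI⟩)
  have hKC : ∀ v ∈ ⋃₀ K, v ∉ C := fun v ⟨I, hI, hv⟩ => notMem_of_mem_comps (hK hI) hv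
  have hKC' : ∀ v ∈ ⋃₀ K', v ∉ C := fun v ⟨I, hI, hv⟩ => notMem_of_mem_comps (hK' hI) hv
  have hKK' : ∀ v ∈ ⋃₀ K', v ∉ ⋃₀ K := by
    rintro v ⟨I, hI, hv⟩ ⟨J, hJ, hv'⟩
    have := eq_of_mem_comps (hK' hI) (hK hJ) hv hv'
    exact disjoint_left.1 hdisj hJ (this ▸ hI)
  have hφC : ∀ v ∈ C, φ v = gapArc (a v) (b v) ∪ stickPt '' Icc 0 (Real.sigmoid (d v)) :=
    fun v hv => if_pos hv
  have hφK : ∀ v ∈ ⋃₀ K, φ v = ivArc (l v) (r v) := fun v hv => by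
    simp only [φ, if_neg (hKC v hv), if_pos hv]
  have hφK' : ∀ v ∈ ⋃₀ K', φ v = stickPt '' Icc (Real.sigmoid (l' v)) (Real.sigmoid (r' v)) :=
    fun v hv => by simp only [φ, if_neg (hKC' v hv), if_neg (hKK' v hv)]
  have hsubC : ∀ v, stickPt '' Icc 0 (Real.sigmoid (d v)) ⊆ stick := by
    rintro v _ ⟨t, ht, rfl⟩
    exact mem_stick_iff.2 ⟨t, ⟨ht.1, ht.2.trans (Real.sigmoid_le_one _)⟩, rfl⟩
  have hsubK : ∀ v ∈ ⋃₀ K, φ v ⊆ circ \ {branchPt} := fun v hv => by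
    rw [hφK v hv]; exact ivArc_subset _ _
  have hsubK' : ∀ v ∈ ⋃₀ K', φ v ⊆ stick \ {branchPt} := fun v hv => by
    rw [hφK' v hv]; exact stickPt_image_subset (Real.sigmoid_pos _) (Real.sigmoid_lt_one _)
  have hPC : ∀ v ∈ C, branchPt ∈ φ v := fun v hv => by
    rw [hφC v hv]; exact Or.inl (branchPt_mem_gapArc _ _)
  have hconn : ∀ v, IsConnected (φ v) := by
    intro v
    rcases hcover v with hv | hv | hv
    · rw [hφC v hv]
      refine IsConnected.union ⟨branchPt, branchPt_mem_gapArc _ _, ?_⟩ (isConnected_gapArc _ _)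
        ((isConnected_Icc (Real.sigmoid_nonneg _)).image _ continuous_stickPt.continuousOn)
      exact ⟨0, ⟨le_rfl, Real.sigmoid_nonneg _⟩, stickPt_zero⟩
    · rw [hφK v hv]; exact isConnected_ivArc (hm.le v hv)
    · rw [hφK' v hv]
      exact (isConnected_Icc (Real.sigmoid_le (hle' v hv))).image _ continuous_stickPt.continuousOn
  have hcenter : ∀ c ∈ C, ∀ v ∈ ⋃₀ K, (G.Adj c v ↔ (φ c ∩ φ v).Nonempty) := by
    intro c hc v hv
    have hdis : stickPt '' Icc 0 (Real.sigmoid (d c)) ∩ ivArc (l v) (r v) = ∅ := by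
      ext z
      simp only [mem_inter_iff, mem_empty_iff_false, iff_false, not_and]
      exact fun h1 h2 => (ivArc_subset _ _ h2).2
        (circ_inter_stick (ivArc_subset _ _ h2).1 (hsubC c h1))
    rw [hm.adj_center c hc v hv, hφC c hc, hφK v hv, union_inter_distrib_right, hdis, union_empty,
      gapArc_inter_ivArc (hm.le v hv)]
  have hcenter' : ∀ c ∈ C, ∀ v ∈ ⋃₀ K', (G.Adj c v ↔ (φ c ∩ φ v).Nonempty) := by
    intro c hc v hv
    have hdis : gapArc (a c) (b c) ∩
        stickPt '' Icc (Real.sigmoid (l' v)) (Real.sigmoid (r' v)) = ∅ := by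
      ext z
      simp only [mem_inter_iff, mem_empty_iff_false, iff_false, not_and]
      intro h1 h2
      rw [← hφK' v hv] at h2
      exact (hsubK' v hv h2).2 (circ_inter_stick (gapArc_subset _ _ h1) (hsubK' v hv h2).1)
    rw [hcen' c hc v hv, hφC c hc, hφK' v hv, union_inter_distrib_right, hdis, empty_union,
      stick_image_inter_image_nonempty_iff (Real.sigmoid_nonneg _) (Real.sigmoid_le (hle' v hv)),
      Real.sigmoid_le_iff]
    exact ⟨fun h => ⟨Real.sigmoid_nonneg _, h⟩, fun h => h.2⟩
  have hcross : ∀ u ∈ ⋃₀ K, ∀ v ∈ ⋃₀ K', ¬ G.Adj u v ∧ ¬ (φ u ∩ φ v).Nonempty := by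
    intro u hu v hv
    constructor
    · obtain ⟨I, hI, huI⟩ := hu
      obtain ⟨J, hJ, hvJ⟩ := hv
      exact not_adj_of_mem_comps (hK hI) (hK' hJ)
        (fun e => disjoint_left.1 hdisj hI (e ▸ hJ)) huI hvJ
    · rintro ⟨z, hz, hz'⟩
      exact (hsubK u hu hz).2 (circ_inter_stick (hsubK u hu hz).1 (hsubK' v hv hz').1)
  refine ⟨φ, ⟨?_, ?_, hconn, ?_⟩, ?_, ?_, ?_, ?_⟩
  · intro v
    rcases hcover v with hv | hv | hv
    · rw [hφC v hv]
      exact union_subset_union (gapArc_subset _ _) (hsubC v)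
    · exact ((hsubK v hv).trans sdiff_subset).trans subset_union_left
    · exact ((hsubK' v hv).trans sdiff_subset).trans subset_union_right
  · intro v
    rcases hcover v with hv | hv | hv
    · rw [hφC v hv]
      exact (isCompact_gapArc _ _).union (isCompact_Icc.image continuous_stickPt)
    · rw [hφK v hv]; exact isCompact_ivArc _ _
    · rw [hφK' v hv]; exact isCompact_Icc.image continuous_stickPt
  · intro u v huv
    rcases hcover u with hu | hu | hu <;> rcases hcover v with hv | hv | hv
    · exact iff_of_true (hC hu hv huv) ⟨_, hPC u hu, hPC v hv⟩
    · exact hcenter u hu v hv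
    · exact hcenter' u hu v hv
    · rw [G.adj_comm, inter_comm]; exact hcenter v hv u hu
    · rw [hm.adj u hu v hv huv, hφK u hu, hφK v hv, ivArc_inter_ivArc (hm.le u hu) (hm.le v hv)]
    · exact iff_of_false (hcross u hu v hv).1 (hcross u hu v hv).2
    · rw [G.adj_comm, inter_comm]; exact hcenter' v hv u hu
    · rw [G.adj_comm, inter_comm]; exact iff_of_false (hcross v hv u hu).1 (hcross v hv u hu).2
    · rw [hadj' u hu v hv huv, hφK' u hu, hφK' v hv, stick_image_inter_image_nonempty_iff
        (Real.sigmoid_le (hle' u hu)) (Real.sigmoid_le (hle' v hv)), Real.sigmoid_le_iff,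
        Real.sigmoid_le_iff]
  · intro v
    refine ⟨fun h => ?_, hPC v⟩
    rcases hcover v with hv | hv | hv
    · exact hv
    · exact absurd rfl (hsubK v hv h).2
    · exact absurd rfl (hsubK' v hv h).2
  · ext I
    constructor
    · rintro ⟨hI, hsub⟩
      obtain ⟨v, hv⟩ := nonempty_of_mem_comps hI
      obtain ⟨z, hz⟩ := (hconn v).nonempty
      rw [← hKK] at hI
      refine hI.resolve_right fun hI' => ?_
      have h1 := hsub v hv hz
      exact h1.2 (circ_inter_stick h1.1 (hsubK' v ⟨I, hI', hv⟩ hz).1)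
    · exact fun hI => ⟨hK hI, fun v hv => hsubK v ⟨I, hI, hv⟩⟩
  · ext I
    constructor
    · rintro ⟨hI, hsub⟩
      obtain ⟨v, hv⟩ := nonempty_of_mem_comps hI
      obtain ⟨z, hz⟩ := (hconn v).nonempty
      rw [← hKK] at hI
      refine hI.resolve_left fun hI' => ?_
      have h1 := hsub v hv hz
      exact h1.2 (circ_inter_stick (hsubK v ⟨I, hI', hv⟩ hz).1 h1.1)
    · exact fun hI => ⟨hK' hI, fun v hv => hsubK' v ⟨I, hI, hv⟩⟩
  · intro I hI J hJ
    constructor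
    · intro h u hu v hv
      rw [← Real.sigmoid_lt_iff]
      refine h _ (sigmoid_mem _) _ (sigmoid_mem _) (mem_iUnion₂.2 ⟨u, hu, ?_⟩)
        (mem_iUnion₂.2 ⟨v, hv, ?_⟩)
      · rw [hφK u ⟨I, hI, hu⟩]
        exact ⟨_, ⟨Real.sigmoid_le (hm.le u ⟨I, hI, hu⟩), le_rfl⟩, rfl⟩
      · rw [hφK v ⟨J, hJ, hv⟩]
        exact ⟨_, ⟨le_rfl, Real.sigmoid_le (hm.le v ⟨J, hJ, hv⟩)⟩, rfl⟩
    · intro h x hx y hy hxI hyJ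
      obtain ⟨u, hu, hxu⟩ := mem_iUnion₂.1 hxI
      obtain ⟨v, hv, hyv⟩ := mem_iUnion₂.1 hyJ
      rw [hφK u ⟨I, hI, hu⟩, ivArc, circPt_mem_image_iff (Real.sigmoid_pos _)
        (Real.sigmoid_lt_one _) hx] at hxu
      rw [hφK v ⟨J, hJ, hv⟩, ivArc, circPt_mem_image_iff (Real.sigmoid_pos _)
        (Real.sigmoid_lt_one _) hy] at hyv
      have := Real.sigmoid_lt (h u hu v hv)
      linarith [hxu.2, hyv.1]

end Realization

/-! ### From good triples to centered models -/

section GoodOrder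

variable {V : Type*} {G : SimpleGraph V} {C : Set V} {H : G.Subgraph} {K : Set (Set V)}
  {s : Set V → Set V → Prop} {l : List (Set V)} {T : PQTree (Set V)} {i j : ℕ} {I X Y : Set V}

namespace IsGoodOrderWith

theorem exists_mem_zone (h : IsGoodOrderWith C K s l H T) (hX : X ∈ K) :
    ∃ i ∈ Icc 1 l.length, X ∈ zone G C K s l i := by
  rw [h.zone_union] at hX
  obtain ⟨i, hi, hXi⟩ := mem_iUnion₂.1 hX
  exact ⟨i, hi, hXi⟩

theorem le_of_lt (h : IsGoodOrderWith C K s l H T) (hs : IsStrictLinearOn K s)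
    (hi : i ∈ Icc 1 l.length) (hj : j ∈ Icc 1 l.length) (hX : X ∈ zone G C K s l i)
    (hY : Y ∈ zone G C K s l j) (hXY : s X Y) : i ≤ j := by
  by_contra hcon
  have hXK := IsCentralOrderWith.mem_of_mem_zone hX
  have hYK := IsCentralOrderWith.mem_of_mem_zone hY
  exact hs.asymm hXK hYK hXY (h.zone_prec j hj i hi (not_le.1 hcon) Y hY X hX)

/-- A vertex u of C(X) outside C(𝕃_i) would first appear in a later leaf 𝕃_k. Then u witnesses that
X is also in the left zone of 𝕃_k, which contradicts disjointness of the zones. -/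
theorem zoneL_clique_subset [Finite V] (h : IsGoodOrderWith C K s l H T)
    (hs : IsStrictLinearOn K s) (hl : IsConsecutive H l) (hi : i ∈ Icc 1 l.length)
    (hX : X ∈ zoneL G C K s l i) (hQ : IsCliqueOf H (cl G C X)) : cl G C X ⊆ leafAt l i := by
  classical
  obtain ⟨v, hvX, hvi, hvi'⟩ := hX.2.2
  obtain ⟨j, hj, hXj⟩ := hl.exists_subset_leafAt hQ ⟨v, hvX⟩
  rcases lt_trichotomy j i with hji | rfl | hij
  · exact absurd (hl.mem_leafAt (by omega) (Nat.sub_le _ _) (hXj hvX) hvi) hvi'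
  · exact hXj
  intro u hu
  by_contra hui
  have hex : ∃ k, i < k ∧ u ∈ leafAt l k := ⟨j, hij, hXj hu⟩
  obtain ⟨hk1, hk2⟩ := Nat.find_spec hex
  set k := Nat.find hex
  have hk := mem_Icc_of_mem_leafAt hk2
  have hk3 : u ∉ leafAt l (k - 1) := by
    intro hcon
    rcases (show i ≤ k - 1 by omega).eq_or_lt with e | e
    · exact hui (e ▸ hcon)
    · have := Nat.find_min' hex ⟨e, hcon⟩
      omega
  obtain ⟨A, hA⟩ := (h.interval i hi).1
  have hXk : X ∈ zoneL G C K s l k := by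
    refine ⟨hX.1, ?_, u, hu, hk2, hk3⟩
    rintro _ rfl B hB
    exact hs.2.1 _ hX.1 A hA.1 B hB.1 (hX.2.1 _ rfl A hA) (h.induced i hi k hk hk1 A hA B hB)
  exact disjoint_left.1 (h.zone_disjoint i hi k hk hk1.ne) (Or.inl (Or.inl hX))
    (Or.inl (Or.inl hXk))

theorem zoneR_clique_subset [Finite V] (h : IsGoodOrderWith C K s l H T)
    (hs : IsStrictLinearOn K s) (hl : IsConsecutive H l) (hi : i ∈ Icc 1 l.length)
    (hX : X ∈ zoneR G C K s l i) (hQ : IsCliqueOf H (cl G C X)) : cl G C X ⊆ leafAt l i := by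
  classical
  obtain ⟨v, hvX, hvi, hvi'⟩ := hX.2.2
  obtain ⟨j, hj, hXj⟩ := hl.exists_subset_leafAt hQ ⟨v, hvX⟩
  rcases lt_trichotomy j i with hji | rfl | hij
  swap
  · exact hXj
  swap
  · exact absurd (hl.mem_leafAt (Nat.le_succ _) (by omega) hvi (hXj hvX)) hvi'
  intro u hu
  by_contra hui
  let P : ℕ → Prop := fun k => u ∈ leafAt l k
  -- Mirror image: k is the last leaf before i that contains u, so u ends at 𝕃_k.
  have hk2 : P (Nat.findGreatest P (i - 1)) :=
    Nat.findGreatest_spec (P := P) (m := j) (by omega) (hXj hu)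
  have hk1 : Nat.findGreatest P (i - 1) ≤ i - 1 := Nat.findGreatest_le _
  have hmax : ∀ m, Nat.findGreatest P (i - 1) < m → m ≤ i - 1 → ¬ P m :=
    fun m hm hm' => Nat.findGreatest_is_greatest hm hm'
  set k := Nat.findGreatest P (i - 1)
  have hk := mem_Icc_of_mem_leafAt hk2
  have hki : k < i := by have := hi.1; omega
  have hk3 : u ∉ leafAt l (k + 1) := by
    intro hcon
    rcases (show k + 1 ≤ i by omega).eq_or_lt with e | e
    · exact hui (e ▸ hcon)
    · exact hmax (k + 1) (Nat.lt_succ_self _) (by omega) hcon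
  obtain ⟨A, hA⟩ := (h.interval i hi).1
  have hXk : X ∈ zoneR G C K s l k := by
    refine ⟨hX.1, ?_, u, hu, hk2, hk3⟩
    rintro B hB _ rfl
    exact hs.2.1 B hB.1 A hA.1 _ hX.1 (h.induced k hk i hi hki B hB A hA) (hX.2.1 A hA _ rfl)
  exact disjoint_left.1 (h.zone_disjoint i hi k hk hki.ne') (Or.inr hX) (Or.inr hXk)

theorem inner_cases [Finite V] (h : IsGoodOrderWith C K s l H T) (hs : IsStrictLinearOn K s)
    (hi : i ∈ Icc 1 l.length) :
    (∃ IS, inner G C K l i = {IS}) ∨ ((inner G C K l i).Nontrivial ∧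
      ∃ IL ∈ inner G C K l i, (∀ X ∈ inner G C K l i, X ≠ IL → s IL X) ∧
      ∃ IR ∈ inner G C K l i, ∀ X ∈ inner G C K l i, X ≠ IR → s X IR) := by
  have hne := (h.interval i hi).1
  rcases hne.exists_eq_singleton_or_nontrivial with hsing | hnt
  · exact Or.inl hsing
  obtain ⟨IL, hIL, hIL'⟩ := exists_min_image _ (rank K s) (toFinite _) hne
  obtain ⟨IR, hIR, hIR'⟩ := exists_max_image _ (rank K s) (toFinite _) hne
  refine Or.inr ⟨hnt, IL, hIL, fun X hX hX' => ?_, IR, hIR, fun X hX hX' => ?_⟩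
  · exact hs.lt_of_not_lt hIL.1 hX.1 hX'.symm fun e =>
      absurd (hs.rank_lt hX.1 hIL.1 e) (not_lt.2 (hIL' X hX))
  · exact hs.lt_of_not_lt hX.1 hIR.1 hX' fun e =>
      absurd (hs.rank_lt hIR.1 hX.1 e) (not_lt.2 (hIR' X hX))

theorem isSideClique_cl_subset {Z : Set (Set V)} {border B : Set V}
    (hB : IsSideClique G C Z border B) (hZ : Z ⊆ comps G C) (hX : X ∈ Z) : cl G C X ⊆ B := by
  rcases hB with ⟨M, hM, hmax, rfl⟩ | ⟨rfl, -⟩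
  · rcases hmax X hX with rfl | hb
    · exact subset_rfl
    · exact hb.2.trans (clS_subset_cl (hZ hM))
  · exact absurd hX (notMem_empty X)

/-- With a single inner component, the side clique is a clique of H, contains C(X) for every X in
the zone, and lies in the leaf. With several, C(X) ⊆ C^s(I_L) or C(X) ⊆ C^s(I_R) suffices. -/
theorem cl_subset_of_zone [Finite V] (h : IsGoodOrderWith C K s l H T)
    (hs : IsStrictLinearOn K s) (hl : IsConsecutive H l) (hK : K ⊆ comps G C)
    (hi : i ∈ Icc 1 l.length) (hX : X ∈ zone G C K s l i) : cl G C X ⊆ leafAt l i := by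
  rcases hX with (hX | hX) | hX
  · rcases h.inner_cases hs hi with ⟨IS, hIS⟩ | ⟨hnt, IL, hIL, hIL', IR, hIR, hIR'⟩
    · obtain ⟨CL, CR, h1, h2, h3, h4, -⟩ := h.single i hi IS hIS
      refine (isSideClique_cl_subset h1 (fun Z hZ => hK hZ.1) hX).trans ?_
      rcases h1 with ⟨M, hM, hmax, rfl⟩ | ⟨he, rfl⟩
      · exact h.zoneL_clique_subset hs hl hi hM h3
      · exact inter_subset_right
    · obtain ⟨-, -, -, hb, -⟩ := h.multi i hi hnt IL hIL hIL' IR hIR hIR'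
      rw [← hIL.2]
      exact (hb X hX IL rfl).2.trans (clS_subset_cl (hK hIL.1))
  · exact hX.2.subset
  · rcases h.inner_cases hs hi with ⟨IS, hIS⟩ | ⟨hnt, IL, hIL, hIL', IR, hIR, hIR'⟩
    · obtain ⟨CL, CR, h1, h2, h3, h4, -⟩ := h.single i hi IS hIS
      refine (isSideClique_cl_subset h2 (fun Z hZ => hK hZ.1) hX).trans ?_
      rcases h2 with ⟨M, hM, hmax, rfl⟩ | ⟨he, rfl⟩
      · exact h.zoneR_clique_subset hs hl hi hM h4
      · exact inter_subset_left
    · obtain ⟨-, -, -, -, -, hb, -⟩ := h.multi i hi hnt IL hIL hIL' IR hIR hIR'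
      rw [← hIR.2]
      exact (hb X hX IR rfl).2.trans (clS_subset_cl (hK hIR.1))

/-- A component in an earlier zone has its clique in an earlier leaf, so a vertex it shares with 𝕃_i
is in 𝕃_{i-1} by consecutiveness. Constraints from the left thus come only from the left zone or the
border. -/
theorem mem_zoneL_or [Finite V] (h : IsGoodOrderWith C K s l H T) (hs : IsStrictLinearOn K s)
    (hl : IsConsecutive H l) (hK : K ⊆ comps G C) (hi : i ∈ Icc 1 l.length)
    (hY : Y ∈ inner G C K l i) (hI : I ∈ K) (hIY : s I Y) (hI' : I ∉ inner G C K l i) {c : V}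
    (hc : c ∈ cl G C I) (hci : c ∈ leafAt l i) :
    I ∈ zoneL G C K s l i ∨ c ∈ leafAt l (i - 1) ∩ leafAt l i := by
  obtain ⟨j, hj, hIj⟩ := h.exists_mem_zone hI
  have hji := h.le_of_lt hs hj hi hIj (Or.inl (Or.inr hY)) hIY
  rcases hji.eq_or_lt with rfl | hlt
  · left
    rcases hIj with (hIj | hIj) | hIj
    · exact hIj
    · exact absurd hIj hI'
    · exact absurd (hIj.2.1 Y hY I rfl) (hs.asymm hI hY.1 hIY)
  · exact Or.inr ⟨hl.mem_leafAt (by omega) (Nat.sub_le _ _)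
      (h.cl_subset_of_zone hs hl hK hj hIj hc) hci, hci⟩

theorem mem_zoneR_or [Finite V] (h : IsGoodOrderWith C K s l H T) (hs : IsStrictLinearOn K s)
    (hl : IsConsecutive H l) (hK : K ⊆ comps G C) (hi : i ∈ Icc 1 l.length)
    (hY : Y ∈ inner G C K l i) (hI : I ∈ K) (hYI : s Y I) (hI' : I ∉ inner G C K l i) {c : V}
    (hc : c ∈ cl G C I) (hci : c ∈ leafAt l i) :
    I ∈ zoneR G C K s l i ∨ c ∈ leafAt l i ∩ leafAt l (i + 1) := by
  obtain ⟨j, hj, hIj⟩ := h.exists_mem_zone hI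
  have hij := h.le_of_lt hs hi hj (Or.inl (Or.inr hY)) hIj hYI
  rcases hij.eq_or_lt with rfl | hlt
  · left
    rcases hIj with (hIj | hIj) | hIj
    · exact absurd (hIj.2.1 I rfl Y hY) (hs.asymm hY.1 hI hYI)
    · exact absurd hIj hI'
    · exact hIj
  · exact Or.inr ⟨hci, hl.mem_leafAt (Nat.le_succ _) (by omega) hci
      (h.cl_subset_of_zone hs hl hK hj hIj hc)⟩

theorem zoneL_mem_clS [Finite V] (h : IsGoodOrderWith C K s l H T) (hs : IsStrictLinearOn K s)
    (hl : IsConsecutive H l) (hK : K ⊆ comps G C) (hi : i ∈ Icc 1 l.length)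
    (hX : X ∈ zoneL G C K s l i) (hI : I ∈ K) (hIX : s I X) {c : V} (hc : c ∈ cl G C I)
    (hci : c ∈ leafAt l i) : c ∈ clS G C X := by
  obtain ⟨A, hA⟩ := (h.interval i hi).1
  obtain ⟨-, hresp, hord⟩ := h.zoneL_chain i hi
  rcases h.mem_zoneL_or hs hl hK hi hA hI (hs.2.1 I hI X hX.1 A hA.1 hIX (hX.2.1 X rfl A hA))
    (fun e => hs.asymm hI hX.1 hIX (hX.2.1 X rfl I e)) hc hci with hIz | hcB
  · exact ((hord I hIz X hX).2 hIX).2 hc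
  · exact hresp X hX hcB

theorem zoneR_mem_clS [Finite V] (h : IsGoodOrderWith C K s l H T) (hs : IsStrictLinearOn K s)
    (hl : IsConsecutive H l) (hK : K ⊆ comps G C) (hi : i ∈ Icc 1 l.length)
    (hX : X ∈ zoneR G C K s l i) (hI : I ∈ K) (hXI : s X I) {c : V} (hc : c ∈ cl G C I)
    (hci : c ∈ leafAt l i) : c ∈ clS G C X := by
  obtain ⟨A, hA⟩ := (h.interval i hi).1
  obtain ⟨-, hresp, hord⟩ := h.zoneR_chain i hi
  rcases h.mem_zoneR_or hs hl hK hi hA hI (hs.2.1 A hA.1 X hX.1 I hI (hX.2.1 A hA X rfl) hXI)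
    (fun e => hs.asymm hX.1 hI hXI (hX.2.1 I e X rfl)) hc hci with hIz | hcB
  · exact ((hord I hIz X hX).2 hXI).2 hc
  · exact hresp X hX hcB

/-- The left and right sides of an inner component: either both sides are described by cliques for
which the extended graph is a circular-arc graph, or one of the sides is not constrained. -/
theorem inner_sides [Finite V] (h : IsGoodOrderWith C K s l H T) (hs : IsStrictLinearOn K s)
    (hl : IsConsecutive H l) (hK : K ⊆ comps G C) (hi : i ∈ Icc 1 l.length)
    (hX : X ∈ inner G C K l i) :
    (∃ CL CR, (∀ I ∈ K, s I X → cl G C I ∩ cl G C X ⊆ CL) ∧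
      (∀ I ∈ K, s X I → cl G C I ∩ cl G C X ⊆ CR) ∧
      (∀ c ∈ cl G C X, c ∈ CL → c ∈ CR → c ∈ clS G C X) ∧
      IsCircularArc (extGraph G C CL X CR)) ∨
    (X ∈ ambiguous G C ∧ ((∀ I ∈ K, s I X → cl G C I ∩ cl G C X ⊆ clS G C X) ∨
      ∀ I ∈ K, s X I → cl G C I ∩ cl G C X ⊆ clS G C X)) := by
  rcases h.inner_cases hs hi with ⟨IS, hIS⟩ | ⟨hnt, IL, hIL, hIL', IR, hIR, hIR'⟩
  · left
    obtain rfl : X = IS := by rw [hIS] at hX; exact hX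
    have hnot : ∀ I ∈ K, I ≠ X → I ∉ inner G C K l i := fun I _ hne hI => hne (by
      rw [hIS] at hI; exact hI)
    obtain ⟨CL, CR, h1, h2, h3, h4, h5, h6⟩ := h.single i hi X hIS
    refine ⟨CL, CR, ?_, ?_, ?_, h6⟩
    · rintro I hI hIX c ⟨hc, hcX⟩
      rw [hX.2] at hcX
      rcases h.mem_zoneL_or hs hl hK hi hX hI hIX
        (hnot I hI fun e => hs.1 X hX.1 (by rwa [e] at hIX)) hc hcX with hIz | hcB
      · exact isSideClique_cl_subset h1 (fun Z hZ => hK hZ.1) hIz hc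
      -- If the zone is nonempty, its maximum respects the border, so the border is contained in the
      -- side clique.
      · rcases h1 with ⟨M, hM, -, rfl⟩ | ⟨-, rfl⟩
        · exact clS_subset_cl (hK hM.1) ((h.zoneL_chain i hi).2.1 M hM hcB)
        · exact hcB
    · rintro I hI hXI c ⟨hc, hcX⟩
      rw [hX.2] at hcX
      rcases h.mem_zoneR_or hs hl hK hi hX hI hXI
        (hnot I hI fun e => hs.1 X hX.1 (by rwa [e] at hXI)) hc hcX with hIz | hcB
      · exact isSideClique_cl_subset h2 (fun Z hZ => hK hZ.1) hIz hc
      · rcases h2 with ⟨M, hM, -, rfl⟩ | ⟨-, rfl⟩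
        · exact clS_subset_cl (hK hM.1) ((h.zoneR_chain i hi).2.1 M hM hcB)
        · exact hcB
    · intro c hc hcL hcR
      refine ⟨hc.1, fun hn => ?_⟩
      rcases h5 ⟨hn, hc.2⟩ with e | e
      · exact e.2 hcL
      · exact e.2 hcR
  · right
    obtain ⟨hamb, -, hmid, hbL, hrL, hbR, hrR⟩ := h.multi i hi hnt IL hIL hIL' IR hIR hIR'
    refine ⟨hamb hX, ?_⟩
    by_cases e : X = IL
    · left
      subst e
      rintro I hI hIX c ⟨hc, hcX⟩
      rw [hX.2] at hcX
      rcases h.mem_zoneL_or hs hl hK hi hX hI hIX (fun e => hs.asymm hI hX.1 hIX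
        (hIL' I e fun e' => hs.1 X hX.1 (by rwa [e'] at hIX))) hc hcX with hIz | hcB
      · exact (hbL I hIz X rfl).2 hc
      · exact hrL X (Or.inr rfl) hcB
    by_cases e' : X = IR
    · right
      subst e'
      rintro I hI hXI c ⟨hc, hcX⟩
      rw [hX.2] at hcX
      rcases h.mem_zoneR_or hs hl hK hi hX hI hXI (fun e => hs.asymm hX.1 hI hXI
        (hIR' I e fun e' => hs.1 X hX.1 (by rwa [e'] at hXI))) hc hcX with hIz | hcB
      · exact (hbR I hIz X rfl).2 hc
      · exact hrR X (Or.inr rfl) hcB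
    -- A middle component is simple: C(X) = C^s(X), and nothing has to be checked.
    · left
      rintro I - - c ⟨-, hcX⟩
      have := nbr_eq_strongNbr_iff.1 (hmid ⟨hX, by simp [e, e']⟩).2
      rwa [this]

/-- Consecutiveness places c in the leaf whose zone contains X. In a left or right zone the chain
and border conditions finish the proof; for an inner component the side conditions do. -/
theorem glue [Finite V] (h : IsGoodOrderWith C K s l H T) (hs : IsStrictLinearOn K s)
    (hl : IsConsecutive H l) (hK : K ⊆ comps G C) (hI : I ∈ K) (hX : X ∈ K) (hY : Y ∈ K)
    (hIX : s I X) (hXY : s X Y) : cl G C I ∩ cl G C Y ⊆ clS G C X := by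
  rintro c ⟨hcI, hcY⟩
  obtain ⟨i, hi, hIi⟩ := h.exists_mem_zone hI
  obtain ⟨k, hk, hXk⟩ := h.exists_mem_zone hX
  obtain ⟨j, hj, hYj⟩ := h.exists_mem_zone hY
  have hck := hl.mem_leafAt (h.le_of_lt hs hi hk hIi hXk hIX) (h.le_of_lt hs hk hj hXk hYj hXY)
    (h.cl_subset_of_zone hs hl hK hi hIi hcI) (h.cl_subset_of_zone hs hl hK hj hYj hcY)
  rcases hXk with (hXk | hXk) | hXk
  · exact h.zoneL_mem_clS hs hl hK hk hXk hI hIX hcI hck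
  · have hcX : c ∈ cl G C X := hXk.2.symm ▸ hck
    rcases h.inner_sides hs hl hK hk hXk with ⟨CL, CR, h1, h2, h3, -⟩ | ⟨-, h1 | h1⟩
    · exact h3 c hcX (h1 I hI hIX ⟨hcI, hcX⟩) (h2 Y hY hXY ⟨hcY, hcX⟩)
    · exact h1 I hI hIX ⟨hcI, hcX⟩
    · exact h1 Y hY hXY ⟨hcY, hcX⟩
  · exact h.zoneR_mem_clS hs hl hK hk hXk hY hXY hcY hck

/-- Zone members are ambiguous and constrained on one side only, the other side being free. A single
inner component uses the circular-arc model of its extended graph; several inner components are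
ambiguous with one harmless side. -/
theorem hasLocalModel [Finite V] (h : IsGoodOrderWith C K s l H T) (hs : IsStrictLinearOn K s)
    (hl : IsConsecutive H l) (hK : K ⊆ comps G C) (hX : X ∈ K) :
    HasLocalModel G C X {c | ∃ I ∈ K, s I X ∧ c ∈ cl G C I}
      {c | ∃ I ∈ K, s X I ∧ c ∈ cl G C I} := by
  obtain ⟨k, hk, hXk⟩ := h.exists_mem_zone hX
  have hsub := h.cl_subset_of_zone hs hl hK hk hXk
  rcases hXk with (hXk | hXk) | hXk
  · refine hasLocalModel_of_ambiguous ((h.zoneL_chain k hk).1.1 hXk) ?_ _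
    rintro c ⟨⟨I, hI, hIX, hcI⟩, hcX⟩
    exact h.zoneL_mem_clS hs hl hK hk hXk hI hIX hcI (hsub hcX)
  · rcases h.inner_sides hs hl hK hk hXk with ⟨CL, CR, h1, h2, h3, h4⟩ | ⟨hamb, h1 | h1⟩
    · refine (hasLocalModel_of_isCircularArc (hK hX) h4 h3).mono ?_ ?_
      · rintro c ⟨⟨I, hI, hIX, hcI⟩, hcX⟩
        exact h1 I hI hIX ⟨hcI, hcX⟩
      · rintro c ⟨⟨I, hI, hIX, hcI⟩, hcX⟩
        exact h2 I hI hIX ⟨hcI, hcX⟩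
    · refine hasLocalModel_of_ambiguous hamb ?_ _
      rintro c ⟨⟨I, hI, hIX, hcI⟩, hcX⟩
      exact h1 I hI hIX ⟨hcI, hcX⟩
    · refine (hasLocalModel_of_ambiguous hamb ?_ _).symm
      rintro c ⟨⟨I, hI, hIX, hcI⟩, hcX⟩
      exact h1 I hI hIX ⟨hcI, hcX⟩
  · refine (hasLocalModel_of_ambiguous ((h.zoneR_chain k hk).1.1 hXk) ?_ _).symm
    rintro c ⟨⟨I, hI, hXI, hcI⟩, hcX⟩
    exact h.zoneR_mem_clS hs hl hK hk hXk hI hXI hcI (hsub hcX)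

end IsGoodOrderWith

/-- The sets φ*(c) model H for two reasons: every C(I) lies in a leaf and so is a clique of H, and
every vertex and every edge of H lies in a leaf, which is C(A) for an inner component A. -/
theorem IsGoodTriple.exists_isCenteredModel [Finite V] (hC : G.IsClique C)
    (hT : IsPQTreeOf H T)
    (hsimple : ∀ I ∈ ambiguousSimple G C, ∀ J ∈ ambiguousSimple G C, cl G C I = cl G C J → I = J)
    {D J J' : Set (Set V)} (hD : D ⊆ forcedToStick C H) (h : IsGoodTriple C H T D J J' s) :
    ∃ φ : V → Set ℂ, IsCenteredModel C H φ ∧ J = circleComps G C φ ∧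
      (∀ I ∈ J, ∀ I' ∈ J, (s I I' ↔ prec φ I I')) ∧ J' ∪ D = stickComps G C φ := by
  obtain ⟨hunion, hdisj, ⟨hs, l, hgood⟩, hchain⟩ := h
  have hl := (hT l).1 hgood.admissible
  have hJ : J ⊆ comps G C \ D := hunion ▸ subset_union_left
  have hK : J ⊆ comps G C := hJ.trans sdiff_subset
  obtain ⟨lv, rv, a, b, hm, hord, -⟩ := exists_lineModel hK hs
    (A := fun X => {c | ∃ I ∈ J, s I X ∧ c ∈ cl G C I})
    (B := fun X => {c | ∃ I ∈ J, s X I ∧ c ∈ cl G C I})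
    (fun I hI X hX Y hY hIX hXY => hgood.glue hs hl hK hI hX hY hIX hXY)
    (fun I hI X hX hIX c hc => ⟨I, hI, hIX, hc.1⟩)
    (fun I hI X hX hXI c hc => ⟨I, hI, hXI, hc.1⟩)
    (fun X hX => hgood.hasLocalModel hs hl hK hX)
  obtain ⟨l', r', d, hle', hadj', hcen'⟩ := hchain.exists_model hsimple
  have hcomps : J ∪ (J' ∪ D) = comps G C := by
    rw [← union_assoc, hunion]
    exact sdiff_union_of_subset fun I hI => (hD hI).1.1
  have hdisj' : Disjoint J (J' ∪ D) := by
    rw [disjoint_union_right]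
    exact ⟨hdisj, disjoint_left.2 fun I hI => (hJ hI).2⟩
  obtain ⟨φ, hφ, hP, hcirc, hstick, hprec⟩ :=
    exists_lollipopModel hC hcomps hdisj' hm hle' hadj' hcen'
  have hclique : ∀ I ∈ J, IsCliqueOf H (cl G C I) := by
    intro I hI
    obtain ⟨i, hi, hIi⟩ := hgood.exists_mem_zone hI
    exact (hl.isCliqueOf_leafAt i).mono (hgood.cl_subset_of_zone hs hl hK hi hIi)
  have hgap : ∀ c I, I ∈ gap G C φ c ↔ I ∈ J ∧ c ∈ cl G C I := by
    intro c I
    rw [gap, hcirc]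
    rfl
  have hmax : ∀ Q, IsCliqueOf H Q → Q.Nonempty → ∃ I ∈ J, Q ⊆ cl G C I := by
    intro Q hQ hne
    obtain ⟨i, hi, hQi⟩ := hl.exists_subset_leafAt hQ hne
    obtain ⟨A, hA⟩ := (hgood.interval i hi).1
    exact ⟨A, hA.1, hA.2.symm ▸ hQi⟩
  refine ⟨φ, ⟨hφ, hP, ?_, ?_, ?_⟩, hcirc.symm, fun I hI I' hI' => ?_, hstick.symm⟩
  · intro c hc
    obtain ⟨I, hI, hcI⟩ := hmax {c} (isCliqueOf_singleton hc) (singleton_nonempty c)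
    exact ⟨I, (hgap c I).2 ⟨hI, hcI rfl⟩⟩
  · rintro c ⟨-, hcH⟩
    ext I
    rw [hgap]
    refine iff_of_false (fun e => hcH ?_) (notMem_empty I)
    exact (hclique I e.1).1 e.2
  · intro u hu v hv huv
    constructor
    · intro huv'
      obtain ⟨I, hI, hsub⟩ := hmax {u, v} (isCliqueOf_pair huv') (insert_nonempty _ _)
      exact ⟨I, (hgap u I).2 ⟨hI, hsub (Or.inl rfl)⟩, (hgap v I).2 ⟨hI, hsub (Or.inr rfl)⟩⟩
    · rintro ⟨I, hIu, hIv⟩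
      rw [hgap] at hIu hIv
      exact (hclique I hIu.1).2 hIu.2 hIv.2 huv
  · rw [hord I hI I' hI', hprec I hI I' hI']

end GoodOrder

end Lollipop

theorem mainTheorem1 {V : Type*} [Finite V] (G : SimpleGraph V) (C : Set V) (hC : G.IsClique C)
    (H : G.Subgraph) (hH : H.verts ⊆ C)
    (T : Lollipop.PQTree (Set V)) (hT : Lollipop.IsPQTreeOf H T)
    (hsimple : ∀ I ∈ Lollipop.ambiguousSimple G C, ∀ J ∈ Lollipop.ambiguousSimple G C,
      Lollipop.cl G C I = Lollipop.cl G C J → I = J)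
    (hsector : ∀ I ∈ Lollipop.ambiguousSimple G C,
      ¬ Lollipop.IsMinSectorClique H (Lollipop.cl G C I))
    (D : Set (Set V)) (hD : D ⊆ Lollipop.forcedToStick C H) :
    (∀ φ : V → Set ℂ, Lollipop.IsCenteredModel C H φ →
      Lollipop.IsGoodTriple C H T D (Lollipop.circleComps G C φ)
        (Lollipop.stickComps G C φ \ D) (Lollipop.prec φ)) ∧
    (∀ (J J' : Set (Set V)) (r : Set V → Set V → Prop),
      Lollipop.IsGoodTriple C H T D J J' r →
      ∃ φ : V → Set ℂ, Lollipop.IsCenteredModel C H φ ∧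
        J = Lollipop.circleComps G C φ ∧
        (∀ I ∈ J, ∀ I' ∈ J, (r I I' ↔ Lollipop.prec φ I I')) ∧
        J' ∪ D = Lollipop.stickComps G C φ) ∧
    ((∃ φ : V → Set ℂ, Lollipop.IsCenteredModel C H φ) ↔
      ∃ (J J' : Set (Set V)) (r : Set V → Set V → Prop),
        Lollipop.IsGoodTriple C H T D J J' r) := by
  refine ⟨fun φ hφ => hφ.isGoodTriple hC hT hsimple hsector hD, fun J J' r h =>
    h.exists_isCenteredModel hC hT hsimple hD, ?_⟩
  constructor
  · rintro ⟨φ, hφ⟩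
    exact ⟨_, _, _, hφ.isGoodTriple hC hT hsimple hsector hD⟩
  · rintro ⟨J, J', r, h⟩
    obtain ⟨φ, hφ, -⟩ := h.exists_isCenteredModel hC hT hsimple hD
    exact ⟨φ, hφ⟩
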